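/- Let $n\ge 2$, $1<p<\infty$, and let $H:\mathbb R^n\to[0,+\infty)$ be of class $C^2(\mathbb R^n\setminus\{0\})$ and such that * $H(t\xi)=|t|H(\xi)$ for all $t\in\mathbb R$, $\xi\in\mathbb R^n$; * every sublevel set $\{\xi : H(\xi)\le t\}$, $t>0$, is strictly convex; * there are constants $0<a\le b$ with $a|\xi|\le H(\xi)\le b|\xi|$ for all $\xi\in\mathbb R^n$; * there is $\gamma>0$ with $\sum_{i,j=1}^n \frac{\partial}{\partial\xi_j}\big([H(\eta)]^{p-1}H_{\xi_i}(\eta)\big)\xi_i\xi_j\ge\gamma|\eta|^{p-2}|\xi|^2$ for all $\eta\in\mathbb R^n\setminus\{0\}$, $\xi\in\mathbb R^n$. Let $H^{o}(v)=\sup_{\xi\ne0}\frac{\xi\cdot v}{H(\xi)}$ be the polar function of $H$, and suppose that $H^o$ is of class $C^2(\mathbb R^n\setminus\{0\})$ and that the hypersurface $\{x : H^{o}(x)=1\}$ has positive Gaussian curvature at every point. Let $\Omega\subset\mathbb R^n$ be a bounded convex open set with $C^2$ boundary, let $\nu$ be its outer unit normal, let $\sigma$ be the $(n-1)$-dimensional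 Hausdorff (surface) measure on $\partial\Omega$, and let $d_H(x)=\inf_{y\in\partial\Omega}H^{o}(x-y)$ be the anisotropic distance from the boundary. Then for all $\alpha>0$, $\vartheta>0$ and all $u\in W^{1,p}(\Omega)$, $$\int_{\Omega}[H(Du)]^p\,dx+\vartheta^{p-1}\int_{\partial\Omega}|u|^pH(\nu)\,d\sigma\;\ge\;(p-1)(\alpha\vartheta)^{p-1}(1-\alpha\vartheta)\int_\Omega\frac{|u|^p}{(d_H+\alpha)^p}\,dx,$$ where $u$ on $\partial\Omega$ is understood in the sense of traces. -/

import Mathlib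

open MeasureTheory Filter Topology
open scoped RealInnerProductSpace

/-- Standing assumptions on the anisotropy `H`: it is `C²` away from the origin, absolutely
homogeneous of degree one, its sublevel sets at positive levels are strictly convex, and it is
comparable with the Euclidean norm. -/
structure IsAnisotropy {n : ℕ} (H : EuclideanSpace ℝ (Fin n) → ℝ) : Prop where
  contDiffOn : ContDiffOn ℝ 2 H {0}ᶜ
  homogeneous : ∀ (t : ℝ) (ξ : EuclideanSpace ℝ (Fin n)), H (t • ξ) = |t| * H ξ
  strictConvex_sublevel : ∀ t : ℝ, 0 < t → StrictConvex ℝ {ξ | H ξ ≤ t}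
  comparable : ∃ a b : ℝ, 0 < a ∧ a ≤ b ∧
    ∀ ξ : EuclideanSpace ℝ (Fin n), a * ‖ξ‖ ≤ H ξ ∧ H ξ ≤ b * ‖ξ‖

/-- The ellipticity condition on `H^{p-1} H_ξ`: for some `γ > 0`,
`∑_{i,j} ∂_{ξ_j} (H(η)^{p-1} H_{ξ_i}(η)) ξ_i ξ_j ≥ γ |η|^{p-2} |ξ|²` for all `η ≠ 0` and all `ξ`. -/
def IsUniformlyElliptic {n : ℕ} (p : ℝ) (H : EuclideanSpace ℝ (Fin n) → ℝ) : Prop :=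
  ∃ γ : ℝ, 0 < γ ∧ ∀ η : EuclideanSpace ℝ (Fin n), η ≠ 0 → ∀ ξ : EuclideanSpace ℝ (Fin n),
    γ * ‖η‖ ^ (p - 2) * ‖ξ‖ ^ 2 ≤
      ⟪fderiv ℝ (fun ζ => H ζ ^ (p - 1) • gradient H ζ) η ξ, ξ⟫

/-- The polar function `H°(v) = sup_{ξ ≠ 0} (ξ · v) / H(ξ)`. -/
noncomputable def polar {n : ℕ} (H : EuclideanSpace ℝ (Fin n) → ℝ)
    (v : EuclideanSpace ℝ (Fin n)) : ℝ :=
  ⨆ ξ : {ξ : EuclideanSpace ℝ (Fin n) // ξ ≠ 0}, ⟪(ξ : EuclideanSpace ℝ (Fin n)), v⟫ / H ξ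

/-- The unit normal field `DF / |DF|` of the level sets of `F` (outer to the sublevel sets). -/
noncomputable def levelNormal {n : ℕ} (F : EuclideanSpace ℝ (Fin n) → ℝ)
    (x : EuclideanSpace ℝ (Fin n)) : EuclideanSpace ℝ (Fin n) :=
  ‖gradient F x‖⁻¹ • gradient F x

/-- The Gaussian curvature at `x` of the level set of `F` through `x`, oriented by
`N = DF / |DF|`: the determinant of the shape operator `v ↦ D_v N` of the tangent space `N(x)^⊥`.
With this orientation the unit sphere has curvature `1`. -/
noncomputable def levelGaussCurvature {n : ℕ} (F : EuclideanSpace ℝ (Fin n) → ℝ)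
    (x : EuclideanSpace ℝ (Fin n)) : ℝ :=
  LinearMap.det
    (((ℝ ∙ levelNormal F x)ᗮ.orthogonalProjectionOnto ∘L
      fderiv ℝ (levelNormal F) x ∘L (ℝ ∙ levelNormal F x)ᗮ.subtypeL :
        (ℝ ∙ levelNormal F x)ᗮ →L[ℝ] (ℝ ∙ levelNormal F x)ᗮ) :
      (ℝ ∙ levelNormal F x)ᗮ →ₗ[ℝ] (ℝ ∙ levelNormal F x)ᗮ)

/-- The boundary `{F = 1}` of the Wulff shape `{F < 1}` is a `C²` hypersurface (`F` being `C²`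
off the origin) with positive Gaussian curvature at every point. -/
structure HasPositiveGaussCurvature {n : ℕ} (F : EuclideanSpace ℝ (Fin n) → ℝ) : Prop where
  contDiffOn : ContDiffOn ℝ 2 F {0}ᶜ
  curvature_pos : ∀ x, F x = 1 → 0 < levelGaussCurvature F x

/-- `φ` is a `C²` defining function of `Ω` in the open neighbourhood `U` of `x`. -/
structure IsC2DefiningFunction {n : ℕ} (Ω : Set (EuclideanSpace ℝ (Fin n)))
    (x : EuclideanSpace ℝ (Fin n)) (U : Set (EuclideanSpace ℝ (Fin n)))
    (φ : EuclideanSpace ℝ (Fin n) → ℝ) : Prop where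
  isOpen : IsOpen U
  mem : x ∈ U
  contDiffOn : ContDiffOn ℝ 2 φ U
  gradient_ne_zero : ∀ y ∈ U, gradient φ y ≠ 0
  inter_eq : Ω ∩ U = {y ∈ U | φ y < 0}
  frontier_inter_eq : frontier Ω ∩ U = {y ∈ U | φ y = 0}

/-- `Ω` has `C²` boundary. -/
def HasC2Boundary {n : ℕ} (Ω : Set (EuclideanSpace ℝ (Fin n))) : Prop :=
  ∀ x ∈ frontier Ω, ∃ U φ, IsC2DefiningFunction Ω x U φ

/-- `v` is the outer unit normal to `∂Ω` at `x`: it equals `Dφ(x) / |Dφ(x)|` for some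
(equivalently, every) local defining function `φ`. -/
def IsOuterUnitNormal {n : ℕ} (Ω : Set (EuclideanSpace ℝ (Fin n)))
    (x v : EuclideanSpace ℝ (Fin n)) : Prop :=
  ∃ U φ, IsC2DefiningFunction Ω x U φ ∧ v = levelNormal φ x

/-- The outer unit normal field of `∂Ω`. -/
noncomputable def outerUnitNormal {n : ℕ} (Ω : Set (EuclideanSpace ℝ (Fin n)))
    (x : EuclideanSpace ℝ (Fin n)) : EuclideanSpace ℝ (Fin n) :=
  Classical.epsilon (IsOuterUnitNormal Ω x)

/-- If `φ` has gradient `g` and `φ x = 0`, then `φ` is negative just after `x` in every direction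
`w` with `g · w < 0`. -/
theorem eventually_neg_of_gradient {n : ℕ} {φ : EuclideanSpace ℝ (Fin n) → ℝ}
    {x g w : EuclideanSpace ℝ (Fin n)} (hφ : HasGradientAt φ g x) (h0 : φ x = 0)
    (hw : ⟪g, w⟫ < 0) : ∀ᶠ t in 𝓝[>] (0 : ℝ), φ (x + t • w) < 0 := by
  have hl : HasDerivAt (fun t : ℝ => x + t • w) w 0 := by
    simpa using ((hasDerivAt_id (0 : ℝ)).smul_const w).const_add x
  have hφ' : HasFDerivAt φ (InnerProductSpace.toDual ℝ _ g) (x + (0 : ℝ) • w) := by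
    simpa using hφ.hasFDerivAt
  have hd := hφ'.comp_hasDerivAt (0 : ℝ) hl
  have hs := (hasDerivAt_iff_tendsto_slope.mp hd).mono_left
    (nhdsWithin_mono (0 : ℝ) (s := Set.Ioi 0) fun t ht => ne_of_gt ht)
  have hs' := hs.eventually_lt_const (u := 0) (by simpa using hw)
  filter_upwards [hs', self_mem_nhdsWithin] with t ht htpos
  have htpos' : (0 : ℝ) < t := htpos
  simp only [slope, Function.comp, vsub_eq_sub, sub_zero, zero_smul, add_zero, h0,
    smul_eq_mul] at ht
  by_contra hcon
  exact absurd ht (not_lt.mpr (mul_nonneg (inv_nonneg.mpr htpos'.le) (not_lt.mp hcon)))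

/-- The outer unit normal is unique: it does not depend on the defining function. -/
theorem IsOuterUnitNormal.unique {n : ℕ} {Ω : Set (EuclideanSpace ℝ (Fin n))}
    {x v w : EuclideanSpace ℝ (Fin n)} (hx : x ∈ frontier Ω)
    (hv : IsOuterUnitNormal Ω x v) (hw : IsOuterUnitNormal Ω x w) : v = w := by
  obtain ⟨U, φ, hφ, rfl⟩ := hv
  obtain ⟨V, ψ, hψ, rfl⟩ := hw
  have key : ∀ {U V : Set (EuclideanSpace ℝ (Fin n))} {φ ψ : EuclideanSpace ℝ (Fin n) → ℝ},
      IsC2DefiningFunction Ω x U φ → IsC2DefiningFunction Ω x V ψ →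
      ∀ z, ⟪gradient φ x, z⟫ < 0 → ⟪gradient ψ x, z⟫ ≤ 0 := by
    intro U V φ ψ hφ hψ z hz
    by_contra! hcon
    have hg : ∀ {U : Set (EuclideanSpace ℝ (Fin n))} {φ : EuclideanSpace ℝ (Fin n) → ℝ},
        IsC2DefiningFunction Ω x U φ → HasGradientAt φ (gradient φ x) x ∧ φ x = 0 := by
      intro U φ h
      refine ⟨?_, ?_⟩
      · exact ((h.contDiffOn.contDiffAt (h.isOpen.mem_nhds h.mem)).differentiableAt
          (by norm_num)).hasGradientAt
      · have : x ∈ {y ∈ U | φ y = 0} := h.frontier_inter_eq ▸ ⟨hx, h.mem⟩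
        exact this.2
    have h1 := eventually_neg_of_gradient (hg hφ).1 (hg hφ).2 hz
    have h2 := eventually_neg_of_gradient (φ := fun y => -ψ y) (g := -gradient ψ x) (x := x)
      (w := z) (by
        have := (hg hψ).1.hasFDerivAt.neg
        rw [hasGradientAt_iff_hasFDerivAt, map_neg]
        exact this) (by simp [(hg hψ).2]) (by simpa using hcon)
    have hc : Tendsto (fun t : ℝ => x + t • z) (𝓝[>] 0) (𝓝 x) := by
      have : Continuous fun t : ℝ => x + t • z := by fun_prop
      simpa using (this.tendsto 0).mono_left nhdsWithin_le_nhds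
    have h3 := hc.eventually (hφ.isOpen.mem_nhds hφ.mem)
    have h4 := hc.eventually (hψ.isOpen.mem_nhds hψ.mem)
    obtain ⟨t, h1, h2, h3, h4⟩ := (h1.and (h2.and (h3.and h4))).exists
    have hΩ : x + t • z ∈ Ω ∩ U := hφ.inter_eq ▸ ⟨h3, h1⟩
    have hΩ' : x + t • z ∈ {y ∈ V | ψ y < 0} := hψ.inter_eq ▸ ⟨hΩ.1, h4⟩
    have := hΩ'.2
    linarith
  have ha := hφ.gradient_ne_zero x hφ.mem
  have hb := hψ.gradient_ne_zero x hψ.mem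
  have hk := key hφ hψ
  unfold levelNormal
  set a := gradient φ x
  set b := gradient ψ x
  have ha' : 0 < ‖a‖ := norm_pos_iff.mpr ha
  have hb' : 0 < ‖b‖ := norm_pos_iff.mpr hb
  have hle : ‖a‖ * ‖b‖ ≤ ⟪a, b⟫ := by
    by_contra! hlt
    have h := hk (‖a‖ • b - ‖b‖ • a) (by
      rw [inner_sub_right, inner_smul_right, inner_smul_right, real_inner_self_eq_norm_sq]
      nlinarith)
    rw [inner_sub_right, inner_smul_right, inner_smul_right, real_inner_self_eq_norm_sq,
      real_inner_comm a b] at h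
    nlinarith
  have heq : ⟪a, b⟫ = ‖a‖ * ‖b‖ := le_antisymm (real_inner_le_norm a b) hle
  rw [inner_eq_norm_mul_iff_real] at heq
  have h' : ‖b‖⁻¹ • ‖a‖⁻¹ • (‖b‖ • a) = ‖b‖⁻¹ • ‖a‖⁻¹ • (‖a‖ • b) := by rw [heq]
  simp only [smul_smul] at h' ⊢
  convert h' using 2 <;> field_simp

/-- Surface measure `σ` on `∂Ω`: the `(n-1)`-dimensional Hausdorff measure, normalized to agree with
Lebesgue measure on hyperplanes, restricted to `∂Ω`. -/
noncomputable def surfaceMeasure {n : ℕ} (Ω : Set (EuclideanSpace ℝ (Fin n))) :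
    Measure (EuclideanSpace ℝ (Fin n)) :=
  (Measure.euclideanHausdorffMeasure (n - 1)).restrict (frontier Ω)

/-- The anisotropic distance to the boundary, `d_H(x) = inf_{y ∈ ∂Ω} H°(x - y)`. -/
noncomputable def anisotropicDist {n : ℕ} (H : EuclideanSpace ℝ (Fin n) → ℝ)
    (Ω : Set (EuclideanSpace ℝ (Fin n))) (x : EuclideanSpace ℝ (Fin n)) : ℝ :=
  ⨅ y : frontier Ω, polar H (x - y)

/-- A representative of an element of `W^{1,p}(Ω)`: an `L^p(Ω)` function `toFun` with a weak gradient
`grad` in `L^p(Ω)`. Values outside `Ω` are irrelevant. -/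
structure SobolevFunction {n : ℕ} (Ω : Set (EuclideanSpace ℝ (Fin n))) (p : ℝ) where
  toFun : EuclideanSpace ℝ (Fin n) → ℝ
  grad : EuclideanSpace ℝ (Fin n) → EuclideanSpace ℝ (Fin n)
  memLp : MemLp toFun (ENNReal.ofReal p) (volume.restrict Ω)
  memLp_grad : MemLp grad (ENNReal.ofReal p) (volume.restrict Ω)
  weak_grad : ∀ ψ : EuclideanSpace ℝ (Fin n) → ℝ, ContDiff ℝ (⊤ : ℕ∞) ψ → HasCompactSupport ψ →
    tsupport ψ ⊆ Ω → ∀ v : EuclideanSpace ℝ (Fin n),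
      ∫ x in Ω, toFun x * fderiv ℝ ψ x v = - ∫ x in Ω, ⟪grad x, v⟫ * ψ x

/-- `g` is the boundary trace of `u`: there are `C¹` functions on the whole space converging to `u` in `W^{1,p}(Ω)` whose restrictions to `∂Ω` converge to `g` in
`L^p(∂Ω, σ)`. -/
def SobolevFunction.IsTrace {n : ℕ} {Ω : Set (EuclideanSpace ℝ (Fin n))} {p : ℝ}
    (u : SobolevFunction Ω p) (g : EuclideanSpace ℝ (Fin n) → ℝ) : Prop :=
  MemLp g (ENNReal.ofReal p) (surfaceMeasure Ω) ∧
  ∃ φ : ℕ → EuclideanSpace ℝ (Fin n) → ℝ, (∀ k, ContDiff ℝ 1 (φ k)) ∧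
    Tendsto (fun k => eLpNorm (fun x => φ k x - u.toFun x) (ENNReal.ofReal p) (volume.restrict Ω))
      atTop (𝓝 0) ∧
    Tendsto (fun k => eLpNorm (fun x => gradient (φ k) x - u.grad x) (ENNReal.ofReal p)
      (volume.restrict Ω)) atTop (𝓝 0) ∧
    Tendsto (fun k => eLpNorm (fun x => φ k x - g x) (ENNReal.ofReal p) (surfaceMeasure Ω))
      atTop (𝓝 0)

/-- The boundary trace of `u ∈ W^{1,p}(Ω)`. -/
noncomputable def SobolevFunction.trace {n : ℕ} {Ω : Set (EuclideanSpace ℝ (Fin n))} {p : ℝ}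
    (u : SobolevFunction Ω p) : EuclideanSpace ℝ (Fin n) → ℝ :=
  Classical.epsilon u.IsTrace

/-! Write `d` for the anisotropic distance and `ν` for the outer normal. Since `Ω` is convex, `d` is
in `Ω` the infimum over boundary points `y` of the affine functions `x ↦ ⟪y - x, ν(y)⟫ / H (ν(y))`.
Hence `d` is concave and Lipschitz, and `H (Dd) = 1` wherever `d` is differentiable, so almost
everywhere. As `H` is convex, the field `DH(Dd)` formally has divergence `tr (D²H(Dd) D²d) ≤ 0`: one
factor is positive semidefinite, the other negative semidefinite.

For `φ` of class `C¹`, this inequality is tested against `|φ|^p k(d) (d + α)^(1-p)`, where the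
cutoff `k` rises from `0` to nearly `1` while `d` runs through `[0, ε]`. By Euler's identity and the
eikonal equation, differentiating the power produces the Hardy term `(p - 1) ∫ k(d) |φ|^p / (d +
α)^p`, and differentiating `k` produces at most `α^(1-p)` times the average `ε⁻¹ ∫_{d < ε} |φ|^p`.
The term with `D|φ|^p` is controlled by `DH(Dd) · ζ ≤ H ζ` and by Young's inequality with parameter
`c = αϑ`; it costs `∫ H(Dφ)^p + (p - 1) c^p ∫ |φ|^p / (d + α)^p` after multiplication by `c^(p-1)`.
As `ε → 0` the layer average is asymptotically at most `∫ |φ|^p H(ν) dσ`, and `c^(p-1) α^(1-p) =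
ϑ^(p-1)`. Collecting terms gives the factor `(p - 1) c^(p-1) (1 - c)`.

The carriers are `anisotropicDist_eq_supportDist`, `eikonal_supportDist`,
`integral_anisotropic_nonneg` (the divergence inequality, by mollifying both `d` and `H`),
`hardy_cutoff` and `integral_layer` (Fubini along a fixed normal in small boundary patches).

For `u ∈ W^{1,p}(Ω)` the trace is a choice among limits of `C¹` functions, so its existence is part
of the proof: `exists_contDiff_tendsto` supplies approximations, and `exists_eLpNorm_trace` makes
their boundary values Cauchy. All three integrals are continuous along such a sequence, by
`tendsto_integral_rpow_mul`. -/

namespace IsAnisotropy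

/-! ### The anisotropy as a norm, and its polar -/

variable {n : ℕ} {H : EuclideanSpace ℝ (Fin n) → ℝ}

theorem nonneg (hH : IsAnisotropy H) (ξ : EuclideanSpace ℝ (Fin n)) : 0 ≤ H ξ := by
  obtain ⟨a, b, ha, -, h⟩ := hH.comparable
  exact (mul_nonneg ha.le (norm_nonneg ξ)).trans (h ξ).1

theorem map_zero (hH : IsAnisotropy H) : H 0 = 0 := by
  simpa using hH.homogeneous 0 0

theorem pos (hH : IsAnisotropy H) {ξ : EuclideanSpace ℝ (Fin n)} (hξ : ξ ≠ 0) : 0 < H ξ := by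
  obtain ⟨a, b, ha, -, h⟩ := hH.comparable
  exact (mul_pos ha (norm_pos_iff.mpr hξ)).trans_le (h ξ).1

theorem map_smul_of_nonneg (hH : IsAnisotropy H) {t : ℝ} (ht : 0 ≤ t)
    (ξ : EuclideanSpace ℝ (Fin n)) : H (t • ξ) = t * H ξ := by
  rw [hH.homogeneous, abs_of_nonneg ht]

theorem map_neg (hH : IsAnisotropy H) (ξ : EuclideanSpace ℝ (Fin n)) : H (-ξ) = H ξ := by
  simpa using hH.homogeneous (-1) ξ

/-- A homogeneous function is the gauge of its unit sublevel set, so convexity of that set yields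
the triangle inequality: combine the two normalized vectors with weights proportional to `H ξ` and
`H ζ`. -/
theorem add_le (hH : IsAnisotropy H) (ξ ζ : EuclideanSpace ℝ (Fin n)) :
    H (ξ + ζ) ≤ H ξ + H ζ := by
  rcases eq_or_ne ξ 0 with rfl | hξ
  · simp [hH.map_zero]
  rcases eq_or_ne ζ 0 with rfl | hζ
  · simp [hH.map_zero]
  have h1 := hH.pos hξ
  have h2 := hH.pos hζ
  have hc : Convex ℝ {ξ | H ξ ≤ 1} := (hH.strictConvex_sublevel 1 one_pos).convex
  have m1 : (H ξ)⁻¹ • ξ ∈ {ξ | H ξ ≤ 1} := by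
    simp only [Set.mem_ofPred_eq]
    rw [hH.map_smul_of_nonneg (inv_nonneg.mpr h1.le), inv_mul_cancel₀ h1.ne']
  have m2 : (H ζ)⁻¹ • ζ ∈ {ξ | H ξ ≤ 1} := by
    simp only [Set.mem_ofPred_eq]
    rw [hH.map_smul_of_nonneg (inv_nonneg.mpr h2.le), inv_mul_cancel₀ h2.ne']
  have hs : 0 < H ξ + H ζ := by positivity
  have := hc m1 m2 (a := H ξ / (H ξ + H ζ)) (b := H ζ / (H ξ + H ζ)) (by positivity)
    (by positivity) (by field_simp)
  have e : (H ξ / (H ξ + H ζ)) • (H ξ)⁻¹ • ξ + (H ζ / (H ξ + H ζ)) • (H ζ)⁻¹ • ζ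
      = (H ξ + H ζ)⁻¹ • (ξ + ζ) := by
    rw [smul_smul, smul_smul, smul_add]
    congr 2 <;> field_simp
  rw [e, Set.mem_ofPred_eq, hH.map_smul_of_nonneg (inv_nonneg.mpr hs.le)] at this
  field_simp at this
  linarith

theorem convexOn (hH : IsAnisotropy H) : ConvexOn ℝ Set.univ H :=
  ⟨convex_univ, fun x _ y _ a b ha hb _ => by
    simpa [hH.map_smul_of_nonneg ha, hH.map_smul_of_nonneg hb] using hH.add_le (a • x) (b • y)⟩

theorem exists_lipschitz (hH : IsAnisotropy H) : ∃ K, LipschitzWith K H := by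
  obtain ⟨a, b, ha, hab, h⟩ := hH.comparable
  refine ⟨b.toNNReal, LipschitzWith.of_le_add_mul _ fun x y => ?_⟩
  have h1 := hH.add_le y (x - y)
  have h2 := (h (x - y)).2
  rw [add_sub_cancel] at h1
  rw [Real.coe_toNNReal b (ha.le.trans hab), dist_eq_norm]
  linarith

theorem continuous (hH : IsAnisotropy H) : Continuous H :=
  hH.exists_lipschitz.choose_spec.continuous

theorem contDiffAt (hH : IsAnisotropy H) {ξ : EuclideanSpace ℝ (Fin n)} (hξ : ξ ≠ 0) :
    ContDiffAt ℝ 2 H ξ :=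
  hH.contDiffOn.contDiffAt (isOpen_compl_singleton.mem_nhds hξ)

theorem hasGradientAt (hH : IsAnisotropy H) {ξ : EuclideanSpace ℝ (Fin n)} (hξ : ξ ≠ 0) :
    HasGradientAt H (gradient H ξ) ξ :=
  ((hH.contDiffAt hξ).differentiableAt (by norm_num)).hasGradientAt

/-- By subadditivity every forward difference quotient of `H` in the direction `ζ` is at most `H ζ`.
-/
theorem inner_gradient_le (hH : IsAnisotropy H) {ξ : EuclideanSpace ℝ (Fin n)} (hξ : ξ ≠ 0)
    (ζ : EuclideanSpace ℝ (Fin n)) : ⟪gradient H ξ, ζ⟫ ≤ H ζ := by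
  have hl : HasDerivAt (fun t : ℝ => ξ + t • ζ) ζ 0 := by
    simpa using ((hasDerivAt_id (0 : ℝ)).smul_const ζ).const_add ξ
  have hφ' : HasFDerivAt H (InnerProductSpace.toDual ℝ _ (gradient H ξ)) (ξ + (0 : ℝ) • ζ) := by
    simpa using (hH.hasGradientAt hξ).hasFDerivAt
  have hd := hφ'.comp_hasDerivAt (0 : ℝ) hl
  have hs := (hasDerivAt_iff_tendsto_slope.mp hd).mono_left
    (nhdsWithin_mono (0 : ℝ) (s := Set.Ioi 0) fun t ht => ne_of_gt ht)
  refine le_of_tendsto (by simpa using hs) ?_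
  filter_upwards [self_mem_nhdsWithin] with t ht
  have ht' : (0 : ℝ) < t := ht
  simp only [slope, Function.comp, vsub_eq_sub, sub_zero, zero_smul, add_zero, smul_eq_mul]
  have := hH.add_le ξ (t • ζ)
  rw [hH.map_smul_of_nonneg ht'.le] at this
  rw [inv_mul_le_iff₀ ht']
  linarith

/-- Euler's identity, from differentiating `t ↦ H (t • ξ) = t * H ξ` at `t = 1`. -/
theorem inner_gradient_self (hH : IsAnisotropy H) {ξ : EuclideanSpace ℝ (Fin n)} (hξ : ξ ≠ 0) :
    ⟪gradient H ξ, ξ⟫ = H ξ := by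
  have hl : HasDerivAt (fun t : ℝ => t • ξ) ξ 1 := by
    simpa using ((hasDerivAt_id (1 : ℝ)).smul_const ξ)
  have hφ' : HasFDerivAt H (InnerProductSpace.toDual ℝ _ (gradient H ξ)) ((1 : ℝ) • ξ) := by
    simpa using (hH.hasGradientAt hξ).hasFDerivAt
  have hd := hφ'.comp_hasDerivAt (1 : ℝ) hl
  have h2 : HasDerivAt (H ∘ fun t : ℝ => t • ξ) (1 * H ξ) 1 := by
    refine ((hasDerivAt_id (1 : ℝ)).mul_const (H ξ)).congr_of_eventuallyEq ?_
    filter_upwards [lt_mem_nhds (zero_lt_one (α := ℝ))] with t ht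
    simp [hH.map_smul_of_nonneg ht.le]
  simpa using hd.unique h2

/-! ### The polar function -/

theorem polar_bddAbove (hH : IsAnisotropy H) (v : EuclideanSpace ℝ (Fin n)) :
    BddAbove (Set.range fun ξ : {ξ : EuclideanSpace ℝ (Fin n) // ξ ≠ 0} =>
      ⟪(ξ : EuclideanSpace ℝ (Fin n)), v⟫ / H ξ) := by
  obtain ⟨a, b, ha, hab, h⟩ := hH.comparable
  refine ⟨‖v‖ / a, ?_⟩
  rintro _ ⟨ξ, rfl⟩
  have h0 := hH.pos ξ.2
  rw [div_le_div_iff₀ h0 ha]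
  calc _ ≤ ‖(ξ : EuclideanSpace ℝ (Fin n))‖ * ‖v‖ * a := by
        gcongr; exact real_inner_le_norm _ _
    _ = ‖v‖ * (a * ‖(ξ : EuclideanSpace ℝ (Fin n))‖) := by ring
    _ ≤ _ := by gcongr; exact (h _).1

theorem inner_le_mul_polar (hH : IsAnisotropy H) (ξ v : EuclideanSpace ℝ (Fin n)) :
    ⟪ξ, v⟫ ≤ H ξ * polar H v := by
  rcases eq_or_ne ξ 0 with rfl | hξ
  · simp [hH.map_zero]
  have := le_ciSup (hH.polar_bddAbove v) ⟨ξ, hξ⟩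
  rw [div_le_iff₀ (hH.pos hξ)] at this
  rw [mul_comm]; exact this

theorem polar_le (hH : IsAnisotropy H) {v : EuclideanSpace ℝ (Fin n)} {c : ℝ} (hc : 0 ≤ c)
    (h : ∀ ξ, ⟪ξ, v⟫ ≤ c * H ξ) : polar H v ≤ c :=
  -- Nonnegativity of `c` covers the empty index set, where the real supremum is `0` by default.
  Real.iSup_le (fun ξ => (div_le_iff₀ (hH.pos ξ.2)).mpr (h ξ)) hc

theorem polar_nonneg (hH : IsAnisotropy H) (v : EuclideanSpace ℝ (Fin n)) : 0 ≤ polar H v := by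
  rcases eq_or_ne v 0 with rfl | hv
  · simp [polar]
  have h1 := hH.inner_le_mul_polar v v
  rw [real_inner_self_eq_norm_sq] at h1
  exact nonneg_of_mul_nonneg_right ((sq_nonneg _).trans h1) (hH.pos hv)

theorem polar_pos (hH : IsAnisotropy H) {v : EuclideanSpace ℝ (Fin n)} (hv : v ≠ 0) :
    0 < polar H v := by
  have h1 := hH.inner_le_mul_polar v v
  rw [real_inner_self_eq_norm_sq] at h1
  have h2 : 0 < ‖v‖ ^ 2 := by have := norm_pos_iff.mpr hv; positivity
  exact pos_of_mul_pos_right (h2.trans_le h1) (hH.pos hv).le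

/-- Gradients of `H` lie in the polar unit ball. They are the directions in which a supporting
hyperplane is reached at least polar cost. -/
theorem polar_gradient_le_one (hH : IsAnisotropy H) {ξ : EuclideanSpace ℝ (Fin n)} (hξ : ξ ≠ 0) :
    polar H (gradient H ξ) ≤ 1 :=
  hH.polar_le zero_le_one fun ζ => by
    rw [real_inner_comm, one_mul]; exact hH.inner_gradient_le hξ ζ

theorem polar_smul_le (hH : IsAnisotropy H) {t : ℝ} (ht : 0 ≤ t) (v : EuclideanSpace ℝ (Fin n)) :
    polar H (t • v) ≤ t * polar H v :=
  hH.polar_le (mul_nonneg ht (hH.polar_nonneg v)) fun ξ => by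
    rw [inner_smul_right]
    nlinarith [hH.inner_le_mul_polar ξ v]

theorem polar_neg_le (hH : IsAnisotropy H) (v : EuclideanSpace ℝ (Fin n)) :
    polar H (-v) ≤ polar H v :=
  hH.polar_le (hH.polar_nonneg v) fun ξ => by
    have := hH.inner_le_mul_polar (-ξ) v
    rw [hH.map_neg, inner_neg_left] at this
    rw [inner_neg_right]; linarith

theorem polar_neg (hH : IsAnisotropy H) (v : EuclideanSpace ℝ (Fin n)) :
    polar H (-v) = polar H v :=
  le_antisymm (hH.polar_neg_le v) (by simpa using hH.polar_neg_le (-v))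

theorem polar_add_le (hH : IsAnisotropy H) (v w : EuclideanSpace ℝ (Fin n)) :
    polar H (v + w) ≤ polar H v + polar H w :=
  hH.polar_le (add_nonneg (hH.polar_nonneg v) (hH.polar_nonneg w)) fun ξ => by
    rw [inner_add_right]
    nlinarith [hH.inner_le_mul_polar ξ v, hH.inner_le_mul_polar ξ w]

/-- Two-sided comparison of the polar function with the Euclidean norm. -/
theorem polar_comparable (hH : IsAnisotropy H) : ∃ c C : ℝ, 0 < c ∧ 0 < C ∧
    ∀ v, c * ‖v‖ ≤ polar H v ∧ polar H v ≤ C * ‖v‖ := by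
  obtain ⟨a, b, ha, hab, h⟩ := hH.comparable
  have hb := ha.trans_le hab
  refine ⟨b⁻¹, a⁻¹, by positivity, by positivity, fun v => ⟨?_, ?_⟩⟩
  · rcases eq_or_ne v 0 with rfl | hv
    · simpa using hH.polar_nonneg 0
    have h1 := hH.inner_le_mul_polar v v
    rw [real_inner_self_eq_norm_sq] at h1
    have hv' := norm_pos_iff.mpr hv
    rw [inv_mul_le_iff₀ hb]
    have h2 : H v * polar H v ≤ b * ‖v‖ * polar H v :=
      mul_le_mul_of_nonneg_right (h v).2 (hH.polar_nonneg v)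
    have h3 : ‖v‖ * ‖v‖ ≤ ‖v‖ * (b * polar H v) := by nlinarith
    exact le_of_mul_le_mul_left h3 hv'
  · refine hH.polar_le (by positivity) fun ξ => ?_
    have h1 := real_inner_le_norm ξ v
    have h2 := (h ξ).1
    calc _ ≤ ‖ξ‖ * ‖v‖ := h1
      _ = a⁻¹ * ‖v‖ * (a * ‖ξ‖) := by field_simp
      _ ≤ _ := by gcongr

theorem exists_lipschitz_polar (hH : IsAnisotropy H) : ∃ K, LipschitzWith K (polar H) := by
  obtain ⟨c, C, hc, hC, h⟩ := hH.polar_comparable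
  refine ⟨C.toNNReal, LipschitzWith.of_le_add_mul _ fun x y => ?_⟩
  have h1 := hH.polar_add_le y (x - y)
  have h2 := (h (x - y)).2
  rw [add_sub_cancel] at h1
  rw [Real.coe_toNNReal C hC.le, dist_eq_norm]
  linarith

/-- Duality: `H ξ` is bounded by `c` as soon as `ξ · v ≤ c H°(v)` for all `v`. -/
theorem le_of_inner_le_polar (hH : IsAnisotropy H) {ξ : EuclideanSpace ℝ (Fin n)} {c : ℝ}
    (hc : 0 ≤ c) (h : ∀ v, ⟪ξ, v⟫ ≤ c * polar H v) : H ξ ≤ c := by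
  rcases eq_or_ne ξ 0 with rfl | hξ
  · rwa [hH.map_zero]
  rw [← hH.inner_gradient_self hξ, real_inner_comm]
  refine (h _).trans ?_
  nlinarith [hH.polar_gradient_le_one hξ]

end IsAnisotropy

/-! ### Normals and supporting hyperplanes of a convex `C²` domain -/

section Domain

variable {n : ℕ} {Ω : Set (EuclideanSpace ℝ (Fin n))}

theorem IsC2DefiningFunction.of_mem {x y : EuclideanSpace ℝ (Fin n)}
    {U : Set (EuclideanSpace ℝ (Fin n))} {φ : EuclideanSpace ℝ (Fin n) → ℝ}
    (h : IsC2DefiningFunction Ω x U φ) (hy : y ∈ U) : IsC2DefiningFunction Ω y U φ :=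
  ⟨h.isOpen, hy, h.contDiffOn, h.gradient_ne_zero, h.inter_eq, h.frontier_inter_eq⟩

theorem IsC2DefiningFunction.hasGradientAt {x : EuclideanSpace ℝ (Fin n)}
    {U : Set (EuclideanSpace ℝ (Fin n))} {φ : EuclideanSpace ℝ (Fin n) → ℝ}
    (h : IsC2DefiningFunction Ω x U φ) : HasGradientAt φ (gradient φ x) x :=
  ((h.contDiffOn.contDiffAt (h.isOpen.mem_nhds h.mem)).differentiableAt (by norm_num)).hasGradientAt

theorem IsC2DefiningFunction.eq_zero {x : EuclideanSpace ℝ (Fin n)}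
    {U : Set (EuclideanSpace ℝ (Fin n))} {φ : EuclideanSpace ℝ (Fin n) → ℝ}
    (h : IsC2DefiningFunction Ω x U φ) (hx : x ∈ frontier Ω) : φ x = 0 :=
  (h.frontier_inter_eq.subset ⟨hx, h.mem⟩).2

/-- Uniqueness of the normal removes the arbitrariness of the choice operator, so any local defining
function may be used for computation. -/
theorem outerUnitNormal_eq_levelNormal {y : EuclideanSpace ℝ (Fin n)}
    {U : Set (EuclideanSpace ℝ (Fin n))} {φ : EuclideanSpace ℝ (Fin n) → ℝ}
    (h : IsC2DefiningFunction Ω y U φ) (hy : y ∈ frontier Ω) :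
    outerUnitNormal Ω y = levelNormal φ y := by
  have h1 : IsOuterUnitNormal Ω y (levelNormal φ y) := ⟨U, φ, h, rfl⟩
  have h2 : IsOuterUnitNormal Ω y (outerUnitNormal Ω y) := Classical.epsilon_spec ⟨_, h1⟩
  exact h2.unique hy h1

theorem norm_levelNormal {x : EuclideanSpace ℝ (Fin n)} {φ : EuclideanSpace ℝ (Fin n) → ℝ}
    (h : gradient φ x ≠ 0) : ‖levelNormal φ x‖ = 1 := by
  rw [levelNormal, norm_smul, norm_inv, norm_norm, inv_mul_cancel₀ (norm_ne_zero_iff.mpr h)]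

theorem norm_outerUnitNormal (hΩ : HasC2Boundary Ω) {y : EuclideanSpace ℝ (Fin n)}
    (hy : y ∈ frontier Ω) : ‖outerUnitNormal Ω y‖ = 1 := by
  obtain ⟨U, φ, h⟩ := hΩ y hy
  rw [outerUnitNormal_eq_levelNormal h hy, norm_levelNormal (h.gradient_ne_zero y h.mem)]

theorem outerUnitNormal_ne_zero (hΩ : HasC2Boundary Ω) {y : EuclideanSpace ℝ (Fin n)}
    (hy : y ∈ frontier Ω) : outerUnitNormal Ω y ≠ 0 :=
  norm_ne_zero_iff.mp (by rw [norm_outerUnitNormal hΩ hy]; exact one_ne_zero)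

/-- One defining function computes the normal at all nearby boundary points, and its gradient is
continuous and nonzero. -/
theorem continuousOn_outerUnitNormal (hΩ : HasC2Boundary Ω) :
    ContinuousOn (outerUnitNormal Ω) (frontier Ω) := by
  intro x hx
  obtain ⟨U, φ, h⟩ := hΩ x hx
  have hU : U ∈ 𝓝 x := h.isOpen.mem_nhds h.mem
  have hg : ContinuousAt (gradient φ) x := by
    have := ((h.contDiffOn.contDiffAt hU).fderiv_right (m := 1) (by norm_num)).continuousAt
    exact (InnerProductSpace.toDual ℝ _).symm.continuous.continuousAt.comp this
  have hl : ContinuousAt (levelNormal φ) x :=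
    (hg.norm.inv₀ (norm_ne_zero_iff.mpr (h.gradient_ne_zero x h.mem))).smul hg
  refine hl.continuousWithinAt.congr_of_eventuallyEq ?_ (outerUnitNormal_eq_levelNormal h hx)
  filter_upwards [mem_nhdsWithin_of_mem_nhds hU, self_mem_nhdsWithin] with y hyU hy
  exact outerUnitNormal_eq_levelNormal (h.of_mem hyU) hy

theorem add_smul_sub_mem_of_mem_frontier (hΩo : IsOpen Ω) (hΩc : Convex ℝ Ω)
    {y z : EuclideanSpace ℝ (Fin n)} (hy : y ∈ frontier Ω) (hz : z ∈ Ω) {t : ℝ} (ht : 0 < t)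
    (ht1 : t ≤ 1) : y + t • (z - y) ∈ Ω := by
  have := hΩc.add_smul_sub_mem_interior' (frontier_subset_closure hy)
    (by rwa [hΩo.interior_eq]) (t := t) ⟨ht, ht1⟩
  rwa [hΩo.interior_eq] at this

theorem inner_sub_outerUnitNormal_neg (hΩ : HasC2Boundary Ω) (hΩo : IsOpen Ω) (hΩc : Convex ℝ Ω)
    {y z : EuclideanSpace ℝ (Fin n)} (hy : y ∈ frontier Ω) (hz : z ∈ Ω) :
    ⟪z - y, outerUnitNormal Ω y⟫ < 0 := by
  obtain ⟨U, φ, h⟩ := hΩ y hy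
  have hg := h.gradient_ne_zero y h.mem
  -- The segment from `y` to `w` lies in `Ω`, where `φ < 0`, so `φ` cannot increase from `φ y = 0`
  -- to first order.
  have key : ∀ w ∈ Ω, ⟪gradient φ y, w - y⟫ ≤ 0 := by
    intro w hw
    by_contra! hcon
    have h2 := eventually_neg_of_gradient (φ := fun y => -φ y) (g := -gradient φ y) (x := y)
      (w := w - y) (by
        have := h.hasGradientAt.hasFDerivAt.neg
        rw [hasGradientAt_iff_hasFDerivAt, _root_.map_neg]
        exact this) (by simp [h.eq_zero hy]) (by simpa using hcon)
    have hc : Tendsto (fun t : ℝ => y + t • (w - y)) (𝓝[>] 0) (𝓝 y) := by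
      have : Continuous fun t : ℝ => y + t • (w - y) := by fun_prop
      simpa using (this.tendsto 0).mono_left nhdsWithin_le_nhds
    have h3 := hc.eventually (h.isOpen.mem_nhds h.mem)
    have h4 : ∀ᶠ t : ℝ in 𝓝[>] 0, t < 1 := nhdsWithin_le_nhds (gt_mem_nhds one_pos)
    obtain ⟨t, h2, h3, h4, h5⟩ := (h2.and (h3.and (h4.and self_mem_nhdsWithin))).exists
    have h6 := add_smul_sub_mem_of_mem_frontier hΩo hΩc hy hw h5 h4.le
    have := (h.inter_eq.subset ⟨h6, h3⟩).2
    linarith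
  -- Openness makes the inequality strict: `z` can be pushed slightly along the gradient without
  -- leaving `Ω`.
  have hc : Tendsto (fun t : ℝ => z + t • gradient φ y) (𝓝[>] 0) (𝓝 z) := by
    have : Continuous fun t : ℝ => z + t • gradient φ y := by fun_prop
    simpa using (this.tendsto 0).mono_left nhdsWithin_le_nhds
  obtain ⟨t, h1, h2⟩ := ((hc.eventually (hΩo.mem_nhds hz)).and self_mem_nhdsWithin).exists
  have h3 := key _ h1
  have h2' : (0 : ℝ) < t := h2
  have hn : 0 < ‖gradient φ y‖ := norm_pos_iff.mpr hg
  have h4 : ⟪gradient φ y, z - y⟫ < 0 := by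
    rw [add_sub_right_comm, inner_add_right, inner_smul_right, real_inner_self_eq_norm_sq] at h3
    have : 0 < t * ‖gradient φ y‖ ^ 2 := by positivity
    linarith
  rw [outerUnitNormal_eq_levelNormal h hy, levelNormal, inner_smul_right, real_inner_comm]
  exact mul_neg_of_pos_of_neg (inv_pos.mpr hn) h4

theorem inner_sub_outerUnitNormal_nonpos (hΩ : HasC2Boundary Ω) (hΩo : IsOpen Ω)
    (hΩc : Convex ℝ Ω) {y z : EuclideanSpace ℝ (Fin n)} (hy : y ∈ frontier Ω)
    (hz : z ∈ closure Ω) : ⟪z - y, outerUnitNormal Ω y⟫ ≤ 0 := by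
  have hcl : IsClosed {z | ⟪z - y, outerUnitNormal Ω y⟫ ≤ 0} :=
    isClosed_le (by fun_prop) continuous_const
  exact closure_minimal (fun w hw => (inner_sub_outerUnitNormal_neg hΩ hΩo hΩc hy hw).le) hcl hz

/-- Near a boundary point `x`, the domain contains inward segments of uniform length in the
direction opposite to the normal at `x`. -/
theorem exists_inward_segments (hΩ : HasC2Boundary Ω) (hΩo : IsOpen Ω) (hΩc : Convex ℝ Ω)
    {x : EuclideanSpace ℝ (Fin n)} (hx : x ∈ frontier Ω) :
    ∃ r > 0, ∃ δ > 0, ∀ y ∈ frontier Ω ∩ Metric.ball x r, ∀ t : ℝ, 0 < t → t ≤ δ →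
      y - t • outerUnitNormal Ω x ∈ Ω := by
  obtain ⟨U, φ, h⟩ := hΩ x hx
  set N := outerUnitNormal Ω x with hN
  have hg := h.gradient_ne_zero x h.mem
  have hn : 0 < ‖gradient φ x‖ := norm_pos_iff.mpr hg
  have hneg : ⟪gradient φ x, -N⟫ < 0 := by
    rw [hN, outerUnitNormal_eq_levelNormal h hx, levelNormal, inner_neg_right, inner_smul_right,
      real_inner_self_eq_norm_sq]
    have : 0 < ‖gradient φ x‖⁻¹ * ‖gradient φ x‖ ^ 2 := by positivity
    linarith
  have h2 := eventually_neg_of_gradient h.hasGradientAt (h.eq_zero hx) hneg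
  have hc : Tendsto (fun t : ℝ => x + t • -N) (𝓝[>] 0) (𝓝 x) := by
    have : Continuous fun t : ℝ => x + t • -N := by fun_prop
    simpa using (this.tendsto 0).mono_left nhdsWithin_le_nhds
  obtain ⟨δ, h2, h3, h4⟩ := (h2.and ((hc.eventually (h.isOpen.mem_nhds h.mem)).and
    self_mem_nhdsWithin)).exists
  have h5 : x + δ • -N ∈ Ω := (h.inter_eq.superset ⟨h3, h2⟩).1
  obtain ⟨r, hr, hr'⟩ := Metric.isOpen_iff.mp hΩo _ h5
  have hδ : (0 : ℝ) < δ := h4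
  refine ⟨r, hr, δ, hδ, fun y hy t ht htδ => ?_⟩
  -- Translating `y` by `-δ • N` puts it in a ball around `x - δ • N` contained in `Ω`; convexity
  -- then gives the whole segment.
  have h6 : y - δ • N ∈ Ω := hr' (by
    have := hy.2
    rw [Metric.mem_ball, dist_eq_norm] at this ⊢
    convert this using 2
    rw [smul_neg]; abel)
  have h7 := add_smul_sub_mem_of_mem_frontier hΩo hΩc hy.1 h6 (div_pos ht hδ)
    ((div_le_one hδ).mpr htδ)
  convert h7 using 1
  rw [sub_sub_cancel_left, smul_neg, smul_smul, div_mul_cancel₀ _ hδ.ne', sub_eq_add_neg]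

end Domain

/-! ### The distance as an infimum of affine functions, and the eikonal equation -/

section SupportDist

variable {n : ℕ} {H : EuclideanSpace ℝ (Fin n) → ℝ} {Ω : Set (EuclideanSpace ℝ (Fin n))}

/-- The smallest normalized distance to the supporting hyperplanes of `Ω`. It is defined and concave
on the whole space, and agrees with the anisotropic distance to the boundary in `Ω`. -/
noncomputable def supportDist (H : EuclideanSpace ℝ (Fin n) → ℝ)
    (Ω : Set (EuclideanSpace ℝ (Fin n))) (x : EuclideanSpace ℝ (Fin n)) : ℝ :=
  ⨅ y : frontier Ω, ⟪(y : EuclideanSpace ℝ (Fin n)) - x, outerUnitNormal Ω y⟫ /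
    H (outerUnitNormal Ω y)

theorem nonempty_frontier_of_isBounded (hn : n ≠ 0) (hΩb : Bornology.IsBounded Ω)
    (hne : Ω.Nonempty) : (frontier Ω).Nonempty := by
  have : Nonempty (Fin n) := ⟨⟨0, Nat.pos_of_ne_zero hn⟩⟩
  by_contra hcon
  rw [Set.not_nonempty_iff_eq_empty, ← isClopen_iff_frontier_eq_empty, isClopen_iff] at hcon
  rcases hcon with rfl | rfl
  · exact Set.not_nonempty_empty hne
  · exact NormedSpace.unbounded_univ ℝ (EuclideanSpace ℝ (Fin n)) hΩb

theorem isCompact_frontier_of_isBounded (hΩb : Bornology.IsBounded Ω) : IsCompact (frontier Ω) :=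
  hΩb.isCompact_closure.of_isClosed_subset isClosed_frontier frontier_subset_closure

variable (hH : IsAnisotropy H) (hΩ : HasC2Boundary Ω) (hΩb : Bornology.IsBounded Ω)

include hH hΩ in
theorem neg_polar_le_div {x y : EuclideanSpace ℝ (Fin n)} (hy : y ∈ frontier Ω) :
    ⟪x, outerUnitNormal Ω y⟫ / H (outerUnitNormal Ω y) ≤ polar H x := by
  have h0 := hH.pos (outerUnitNormal_ne_zero hΩ hy)
  rw [div_le_iff₀ h0, real_inner_comm, mul_comm]
  exact hH.inner_le_mul_polar _ _

include hH hΩ hΩb in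
-- Needed because a real infimum of a family unbounded below is `0` by default. Each ratio is at
-- least `-polar H (x - y)`, and `y` ranges over a compact set.
theorem supportDist_bddBelow (x : EuclideanSpace ℝ (Fin n)) :
    BddBelow (Set.range fun y : frontier Ω =>
      ⟪(y : EuclideanSpace ℝ (Fin n)) - x, outerUnitNormal Ω y⟫ / H (outerUnitNormal Ω y)) := by
  have hK := isCompact_frontier_of_isBounded hΩb
  have hc : ContinuousOn (fun y => polar H (x - y)) (frontier Ω) :=
    (hH.exists_lipschitz_polar.choose_spec.continuous.comp
      (continuous_const.sub continuous_id)).continuousOn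
  obtain ⟨M, hM⟩ := hK.bddAbove_image hc
  refine ⟨-M, ?_⟩
  rintro _ ⟨y, rfl⟩
  have h1 := neg_polar_le_div hH hΩ (x := x - y) y.2
  have h2 := hM ⟨y, y.2, rfl⟩
  simp only at h2 ⊢
  rw [← neg_sub x, inner_neg_left, neg_div]
  linarith

include hH hΩ hΩb in
theorem supportDist_le {x y : EuclideanSpace ℝ (Fin n)} (hy : y ∈ frontier Ω) :
    supportDist H Ω x ≤ ⟪y - x, outerUnitNormal Ω y⟫ / H (outerUnitNormal Ω y) :=
  ciInf_le (supportDist_bddBelow hH hΩ hΩb x) ⟨y, hy⟩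

theorem le_supportDist (hne : (frontier Ω).Nonempty) {x : EuclideanSpace ℝ (Fin n)} {c : ℝ}
    (h : ∀ y ∈ frontier Ω, c ≤ ⟪y - x, outerUnitNormal Ω y⟫ / H (outerUnitNormal Ω y)) :
    c ≤ supportDist H Ω x :=
  have := hne.to_subtype
  le_ciInf fun y => h y y.2

include hH hΩ hΩb in
-- Replacing `z` by `x` changes each affine function by at most `polar H (z - x)`. This gives both
-- the Lipschitz bound and the upper half of the eikonal equation.
theorem supportDist_sub_le (hne : (frontier Ω).Nonempty) (x z : EuclideanSpace ℝ (Fin n)) :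
    supportDist H Ω x ≤ supportDist H Ω z + polar H (z - x) := by
  rw [← sub_le_iff_le_add]
  refine le_supportDist hne fun y hy => ?_
  have h1 := supportDist_le hH hΩ hΩb (x := x) hy
  have h2 := neg_polar_le_div hH hΩ (x := z - x) hy
  have h3 : ⟪y - x, outerUnitNormal Ω y⟫ / H (outerUnitNormal Ω y) =
      ⟪y - z, outerUnitNormal Ω y⟫ / H (outerUnitNormal Ω y) +
      ⟪z - x, outerUnitNormal Ω y⟫ / H (outerUnitNormal Ω y) := by
    rw [← add_div, ← inner_add_left, sub_add_sub_cancel]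
  linarith

include hH hΩ hΩb in
theorem exists_lipschitz_supportDist (hne : (frontier Ω).Nonempty) :
    ∃ K, LipschitzWith K (supportDist H Ω) := by
  obtain ⟨c, C, hc, hC, h⟩ := hH.polar_comparable
  refine ⟨C.toNNReal, LipschitzWith.of_le_add_mul _ fun x y => ?_⟩
  have h1 := supportDist_sub_le hH hΩ hΩb hne x y
  have h2 := (h (y - x)).2
  rw [Real.coe_toNNReal C hC.le, dist_comm, dist_eq_norm]
  linarith

include hH hΩ hΩb in
theorem concaveOn_supportDist (hne : (frontier Ω).Nonempty) :
    ConcaveOn ℝ Set.univ (supportDist H Ω) := by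
  refine ⟨convex_univ, fun x _ z _ a b ha hb hab => le_supportDist hne fun y hy => ?_⟩
  have h1 := mul_le_mul_of_nonneg_left (supportDist_le hH hΩ hΩb (x := x) hy) ha
  have h2 := mul_le_mul_of_nonneg_left (supportDist_le hH hΩ hΩb (x := z) hy) hb
  have h3 : y - (a • x + b • z) = a • (y - x) + b • (y - z) := by
    rw [smul_sub, smul_sub, sub_add_sub_comm, ← add_smul, hab, one_smul]
  rw [h3, inner_add_left, inner_smul_left, inner_smul_left, add_div, mul_div_assoc, mul_div_assoc]
  simpa using add_le_add h1 h2

include hH hΩ hΩb in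
theorem supportDist_le_polar {x y : EuclideanSpace ℝ (Fin n)} (hy : y ∈ frontier Ω) :
    supportDist H Ω x ≤ polar H (y - x) :=
  (supportDist_le hH hΩ hΩb hy).trans (neg_polar_le_div hH hΩ hy)

/-- The anisotropic distance is attained on the boundary. -/
theorem exists_polar_eq_anisotropicDist (hH : IsAnisotropy H) (hΩb : Bornology.IsBounded Ω)
    (hne : (frontier Ω).Nonempty) (x : EuclideanSpace ℝ (Fin n)) :
    ∃ y ∈ frontier Ω, anisotropicDist H Ω x = polar H (x - y) := by
  have hK := isCompact_frontier_of_isBounded hΩb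
  have hc : ContinuousOn (fun y => polar H (x - y)) (frontier Ω) :=
    (hH.exists_lipschitz_polar.choose_spec.continuous.comp
      (continuous_const.sub continuous_id)).continuousOn
  obtain ⟨y, hy, hmin⟩ := hK.exists_isMinOn hne hc
  have := hne.to_subtype
  refine ⟨y, hy, le_antisymm ?_ ?_⟩
  · refine ciInf_le (f := fun y : frontier Ω => polar H (x - y)) ⟨0, ?_⟩ ⟨y, hy⟩
    rintro _ ⟨z, rfl⟩
    exact hH.polar_nonneg _
  · exact le_ciInf fun z => hmin z.2

theorem anisotropicDist_le_polar (hH : IsAnisotropy H) {y : EuclideanSpace ℝ (Fin n)}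
    (hy : y ∈ frontier Ω) (x : EuclideanSpace ℝ (Fin n)) :
    anisotropicDist H Ω x ≤ polar H (x - y) := by
  refine ciInf_le (f := fun y : frontier Ω => polar H (x - y)) ⟨0, ?_⟩ ⟨y, hy⟩
  rintro _ ⟨z, rfl⟩
  exact hH.polar_nonneg _

/-- A segment from a point of a set to a point outside meets the frontier. -/
theorem exists_mem_frontier_segment {x z : EuclideanSpace ℝ (Fin n)} (hx : x ∈ Ω) (hz : z ∉ Ω) :
    ∃ t ∈ Set.Icc (0 : ℝ) 1, x + t • (z - x) ∈ frontier Ω := by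
  have hpre : IsPreconnected ((fun t : ℝ => x + t • (z - x)) '' Set.Icc 0 1) :=
    isPreconnected_Icc.image _ (by fun_prop)
  have h := isPreconnected_iff_subset_of_disjoint.mp hpre
  by_contra! hcon
  have hsub : (fun t : ℝ => x + t • (z - x)) '' Set.Icc 0 1 ⊆ interior Ω ∪ interior Ωᶜ := by
    rintro _ ⟨t, ht, rfl⟩
    have := hcon t ht
    rw [interior_compl]
    by_cases h1 : x + t • (z - x) ∈ closure Ω
    · exact Or.inl (by_contra fun h2 => this ⟨h1, h2⟩)
    · exact Or.inr h1
  rcases h _ _ isOpen_interior isOpen_interior hsub (by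
      rw [Set.eq_empty_iff_forall_notMem]
      rintro w ⟨-, h1, h2⟩
      exact interior_subset h2 (interior_subset h1)) with h | h
  · exact hz (interior_subset (h ⟨1, by simp, by simp⟩))
  · exact interior_subset (h ⟨0, by simp, by simp⟩) hx

variable (hΩo : IsOpen Ω) (hΩc : Convex ℝ Ω)

include hH hΩ hΩb hΩo hΩc in
-- Starting at `x` and moving by `s • gradient H N`, where `N` is the normal at `y`, one lands on
-- the supporting hyperplane at `y` when `s` is the normalized distance to it. The boundary is
-- therefore crossed at polar distance at most `s`. The other inequality tests the infimum at a
-- nearest boundary point.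
theorem anisotropicDist_eq_supportDist (hne : (frontier Ω).Nonempty)
    {x : EuclideanSpace ℝ (Fin n)} (hx : x ∈ Ω) :
    anisotropicDist H Ω x = supportDist H Ω x := by
  refine le_antisymm (le_supportDist hne fun y hy => ?_) ?_
  · set N := outerUnitNormal Ω y with hN
    have hN0 : N ≠ 0 := outerUnitNormal_ne_zero hΩ hy
    have hHN := hH.pos hN0
    set s := ⟪y - x, N⟫ / H N with hs
    have hs0 : 0 ≤ s := by
      have := inner_sub_outerUnitNormal_neg hΩ hΩo hΩc hy hx
      rw [← neg_sub, inner_neg_left] at this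
      exact div_nonneg (by linarith) hHN.le
    have hz : x + s • gradient H N ∉ Ω := fun hz => by
      have := inner_sub_outerUnitNormal_neg hΩ hΩo hΩc hy hz
      rw [add_sub_right_comm, inner_add_left, inner_smul_left, ← hN, hH.inner_gradient_self hN0,
        ← neg_sub, inner_neg_left, hs] at this
      simp [div_mul_cancel₀ _ hHN.ne'] at this
    obtain ⟨t, ht, hf⟩ := exists_mem_frontier_segment hx hz
    refine (anisotropicDist_le_polar hH hf x).trans ?_
    rw [add_sub_cancel_left, sub_add_cancel_left, hH.polar_neg]
    calc _ ≤ t * polar H (s • gradient H N) := hH.polar_smul_le ht.1 _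
      _ ≤ t * (s * polar H (gradient H N)) :=
        mul_le_mul_of_nonneg_left (hH.polar_smul_le hs0 _) ht.1
      _ ≤ 1 * (s * 1) := by
        have := hH.polar_gradient_le_one hN0
        have := hH.polar_nonneg (gradient H N)
        have := ht.2
        have := ht.1
        gcongr
      _ = s := by ring
  · obtain ⟨y, hy, h⟩ := exists_polar_eq_anisotropicDist hH hΩb hne x
    rw [h, ← hH.polar_neg, neg_sub]
    exact supportDist_le_polar hH hΩ hΩb hy

include hH hΩ hΩb hΩo hΩc in
theorem supportDist_pos (hne : (frontier Ω).Nonempty) {x : EuclideanSpace ℝ (Fin n)}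
    (hx : x ∈ Ω) : 0 < supportDist H Ω x := by
  rw [← anisotropicDist_eq_supportDist hH hΩ hΩb hΩo hΩc hne hx]
  obtain ⟨y, hy, h⟩ := exists_polar_eq_anisotropicDist hH hΩb hne x
  rw [h]
  refine hH.polar_pos (sub_ne_zero.mpr ?_)
  rintro rfl
  rw [hΩo.frontier_eq] at hy
  exact hy.2 hx

include hH hΩ hΩb hΩo hΩc in
-- On the segment from an interior point `c` to `x`, the supporting hyperplane at the crossing point
-- separates the two. The sign outside `Ω` is what makes functions of `supportDist` that vanish on
-- `(-∞, 0]` usable as test functions.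
theorem supportDist_nonpos (hne : Ω.Nonempty) {x : EuclideanSpace ℝ (Fin n)} (hx : x ∉ Ω) :
    supportDist H Ω x ≤ 0 := by
  obtain ⟨c, hc⟩ := hne
  obtain ⟨t, ht, hy⟩ := exists_mem_frontier_segment hc hx
  set y := c + t • (x - c) with hyd
  refine (supportDist_le hH hΩ hΩb (x := x) hy).trans ?_
  have h1 := inner_sub_outerUnitNormal_neg hΩ hΩo hΩc hy hc
  refine div_nonpos_of_nonpos_of_nonneg ?_ (hH.nonneg _)
  have h2 : c - y = -(t • (x - c)) := by rw [hyd]; abel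
  have h3 : y - x = -((1 - t) • (x - c)) := by
    rw [hyd, sub_smul, one_smul]; abel
  rw [h2, inner_neg_left, inner_smul_left] at h1
  rw [h3, inner_neg_left, inner_smul_left]
  simp only [RCLike.conj_to_real] at h1 ⊢
  have h4 : 0 < ⟪x - c, outerUnitNormal Ω y⟫ := by
    by_contra! h5
    nlinarith [ht.1]
  nlinarith [ht.2]

/-- The difference quotient of a differentiable function, along a ray. -/
theorem HasGradientAt.tendsto_quotient {f : EuclideanSpace ℝ (Fin n) → ℝ}
    {g x : EuclideanSpace ℝ (Fin n)} (hf : HasGradientAt f g x) (v : EuclideanSpace ℝ (Fin n)) :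
    Tendsto (fun t : ℝ => (f (x + t • v) - f x) / t) (𝓝[>] 0) (𝓝 ⟪g, v⟫) := by
  have hl : HasDerivAt (fun t : ℝ => x + t • v) v 0 := by
    simpa using ((hasDerivAt_id (0 : ℝ)).smul_const v).const_add x
  have hφ' : HasFDerivAt f (InnerProductSpace.toDual ℝ _ g) (x + (0 : ℝ) • v) := by
    simpa using hf.hasFDerivAt
  have hd := hφ'.comp_hasDerivAt (0 : ℝ) hl
  have hs := (hasDerivAt_iff_tendsto_slope.mp hd).mono_left
    (nhdsWithin_mono (0 : ℝ) (s := Set.Ioi 0) fun t ht => ne_of_gt ht)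
  simpa [slope_fun_def_field] using hs

include hH hΩ hΩb hΩo hΩc in
/-- The eikonal equation `H(D d_H) = 1` at points of differentiability. -/
theorem eikonal_supportDist (hne : (frontier Ω).Nonempty) {x g : EuclideanSpace ℝ (Fin n)}
    (hx : x ∈ Ω) (hg : HasGradientAt (supportDist H Ω) g x) : H g = 1 := by
  -- Upper bound: directional derivatives along `v` are at most `polar H v`, and duality turns this
  -- into `H g ≤ 1`.
  refine le_antisymm (hH.le_of_inner_le_polar zero_le_one fun v => ?_) ?_
  · refine le_of_tendsto (hg.tendsto_quotient v) ?_
    filter_upwards [self_mem_nhdsWithin] with t ht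
    have ht' : (0 : ℝ) < t := ht
    rw [div_le_iff₀ ht', one_mul]
    have h1 := supportDist_sub_le hH hΩ hΩb hne (x + t • v) x
    rw [sub_add_cancel_left, hH.polar_neg] at h1
    have h2 := hH.polar_smul_le ht'.le v
    linarith
  -- Lower bound: towards a nearest boundary point `y` the distance decreases at the full rate
  -- `polar H (x - y)`, which is possible only if `H g ≥ 1`.
  · obtain ⟨y, hy, h⟩ := exists_polar_eq_anisotropicDist hH hΩb hne x
    rw [anisotropicDist_eq_supportDist hH hΩ hΩb hΩo hΩc hne hx] at h
    have hpos := supportDist_pos hH hΩ hΩb hΩo hΩc hne hx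
    have h1 : ⟪g, y - x⟫ ≤ -polar H (x - y) := by
      refine le_of_tendsto (hg.tendsto_quotient (y - x)) ?_
      filter_upwards [self_mem_nhdsWithin, nhdsWithin_le_nhds (gt_mem_nhds one_pos)] with t ht ht1
      have ht' : (0 : ℝ) < t := ht
      rw [div_le_iff₀ ht']
      have h2 := supportDist_le_polar hH hΩ hΩb (x := x + t • (y - x)) hy
      have h3 : y - (x + t • (y - x)) = -((1 - t) • (x - y)) := by
        rw [sub_smul, one_smul, smul_sub, smul_sub]; abel
      rw [h3, hH.polar_neg] at h2
      have h4 := hH.polar_smul_le (sub_nonneg.mpr ht1.le) (x - y)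
      rw [h]
      linarith
    have h2 := hH.inner_le_mul_polar g (x - y)
    rw [← neg_sub, inner_neg_right] at h1
    have h3 : 1 * polar H (x - y) ≤ H g * polar H (x - y) := by linarith
    rw [h] at hpos
    exact le_of_mul_le_mul_right h3 hpos

end SupportDist

/-! ### Convex functions: gradients, mollification, sign of the divergence -/

section Convex

variable {n : ℕ}

local notation "E" => EuclideanSpace ℝ (Fin n)

theorem ConvexOn.inner_gradient_le_sub {f : E → ℝ} (hf : ConvexOn ℝ Set.univ f) {g x : E}
    (hg : HasGradientAt f g x) (v : E) : ⟪g, v⟫ ≤ f (x + v) - f x := by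
  refine le_of_tendsto (hg.tendsto_quotient v) ?_
  filter_upwards [self_mem_nhdsWithin, nhdsWithin_le_nhds (gt_mem_nhds one_pos)] with t ht ht1
  have ht' : (0 : ℝ) < t := ht
  rw [div_le_iff₀ ht']
  have h := hf.2 (Set.mem_univ x) (Set.mem_univ (x + v)) (sub_nonneg.mpr ht1.le) ht'.le (by ring)
  have e : (1 - t) • x + t • (x + v) = x + t • v := by
    rw [sub_smul, one_smul, smul_add]; abel
  rw [e] at h
  simp only [smul_eq_mul] at h
  linarith

theorem tendsto_of_forall_tendsto_inner {ι : Type*} {l : Filter ι} {g : ι → E} {g₀ : E}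
    (h : ∀ v, Tendsto (fun k => ⟪g k, v⟫) l (𝓝 ⟪g₀, v⟫)) : Tendsto g l (𝓝 g₀) := by
  have e : ∀ w : E, w = ∑ i, ⟪w, EuclideanSpace.basisFun (Fin n) ℝ i⟫ •
      EuclideanSpace.basisFun (Fin n) ℝ i := fun w => by
    conv_lhs => rw [← (EuclideanSpace.basisFun (Fin n) ℝ).sum_repr' w]
    simp only [real_inner_comm]
  rw [e g₀, funext fun k => e (g k)]
  exact tendsto_finsetSum _ fun i _ => (h _).smul_const _

/-- Gradients of pointwise convergent convex functions converge at points of differentiability. -/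
theorem tendsto_gradient_of_convexOn {F : ℕ → E → ℝ} {f : E → ℝ} {G : ℕ → E} {g x : E}
    (hF : ∀ k, ConvexOn ℝ Set.univ (F k)) (hlim : ∀ z, Tendsto (fun k => F k z) atTop (𝓝 (f z)))
    (hG : ∀ k, HasGradientAt (F k) (G k) x) (hg : HasGradientAt f g x) :
    Tendsto G atTop (𝓝 g) := by
  -- Convexity bounds `⟪G k, v⟫` by a difference quotient of `F k` with fixed step `t`. The step is
  -- chosen so that the quotient of `f` is already below `c`, and then `k → ∞`.
  have key : ∀ v : E, ∀ c, ⟪g, v⟫ < c → ∀ᶠ k in atTop, ⟪G k, v⟫ < c := by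
    intro v c hc
    obtain ⟨t, h1, h2⟩ := (((hg.tendsto_quotient v).eventually_lt_const hc).and
      self_mem_nhdsWithin).exists
    have ht : (0 : ℝ) < t := h2
    have h3 : Tendsto (fun k => (F k (x + t • v) - F k x) / t) atTop
        (𝓝 ((f (x + t • v) - f x) / t)) := ((hlim _).sub (hlim _)).div_const t
    filter_upwards [h3.eventually_lt_const h1] with k hk
    refine lt_of_le_of_lt ?_ hk
    rw [le_div_iff₀ ht]
    have := (hF k).inner_gradient_le_sub (hG k) (t • v)
    rwa [inner_smul_right, mul_comm] at this
  refine tendsto_of_forall_tendsto_inner fun v => tendsto_order.mpr ⟨fun c hc => ?_, key v⟩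
  -- The lower bound is the upper bound in the opposite direction.
  filter_upwards [key (-v) (-c) (by rw [inner_neg_right]; linarith)] with k hk
  rw [inner_neg_right] at hk
  linarith

/-- Convex Lipschitz functions are limits of smooth convex functions lying above them. -/
theorem exists_contDiff_convexOn_approx {f : E → ℝ} (hf : ConvexOn ℝ Set.univ f) {K : NNReal}
    (hK : LipschitzWith K f) : ∃ F : ℕ → E → ℝ, (∀ k, ContDiff ℝ 2 (F k)) ∧
      (∀ k, ConvexOn ℝ Set.univ (F k)) ∧ (∀ k, LipschitzWith K (F k)) ∧ (∀ k x, f x ≤ F k x) ∧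
      ∀ x, Tendsto (fun k => F k x) atTop (𝓝 (f x)) := by
  -- Only the convergence of the outer radius to `0` matters.
  let φ : ℕ → ContDiffBump (0 : E) := fun k =>
    ⟨1 / (k + 2 : ℝ), 1 / (k + 1 : ℝ), by positivity, by
      apply one_div_lt_one_div_of_lt <;> [positivity; linarith]⟩
  have hc := hK.continuous
  set F : ℕ → E → ℝ := fun k =>
    (MeasureTheory.convolution ((φ k).normed volume) f (ContinuousLinearMap.lsmul ℝ ℝ) volume) with hF
  have hFe : ∀ k x, F k x = ∫ t, (φ k).normed volume t * f (x - t) := fun k x => rfl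
  have hint : ∀ k (g : E → ℝ), Continuous g →
      Integrable (fun t => (φ k).normed volume t * g t) := fun k g hg =>
    ((φ k).continuous_normed.mul hg).integrable_of_hasCompactSupport
      ((φ k).hasCompactSupport_normed.mul_right)
  have hconst : ∀ k (c : ℝ), ∫ t, (φ k).normed volume t * c = c := fun k c => by
    rw [integral_mul_const, (φ k).integral_normed, one_mul]
  have hint' : ∀ k x, Integrable (fun t => (φ k).normed volume t * f (x - t)) := fun k x =>
    hint k _ (by fun_prop)
  refine ⟨F, fun k => ?_, fun k => ?_, fun k => ?_, fun k x => ?_, fun x => ?_⟩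
  · exact (φ k).hasCompactSupport_normed.contDiff_convolution_left _ (φ k).contDiff_normed
      hc.locallyIntegrable
  · refine ⟨convex_univ, fun x _ y _ a b ha hb hab => ?_⟩
    simp only [hFe, smul_eq_mul]
    rw [← integral_const_mul, ← integral_const_mul,
      ← integral_add ((hint' k x).const_mul a) ((hint' k y).const_mul b)]
    refine integral_mono (hint' k _) (((hint' k x).const_mul a).add ((hint' k y).const_mul b))
      fun t => ?_
    have h := hf.2 (Set.mem_univ (x - t)) (Set.mem_univ (y - t)) ha hb hab
    have e : a • (x - t) + b • (y - t) = a • x + b • y - t := by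
      rw [smul_sub, smul_sub, sub_add_sub_comm, ← add_smul, hab, one_smul]
    rw [e] at h
    have h2 := mul_le_mul_of_nonneg_left h ((φ k).nonneg_normed (μ := volume) t)
    simp only [smul_eq_mul] at h2 ⊢
    linarith
  · refine LipschitzWith.of_le_add_mul _ fun x y => ?_
    rw [hFe, hFe, ← hconst k (K * dist x y), ← integral_add (hint' k y) (hint k _ continuous_const)]
    refine integral_mono (hint' k _) ((hint' k y).add (hint k _ continuous_const)) fun t => ?_
    simp only
    rw [← mul_add]
    refine mul_le_mul_of_nonneg_left ?_ ((φ k).nonneg_normed (μ := volume) t)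
    have := hK.le_add_mul (x - t) (y - t)
    rwa [dist_sub_right] at this
  -- The kernel is even, so `2 * F k x` averages `f (x + t) + f (x - t)`, which is at least `2 * f
  -- x` by midpoint convexity.
  · have h1 : F k x = ∫ t, (φ k).normed volume t * f (x + t) := by
      rw [hFe, ← integral_neg_eq_self]
      simp only [sub_neg_eq_add, (φ k).normed_neg]
    have h2 : 2 * f x ≤ F k x + F k x := by
      nth_rw 1 [h1]
      rw [hFe, ← integral_add (hint k _ (by fun_prop)) (hint' k x), ← hconst k (2 * f x)]
      refine integral_mono (hint k _ continuous_const)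
        ((hint k _ (by fun_prop)).add (hint' k x)) fun t => ?_
      simp only
      rw [← mul_add]
      refine mul_le_mul_of_nonneg_left ?_ ((φ k).nonneg_normed (μ := volume) t)
      have h := hf.2 (Set.mem_univ (x + t)) (Set.mem_univ (x - t))
        (by norm_num : (0 : ℝ) ≤ 1 / 2) (by norm_num : (0 : ℝ) ≤ 1 / 2) (by norm_num)
      have e : (1 / 2 : ℝ) • (x + t) + (1 / 2 : ℝ) • (x - t) = x := by
        rw [← smul_add, add_add_sub_cancel, ← two_smul ℝ x, smul_smul]; norm_num
      rw [e] at h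
      simp only [smul_eq_mul] at h
      linarith
    linarith
  · exact ContDiffBump.convolution_tendsto_right_of_continuous
      (by simpa [φ] using tendsto_one_div_add_atTop_nhds_zero_nat (𝕜 := ℝ)) hc x

theorem contDiff_gradient {f : E → ℝ} (hf : ContDiff ℝ 2 f) : ContDiff ℝ 1 (gradient f) :=
  (InnerProductSpace.toDual ℝ E).symm.contDiff.comp (hf.fderiv_right (m := 1) (by norm_num))

theorem inner_gradient_eq_fderiv (f : E → ℝ) (x v : E) : ⟪gradient f x, v⟫ = fderiv ℝ f x v := by
  rw [gradient, InnerProductSpace.toDual_symm_apply]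

theorem inner_fderiv_gradient {f : E → ℝ} (hf : ContDiff ℝ 2 f) (x v w : E) :
    ⟪fderiv ℝ (gradient f) x v, w⟫ = fderiv ℝ (fderiv ℝ f) x v w := by
  have h1 : HasFDerivAt (fderiv ℝ f) (fderiv ℝ (fderiv ℝ f) x) x :=
    ((hf.fderiv_right (m := 1) (by norm_num)).differentiable one_ne_zero x).hasFDerivAt
  have h2 : HasFDerivAt (gradient f) _ x :=
    ((InnerProductSpace.toDual ℝ E).symm.toContinuousLinearEquiv.toContinuousLinearMap.restrictScalars ℝ).hasFDerivAt.comp x h1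
  rw [h2.fderiv]
  exact InnerProductSpace.toDual_symm_apply

/-- Symmetry of second derivatives, in the operator form needed to diagonalize the Hessian. -/
theorem inner_fderiv_gradient_comm {f : E → ℝ} (hf : ContDiff ℝ 2 f) (x v w : E) :
    ⟪fderiv ℝ (gradient f) x v, w⟫ = ⟪v, fderiv ℝ (gradient f) x w⟫ := by
  rw [real_inner_comm _ v, inner_fderiv_gradient hf, inner_fderiv_gradient hf]
  exact hf.contDiffAt.isSymmSndFDerivAt (by simp) v w

/-- The gradient is monotone, as seen by adding the two tangent inequalities at `x` and `x + t • v`;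
its derivative is then positive semidefinite. -/
theorem ConvexOn.inner_fderiv_gradient_nonneg {f : E → ℝ} (hc : ConvexOn ℝ Set.univ f)
    (hf : ContDiff ℝ 2 f) (x v : E) : 0 ≤ ⟪fderiv ℝ (gradient f) x v, v⟫ := by
  have hg : ∀ y, HasGradientAt f (gradient f y) y := fun y =>
    (hf.differentiable two_ne_zero y).hasGradientAt
  have hl : HasDerivAt (fun t : ℝ => x + t • v) v 0 := by
    simpa using ((hasDerivAt_id (0 : ℝ)).smul_const v).const_add x
  have h1 : HasFDerivAt (gradient f) (fderiv ℝ (gradient f) x) (x + (0 : ℝ) • v) := by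
    simpa using ((contDiff_gradient hf).differentiable one_ne_zero x).hasFDerivAt
  have hd := (h1.comp_hasDerivAt (0 : ℝ) hl).inner ℝ (hasDerivAt_const (0 : ℝ) v)
  have hs := (hasDerivAt_iff_tendsto_slope.mp hd).mono_left
    (nhdsWithin_mono (0 : ℝ) (s := Set.Ioi 0) fun t ht => ne_of_gt ht)
  simp only [inner_zero_right, zero_add] at hs
  refine ge_of_tendsto hs ?_
  filter_upwards [self_mem_nhdsWithin] with t ht
  have ht' : (0 : ℝ) < t := ht
  have a1 := hc.inner_gradient_le_sub (hg x) (t • v)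
  have a2 := hc.inner_gradient_le_sub (hg (x + t • v)) (-(t • v))
  rw [add_neg_cancel_right, inner_neg_right, inner_smul_right] at a2
  rw [inner_smul_right] at a1
  simp only [slope, Function.comp, vsub_eq_sub, sub_zero, zero_smul, add_zero, smul_eq_mul]
  have a3 : 0 ≤ t * (⟪gradient f (x + t • v), v⟫ - ⟪gradient f x, v⟫) := by linarith
  exact mul_nonneg (inv_nonneg.mpr ht'.le) (nonneg_of_mul_nonneg_right a3 ht')

/-- The divergence of `∇G(∇f)` is nonpositive for `G` convex and `f` concave. -/
theorem sum_inner_fderiv_gradient_gradient_nonpos {G f : E → ℝ} (hGc : ConvexOn ℝ Set.univ G)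
    (hG : ContDiff ℝ 2 G) (hfc : ConvexOn ℝ Set.univ (-f)) (hf : ContDiff ℝ 2 f) (x : E) :
    ∑ i, ⟪EuclideanSpace.basisFun (Fin n) ℝ i, fderiv ℝ (fun y => gradient G (gradient f y)) x
      (EuclideanSpace.basisFun (Fin n) ℝ i)⟫ ≤ 0 := by
  set A := fderiv ℝ (gradient G) (gradient f x)
  set B := fderiv ℝ (gradient f) x with hB
  have hcomp : fderiv ℝ (fun y => gradient G (gradient f y)) x = A ∘L B :=
    fderiv_comp x ((contDiff_gradient hG).differentiable one_ne_zero _)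
      ((contDiff_gradient hf).differentiable one_ne_zero x)
  have hBs : (B : E →ₗ[ℝ] E).IsSymmetric := fun v w => inner_fderiv_gradient_comm hf x v w
  have hneg : ∀ v, ⟪B v, v⟫ ≤ 0 := by
    intro v
    have h1 := hfc.inner_fderiv_gradient_nonneg hf.neg x v
    have h2 : gradient (-f) = -gradient f := by
      funext y
      rw [Pi.neg_apply, gradient, gradient, fderiv_neg, _root_.map_neg]
    rw [h2, fderiv_neg, neg_apply, inner_neg_left] at h1
    linarith
  have hn : Module.finrank ℝ E = n := by simp
  have h1 := LinearMap.trace_eq_sum_inner ((A ∘L B : E →L[ℝ] E) : E →ₗ[ℝ] E)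
    (EuclideanSpace.basisFun (Fin n) ℝ)
  -- The trace of `A ∘L B` is evaluated in an eigenbasis of `B`, where each diagonal entry is an
  -- eigenvalue of `B`, nonpositive, times `⟪A b, b⟫ ≥ 0`. No symmetry of `A` is required.
  have h2 := LinearMap.trace_eq_sum_inner ((A ∘L B : E →L[ℝ] E) : E →ₗ[ℝ] E)
    (hBs.eigenvectorBasis hn)
  rw [hcomp]
  refine (h1.symm.trans h2).trans_le (Finset.sum_nonpos fun i _ => ?_)
  set b := hBs.eigenvectorBasis hn i with hb
  have h3 : B b = hBs.eigenvalues hn i • b := hBs.apply_eigenvectorBasis hn i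
  have h4 := hneg b
  rw [h3, inner_smul_left] at h4
  have h5 : ⟪b, b⟫ = 1 := by
    rw [real_inner_self_eq_norm_sq, hb, OrthonormalBasis.norm_eq_one]; norm_num
  rw [h5] at h4
  have h6 := hGc.inner_fderiv_gradient_nonneg hG (gradient f x) b
  change ⟪b, A (B b)⟫ ≤ 0
  rw [h3, _root_.map_smul, inner_smul_right, real_inner_comm]
  exact mul_nonpos_of_nonpos_of_nonneg (by simpa using h4) h6

/-- The vector field `∇G(∇f)` has nonpositive divergence in the weak sense. -/
theorem integral_inner_gradient_nonneg {G f ζ : E → ℝ} (hGc : ConvexOn ℝ Set.univ G)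
    (hG : ContDiff ℝ 2 G) (hfc : ConvexOn ℝ Set.univ (-f)) (hf : ContDiff ℝ 2 f)
    (hζ : ContDiff ℝ 1 ζ) (hζs : HasCompactSupport ζ) (hζ0 : ∀ x, 0 ≤ ζ x) :
    0 ≤ ∫ x, ⟪gradient G (gradient f x), gradient ζ x⟫ := by
  set X : E → E := fun x => gradient G (gradient f x) with hX
  have hXc : ContDiff ℝ 1 X := (contDiff_gradient hG).comp (contDiff_gradient hf)
  set b := EuclideanSpace.basisFun (Fin n) ℝ with hb
  have hXi : ∀ i, ContDiff ℝ 1 fun x => ⟪b i, X x⟫ := fun i => contDiff_const.inner ℝ hXc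
  have hdX : ∀ i x, fderiv ℝ (fun x => ⟪b i, X x⟫) x (b i) = ⟪b i, fderiv ℝ X x (b i)⟫ := by
    intro i x
    rw [fderiv_inner_apply ℝ (differentiableAt_const _) (hXc.differentiable one_ne_zero x)]
    simp
  have e1 : ∀ x, ⟪X x, gradient ζ x⟫ = ∑ i, ⟪b i, X x⟫ * fderiv ℝ ζ x (b i) := by
    intro x
    rw [← b.sum_inner_mul_inner]
    refine Finset.sum_congr rfl fun i _ => ?_
    rw [real_inner_comm (X x), inner_gradient_right]
    rfl
  have i1 : ∀ i, Integrable (fun x => ⟪b i, X x⟫ * fderiv ℝ ζ x (b i)) := fun i =>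
    ((hXi i).continuous.mul ((hζ.continuous_fderiv one_ne_zero).clm_apply
      continuous_const)).integrable_of_hasCompactSupport
        ((hζs.fderiv_apply ℝ (b i)).mul_left)
  have i2 : ∀ i, Integrable (fun x => fderiv ℝ (fun x => ⟪b i, X x⟫) x (b i) * ζ x) := fun i =>
    ((((hXi i).continuous_fderiv one_ne_zero).clm_apply
      continuous_const).mul hζ.continuous).integrable_of_hasCompactSupport hζs.mul_left
  have i3 : ∀ i, Integrable (fun x => ⟪b i, X x⟫ * ζ x) := fun i =>
    ((hXi i).continuous.mul hζ.continuous).integrable_of_hasCompactSupport hζs.mul_left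
  -- Integration by parts in each coordinate, without boundary terms since `ζ` has compact support.
  have e2 : ∀ i, ∫ x, ⟪b i, X x⟫ * fderiv ℝ ζ x (b i) =
      -∫ x, fderiv ℝ (fun x => ⟪b i, X x⟫) x (b i) * ζ x := fun i =>
    integral_mul_fderiv_eq_neg_fderiv_mul_of_integrable (i2 i) (i1 i) (i3 i)
      (fun x _ => (hXi i).differentiable one_ne_zero x)
      (fun x _ => hζ.differentiable one_ne_zero x)
  rw [funext e1, integral_finsetSum _ fun i _ => i1 i, Finset.sum_congr rfl fun i _ => e2 i,
    Finset.sum_neg_distrib, ← integral_finsetSum _ fun i _ => i2 i, ← integral_neg]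
  refine integral_nonneg fun x => ?_
  simp only [hdX]
  rw [← Finset.sum_mul, Pi.zero_apply, Left.nonneg_neg_iff]
  exact mul_nonpos_of_nonpos_of_nonneg
    (sum_inner_fderiv_gradient_gradient_nonpos hGc hG hfc hf x) (hζ0 x)

end Convex

/-! ### The weak divergence inequality for a concave function, and the cutoff -/

section Superharmonic

variable {n : ℕ}

local notation "E" => EuclideanSpace ℝ (Fin n)

theorem norm_gradient_le_of_lipschitzWith {f : E → ℝ} {K : NNReal} (hf : LipschitzWith K f)
    (x : E) : ‖gradient f x‖ ≤ K := by
  rw [gradient, LinearIsometryEquiv.norm_map]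
  exact norm_fderiv_le_of_lipschitz ℝ hf

theorem measurable_gradient (f : E → ℝ) : Measurable (gradient f) :=
  (InnerProductSpace.toDual ℝ E).symm.continuous.measurable.comp (measurable_fderiv ℝ f)

theorem gradient_mul_comp {ψ f : E → ℝ} {h : ℝ → ℝ} {h' : ℝ} {x : E}
    (hψ : DifferentiableAt ℝ ψ x) (hf : DifferentiableAt ℝ f x) (hh : HasDerivAt h h' (f x)) :
    gradient (fun y => ψ y * h (f y)) x =
      h (f x) • gradient ψ x + (ψ x * h') • gradient f x := by
  have h1 := hψ.hasFDerivAt.mul (hh.comp_hasFDerivAt x hf.hasFDerivAt)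
  have h2 : gradient (fun y => ψ y * h (f y)) x = (InnerProductSpace.toDual ℝ E).symm
    (ψ x • (h' • fderiv ℝ f x) + h (f x) • fderiv ℝ ψ x) := by
    rw [gradient]; exact congrArg _ h1.fderiv
  rw [h2, gradient, gradient]
  simp only [_root_.map_add, _root_.map_smul, smul_smul]
  rw [add_comm]

/-- The anisotropic Laplacian of a concave Lipschitz function is nonpositive, tested against
`ψ h(f)`. -/
theorem integral_anisotropic_nonneg {H : E → ℝ} (hH : IsAnisotropy H) {Ω : Set E}
    (hΩm : MeasurableSet Ω) (hΩb : Bornology.IsBounded Ω) {f : E → ℝ} {K : NNReal}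
    (hfc : ConvexOn ℝ Set.univ (-f)) (hfK : LipschitzWith K f) (hf0 : ∀ x ∉ Ω, f x ≤ 0)
    (hfg : ∀ x ∈ Ω, DifferentiableAt ℝ f x → gradient f x ≠ 0)
    {ψ : E → ℝ} (hψ : ContDiff ℝ 1 ψ) (hψ0 : ∀ x, 0 ≤ ψ x) {h h' : ℝ → ℝ}
    (hh : ∀ s, HasDerivAt h (h' s) s) (hh' : Continuous h') (h0 : ∀ s, 0 ≤ h s)
    (hn : ∀ s ≤ 0, h s = 0) (hn' : ∀ s ≤ 0, h' s = 0) :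
    IntegrableOn (fun x => h (f x) * ⟪gradient H (gradient f x), gradient ψ x⟫ +
      ψ x * h' (f x) * H (gradient f x)) Ω ∧
    0 ≤ ∫ x in Ω, (h (f x) * ⟪gradient H (gradient f x), gradient ψ x⟫ +
      ψ x * h' (f x) * H (gradient f x)) := by
  obtain ⟨L, hL⟩ := hH.exists_lipschitz
  -- `G j → H` and `F k → -f`. The limit in `k` is taken first: `gradient (G j)` is continuous
  -- everywhere, so zeros of the mollified gradients do no harm. The limit in `j` then needs
  -- differentiability of `H` only at `gradient f x ≠ 0`.
  obtain ⟨G, hG2, hGc, hGL, -, hGlim⟩ := exists_contDiff_convexOn_approx hH.convexOn hL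
  obtain ⟨F, hF2, hFc, hFK, hFge, hFlim⟩ := exists_contDiff_convexOn_approx hfc hfK.neg
  have hhc : Continuous h := continuous_iff_continuousAt.mpr fun s => (hh s).continuousAt
  have hfcont := hfK.continuous
  have hcpt : IsCompact (closure Ω) := hΩb.isCompact_closure
  have hfin : volume Ω ≠ ⊤ := hΩb.measure_lt_top.ne
  -- uniform bounds on the closure of the domain
  obtain ⟨M, hM⟩ := hcpt.exists_bound_of_continuousOn hfcont.continuousOn
  obtain ⟨B₁, hB₁⟩ := isCompact_Icc.exists_bound_of_continuousOn (s := Set.Icc 0 M) hhc.continuousOn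
  obtain ⟨B₂, hB₂⟩ := isCompact_Icc.exists_bound_of_continuousOn (s := Set.Icc 0 M) hh'.continuousOn
  obtain ⟨B₃, hB₃⟩ := hcpt.exists_bound_of_continuousOn hψ.continuous.continuousOn
  obtain ⟨B₄, hB₄⟩ := hcpt.exists_bound_of_continuousOn
    (f := gradient ψ) ((InnerProductSpace.toDual ℝ E).symm.continuous.comp
      (hψ.continuous_fderiv one_ne_zero)).continuousOn
  -- Since `h` and `h'` vanish on `(-∞, 0]`, an upper bound on the argument suffices; it is
  -- inherited from `-F k ≤ f`.
  have hbh : ∀ s ≤ M, |h s| ≤ |B₁| := fun s hs => by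
    rcases le_total s 0 with h1 | h1
    · rw [hn s h1, abs_zero]; exact abs_nonneg _
    · exact (hB₁ s ⟨h1, hs⟩).trans (le_abs_self _)
  have hbh' : ∀ s ≤ M, |h' s| ≤ |B₂| := fun s hs => by
    rcases le_total s 0 with h1 | h1
    · rw [hn' s h1, abs_zero]; exact abs_nonneg _
    · exact (hB₂ s ⟨h1, hs⟩).trans (le_abs_self _)
  have hbd : ∀ (q g : E) (s : ℝ), ∀ x ∈ Ω, ‖q‖ ≤ L → ‖g‖ ≤ K → s ≤ M →
      ‖⟪q, h s • gradient ψ x + (ψ x * h' s) • g⟫‖ ≤ L * (|B₁| * B₄ + B₃ * |B₂| * K) := by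
    intro q g s x hx hq hg hs
    have hxc := subset_closure hx
    refine (norm_inner_le_norm _ _).trans ?_
    refine mul_le_mul hq ((norm_add_le _ _).trans ?_) (norm_nonneg _) L.2
    rw [norm_smul, norm_smul, norm_mul]
    have b3 := hB₃ x hxc
    have b30 := (norm_nonneg _).trans b3
    gcongr
    · exact hbh s hs
    · exact hB₄ x hxc
    · exact hbh' s hs
  have hFle : ∀ k x, -F k x ≤ f x := fun k x => by
    have := hFge k x
    simp only [Pi.neg_apply] at this
    linarith
  have hfM : ∀ x ∈ Ω, f x ≤ M := fun x hx =>
    (le_abs_self _).trans (hM x (subset_closure hx))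
  have hdiff : ∀ᵐ x, DifferentiableAt ℝ f x := hfK.ae_differentiableAt
  have hgradF : ∀ k x, HasGradientAt (F k) (gradient (F k) x) x := fun k x =>
    ((hF2 k).differentiable two_ne_zero x).hasGradientAt
  have hgradG : ∀ k x, HasGradientAt (G k) (gradient (G k) x) x := fun k x =>
    ((hG2 k).differentiable two_ne_zero x).hasGradientAt
  have hgneg : ∀ k, gradient (-F k) = fun x => -gradient (F k) x := fun k => by
    funext x
    rw [gradient, gradient, fderiv_neg, _root_.map_neg]
  have hgFlim : ∀ x, DifferentiableAt ℝ f x →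
      Tendsto (fun k => gradient (-F k) x) atTop (𝓝 (gradient f x)) := by
    intro x hx
    have h1 : HasGradientAt (-f) (-gradient f x) x := by
      rw [hasGradientAt_iff_hasFDerivAt, _root_.map_neg]
      exact hx.hasGradientAt.hasFDerivAt.neg
    have h2 := (tendsto_gradient_of_convexOn hFc hFlim (fun k => hgradF k x) h1).neg
    simp only [hgneg]
    simpa using h2
  have hgGcont : ∀ j, Continuous (gradient (G j)) := fun j => (contDiff_gradient (hG2 j)).continuous
  have hgFcont : ∀ k, Continuous (gradient (-F k)) := fun k =>
    (contDiff_gradient (hF2 k).neg).continuous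
  have hgψcont : Continuous (gradient ψ) := (InnerProductSpace.toDual ℝ E).symm.continuous.comp
    (hψ.continuous_fderiv one_ne_zero)
  -- the smooth inequality
  have step0 : ∀ j k, 0 ≤ ∫ x in Ω, ⟪gradient (G j) (gradient (-F k) x),
      h (-F k x) • gradient ψ x + (ψ x * h' (-F k x)) • gradient (-F k) x⟫ := by
    intro j k
    have hζ : ContDiff ℝ 1 fun x => ψ x * h ((-F k) x) := by
      refine hψ.mul (ContDiff.comp (contDiff_one_iff_deriv.mpr
        ⟨fun s => (hh s).differentiableAt, ?_⟩) ((hF2 k).neg.of_le one_le_two))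
      rwa [show deriv h = h' from funext fun s => (hh s).deriv]
    -- Outside `Ω` one has `-F k ≤ f ≤ 0`, hence the test function vanishes there. This is why the
    -- approximation has to lie on one side.
    have hζs : HasCompactSupport fun x => ψ x * h ((-F k) x) := by
      refine HasCompactSupport.intro hcpt fun x hx => ?_
      have : x ∉ Ω := fun h => hx (subset_closure h)
      simp only [Pi.neg_apply]
      rw [hn _ ((hFle k x).trans (hf0 x this)), mul_zero]
    have h1 := integral_inner_gradient_nonneg (hGc j) (hG2 j) (f := -F k) (by simpa using hFc k)
      (hF2 k).neg hζ hζs fun x => mul_nonneg (hψ0 x) (h0 _)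
    have h2 : ∀ x, gradient (fun x => ψ x * h ((-F k) x)) x =
      h (-F k x) • gradient ψ x + (ψ x * h' (-F k x)) • gradient (-F k) x := fun x =>
      gradient_mul_comp (hψ.differentiable one_ne_zero x)
        ((hF2 k).neg.differentiable two_ne_zero x) (hh _)
    simp only [h2] at h1
    rwa [setIntegral_eq_integral_of_forall_compl_eq_zero]
    intro x hx
    have h3 : -F k x ≤ 0 := (hFle k x).trans (hf0 x hx)
    rw [hn _ h3, hn' _ h3]
    simp
  -- smoothing of `f` removed
  have step1 : ∀ j, 0 ≤ ∫ x in Ω, ⟪gradient (G j) (gradient f x),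
      h (f x) • gradient ψ x + (ψ x * h' (f x)) • gradient f x⟫ := by
    intro j
    refine ge_of_tendsto' (tendsto_integral_of_dominated_convergence
      (fun _ => L * (|B₁| * B₄ + B₃ * |B₂| * K)) (F := fun k x => ⟪gradient (G j) (gradient (-F k) x),
      h (-F k x) • gradient ψ x + (ψ x * h' (-F k x)) • gradient (-F k) x⟫) (fun k => ?_)
      (integrableOn_const hfin) (fun k => ?_) ?_) (step0 j)
    · have := (hF2 k).continuous
      exact (((hgGcont j).comp (hgFcont k)).inner (((hhc.comp this.neg).smul hgψcont).add
        ((hψ.continuous.mul (hh'.comp this.neg)).smul (hgFcont k)))).aestronglyMeasurable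
    · refine (ae_restrict_iff' hΩm).mpr (Eventually.of_forall fun x hx => ?_)
      refine hbd _ _ _ x hx (norm_gradient_le_of_lipschitzWith (hGL j) _)
        (norm_gradient_le_of_lipschitzWith (hFK k).neg _) ((hFle k x).trans (hfM x hx))
    · filter_upwards [ae_restrict_of_ae hdiff] with x hx
      have h1 : Tendsto (fun k => -F k x) atTop (𝓝 (f x)) := by simpa using (hFlim x).neg
      have h2 := hgFlim x hx
      exact (((hgGcont j).tendsto _).comp h2).inner (((((hhc.tendsto _).comp h1)).smul_const _).add
        ((((hh'.tendsto _).comp h1).const_mul (ψ x)).smul h2))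
  -- smoothing of `H` removed
  have step2 : 0 ≤ ∫ x in Ω, ⟪gradient H (gradient f x),
      h (f x) • gradient ψ x + (ψ x * h' (f x)) • gradient f x⟫ := by
    refine ge_of_tendsto' (tendsto_integral_of_dominated_convergence
      (fun _ => L * (|B₁| * B₄ + B₃ * |B₂| * K)) (F := fun j x => ⟪gradient (G j) (gradient f x),
      h (f x) • gradient ψ x + (ψ x * h' (f x)) • gradient f x⟫) (fun j => ?_)
      (integrableOn_const hfin) (fun j => ?_) ?_) step1
    · have hm := measurable_gradient f
      exact (((hgGcont j).measurable.comp hm).inner ((((hhc.comp hfcont).measurable).smul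
        hgψcont.measurable).add ((hψ.continuous.mul (hh'.comp hfcont)).measurable.smul
          hm))).aestronglyMeasurable
    · refine (ae_restrict_iff' hΩm).mpr (Eventually.of_forall fun x hx => ?_)
      refine hbd _ _ _ x hx (norm_gradient_le_of_lipschitzWith (hGL j) _)
        (norm_gradient_le_of_lipschitzWith hfK _) (hfM x hx)
    · filter_upwards [ae_restrict_of_ae hdiff, ae_restrict_mem hΩm] with x hx hxΩ
      refine Tendsto.inner ?_ tendsto_const_nhds
      exact tendsto_gradient_of_convexOn hGc hGlim (fun j => hgradG j _)
        (hH.hasGradientAt (hfg x hxΩ hx))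
  have hint : IntegrableOn (fun x => ⟪gradient H (gradient f x),
      h (f x) • gradient ψ x + (ψ x * h' (f x)) • gradient f x⟫) Ω := by
    refine Integrable.mono' (integrableOn_const (C := L * (|B₁| * B₄ + B₃ * |B₂| * K)) hfin) ?_
      ((ae_restrict_iff' hΩm).mpr (Eventually.of_forall fun x hx => ?_))
    · have hm := measurable_gradient f
      exact (((measurable_gradient H).comp hm).inner ((((hhc.comp hfcont).measurable).smul
        hgψcont.measurable).add ((hψ.continuous.mul (hh'.comp hfcont)).measurable.smul
          hm))).aestronglyMeasurable
    · exact hbd _ _ _ x hx (norm_gradient_le_of_lipschitzWith hL _)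
        (norm_gradient_le_of_lipschitzWith hfK _) (hfM x hx)
  have hae : (fun x => ⟪gradient H (gradient f x),
      h (f x) • gradient ψ x + (ψ x * h' (f x)) • gradient f x⟫) =ᵐ[volume.restrict Ω]
      fun x => h (f x) * ⟪gradient H (gradient f x), gradient ψ x⟫ +
        ψ x * h' (f x) * H (gradient f x) := ?_
  · exact ⟨hint.congr hae, step2.trans_eq (integral_congr_ae hae)⟩
  filter_upwards [ae_restrict_of_ae hdiff, ae_restrict_mem hΩm] with x hx hxΩ
  rw [inner_add_right, inner_smul_right, inner_smul_right, hH.inner_gradient_self (hfg x hxΩ hx)]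

/-- A `C¹` approximation of the function `s ↦ min (s / ε) 1`, with slope at most `1 / ε`. -/
theorem exists_cutoff {ε : ℝ} (hε : 0 < ε) (hε' : ε < 1 / 2) : ∃ k m : ℝ → ℝ,
    (∀ s, HasDerivAt k (m s) s) ∧ Continuous m ∧ (∀ s, 0 ≤ m s) ∧ (∀ s, m s ≤ 1 / ε) ∧
    (∀ s ≤ 0, m s = 0) ∧ (∀ s, ε ≤ s → m s = 0) ∧ (∀ s ≤ 0, k s = 0) ∧ (∀ s, 0 ≤ k s) ∧
    (∀ s, k s ≤ 1) ∧ ∀ s, ε ≤ s → 1 - 2 * ε ≤ k s := by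
  -- A trapezoid of height `1 / ε` on `[0, ε]` with ramps of length `ε ^ 2`. Its integral lies
  -- between `(ε - 2 * ε ^ 2) / ε = 1 - 2 * ε` and `1`; the condition `ε < 1 / 2` keeps the ramps
  -- disjoint.
  set m : ℝ → ℝ := fun s => max 0 (min 1 (min (s / ε ^ 2) ((ε - s) / ε ^ 2))) / ε with hm
  have hmc : Continuous m := by fun_prop
  have hε2 : 0 < ε ^ 2 := by positivity
  have m0 : ∀ s, 0 ≤ m s := fun s => div_nonneg (le_max_left _ _) hε.le
  have m1 : ∀ s, m s ≤ 1 / ε := fun s => by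
    simp only [hm]; gcongr; exact max_le zero_le_one (min_le_left _ _)
  have mneg : ∀ s ≤ 0, m s = 0 := fun s hs => by
    simp only [hm]
    rw [max_eq_left, zero_div]
    exact (min_le_right _ _).trans ((min_le_left _ _).trans
      (div_nonpos_of_nonpos_of_nonneg hs hε2.le))
  have mbig : ∀ s, ε ≤ s → m s = 0 := fun s hs => by
    simp only [hm]
    rw [max_eq_left, zero_div]
    exact (min_le_right _ _).trans ((min_le_right _ _).trans
      (div_nonpos_of_nonpos_of_nonneg (by linarith) hε2.le))
  have mmid : ∀ s ∈ Set.Icc (ε ^ 2) (ε - ε ^ 2), m s = 1 / ε := fun s hs => by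
    simp only [hm]
    rw [min_eq_left, max_eq_right zero_le_one]
    refine le_min ((one_le_div hε2).mpr hs.1) ((one_le_div hε2).mpr (by linarith [hs.2]))
  have hi : ∀ a b, IntervalIntegrable m volume a b := fun a b => hmc.intervalIntegrable a b
  set k : ℝ → ℝ := fun s => ∫ t in (0 : ℝ)..s, m t with hk
  have hkd : ∀ s, HasDerivAt k (m s) s := fun s =>
    intervalIntegral.integral_hasDerivAt_right (hi _ _)
      (hmc.stronglyMeasurableAtFilter _ _) hmc.continuousAt
  have kmono : Monotone k := monotone_of_hasDerivAt_nonneg hkd fun s => m0 s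
  have kneg : ∀ s ≤ 0, k s = 0 := fun s hs => by
    simp only [hk]
    rw [intervalIntegral.integral_congr (g := fun _ => (0 : ℝ)) fun t ht => mneg t ?_]
    · simp
    · rw [Set.uIcc_of_ge hs] at ht; exact ht.2
  have kbig : ∀ s, ε ≤ s → k s = k ε := fun s hs => by
    simp only [hk]
    rw [← intervalIntegral.integral_add_adjacent_intervals (hi 0 ε) (hi ε s),
      intervalIntegral.integral_congr (a := ε) (g := fun _ => (0 : ℝ)) fun t ht => mbig t ?_]
    · simp
    · rw [Set.uIcc_of_le hs] at ht; exact ht.1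
  have kε1 : k ε ≤ 1 := by
    have := intervalIntegral.integral_mono_on hε.le (hi 0 ε)
      (intervalIntegrable_const (c := 1 / ε)) fun t _ => m1 t
    simpa [hε.ne'] using this
  have kε2 : 1 - 2 * ε ≤ k ε := by
    have h1 : k (ε - ε ^ 2) - k (ε ^ 2) = 1 - 2 * ε := by
      simp only [hk]
      rw [intervalIntegral.integral_interval_sub_left (hi _ _) (hi _ _),
        intervalIntegral.integral_congr (g := fun _ => 1 / ε) fun t ht => mmid t ?_]
      · rw [intervalIntegral.integral_const, smul_eq_mul]; field_simp; ring
      · rwa [Set.uIcc_of_le (by nlinarith)] at ht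
    have h2 : k (ε - ε ^ 2) ≤ k ε := kmono (by nlinarith)
    have h3 : 0 ≤ k (ε ^ 2) := by rw [← kneg 0 le_rfl]; exact kmono hε2.le
    linarith
  refine ⟨k, m, hkd, hmc, m0, m1, mneg, mbig, kneg, fun s => ?_, fun s => ?_, fun s hs => ?_⟩
  · rcases le_total s 0 with h | h
    · exact (kneg s h).ge
    · rw [← kneg 0 le_rfl]; exact kmono h
  · rcases le_total s ε with h | h
    · exact (kmono h).trans kε1
    · exact (kbig s h).le.trans kε1
  · exact kε2.trans (kbig s hs).ge

end Superharmonic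

/-! ### The Hardy inequality with a cutoff -/

section Hardy

variable {n : ℕ}

local notation "E" => EuclideanSpace ℝ (Fin n)

/-- Young's inequality for `a` and `b ^ (p - 1)` with exponents `p` and `p / (p - 1)`, multiplied by
`p`. -/
theorem mul_rpow_mul_le_rpow_add {p : ℝ} (hp : 1 < p) {a b : ℝ} (ha : 0 ≤ a) (hb : 0 ≤ b) :
    p * b ^ (p - 1) * a ≤ a ^ p + (p - 1) * b ^ p := by
  have hp0 : 0 < p := by linarith
  have hc : p.HolderConjugate (p / (p - 1)) := Real.HolderConjugate.conjExponent hp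
  have h := Real.young_inequality_of_nonneg ha (Real.rpow_nonneg hb (p - 1)) hc
  have hp1 : p - 1 ≠ 0 := by linarith
  rw [← Real.rpow_mul hb, mul_div_cancel₀ _ hp1] at h
  have e : p * (a ^ p / p + b ^ p / (p / (p - 1))) = a ^ p + (p - 1) * b ^ p := by
    field_simp
  nlinarith

theorem gradient_abs_rpow {p : ℝ} (hp : 1 < p) {φ : E → ℝ} {x : E}
    (hφ : DifferentiableAt ℝ φ x) :
    gradient (fun y => |φ y| ^ p) x = (p * |φ x| ^ (p - 2) * φ x) • gradient φ x := by
  have h1 := (hasDerivAt_abs_rpow (φ x) hp).comp_hasFDerivAt x hφ.hasFDerivAt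
  have h2 : gradient (fun y => |φ y| ^ p) x = (InnerProductSpace.toDual ℝ E).symm
      ((p * |φ x| ^ (p - 2) * φ x) • fderiv ℝ φ x) := by
    rw [gradient]; exact congrArg _ h1.fderiv
  rw [h2, gradient, _root_.map_smul]

theorem abs_rpow_sub_two_mul {p : ℝ} (hp : 1 < p) (t : ℝ) :
    |p * |t| ^ (p - 2) * t| = p * |t| ^ (p - 1) := by
  rcases eq_or_ne t 0 with rfl | ht
  · simp [Real.zero_rpow (show p - 1 ≠ 0 by linarith)]
  have ht' := abs_pos.mpr ht
  rw [abs_mul, abs_mul, abs_of_pos (by linarith : (0 : ℝ) < p),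
    abs_of_nonneg (Real.rpow_nonneg ht'.le _), mul_assoc]
  congr 1
  rw [← Real.rpow_add_one ht'.ne']
  congr 1; ring

/-- The pointwise inequality behind the Hardy inequality. -/
theorem hardy_pointwise {H : E → ℝ} (hH : IsAnisotropy H) {p : ℝ} (hp : 1 < p) {c ρ : ℝ}
    (hc : 0 < c) (hρ : 0 < ρ) {φ : E → ℝ} {x : E} (hφ : DifferentiableAt ℝ φ x) {g : E}
    (hg : g ≠ 0) :
    c ^ (p - 1) * (ρ ^ (1 - p) * ⟪gradient H g, gradient (fun y => |φ y| ^ p) x⟫) ≤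
      H (gradient φ x) ^ p + (p - 1) * c ^ p * (|φ x| ^ p / ρ ^ p) := by
  have h1 : ⟪gradient H g, gradient (fun y => |φ y| ^ p) x⟫ ≤
      p * |φ x| ^ (p - 1) * H (gradient φ x) := by
    refine (hH.inner_gradient_le hg _).trans ?_
    rw [gradient_abs_rpow hp hφ, hH.homogeneous, abs_rpow_sub_two_mul hp]
  -- With `b = c * |φ x| / ρ` the remainder in Young's inequality is exactly the Hardy integrand,
  -- weighted by the free parameter `c`.
  have h2 := mul_rpow_mul_le_rpow_add hp (hH.nonneg (gradient φ x))
    (b := c * |φ x| / ρ) (by positivity)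
  have e1 : (c * |φ x| / ρ) ^ (p - 1) = c ^ (p - 1) * |φ x| ^ (p - 1) * ρ ^ (1 - p) := by
    rw [Real.div_rpow (by positivity) hρ.le, Real.mul_rpow hc.le (abs_nonneg _),
      show 1 - p = -(p - 1) by ring, Real.rpow_neg hρ.le, div_eq_mul_inv]
  have e2 : (c * |φ x| / ρ) ^ p = c ^ p * (|φ x| ^ p / ρ ^ p) := by
    rw [Real.div_rpow (by positivity) hρ.le, Real.mul_rpow hc.le (abs_nonneg _), mul_div_assoc]
  rw [e1, e2] at h2
  have h3 : 0 ≤ c ^ (p - 1) * ρ ^ (1 - p) := by positivity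
  nlinarith [mul_le_mul_of_nonneg_left h1 h3]

/-- The Hardy inequality for `C¹` functions, with the boundary integral replaced by an average over
a boundary layer, and with a cutoff. -/
theorem hardy_cutoff {H : E → ℝ} (hH : IsAnisotropy H) {p : ℝ} (hp : 1 < p) {Ω : Set E}
    (hΩo : IsOpen Ω) (hΩb : Bornology.IsBounded Ω) (hΩc : Convex ℝ Ω) (hΩ2 : HasC2Boundary Ω)
    (hne : Ω.Nonempty) (hnf : (frontier Ω).Nonempty) {α c ε : ℝ} (hα : 0 < α) (hc : 0 < c)
    {φ : E → ℝ} (hφ : ContDiff ℝ 1 φ) {k m : ℝ → ℝ} (hkm : ∀ s, HasDerivAt k (m s) s)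
    (hm : Continuous m) (hm0 : ∀ s, 0 ≤ m s) (hm1 : ∀ s, m s ≤ 1 / ε) (hmn : ∀ s ≤ 0, m s = 0)
    (hmε : ∀ s, ε ≤ s → m s = 0) (hkn : ∀ s ≤ 0, k s = 0) (hk0 : ∀ s, 0 ≤ k s)
    (hk1 : ∀ s, k s ≤ 1) :
    c ^ (p - 1) * (p - 1) *
        ∫ x in Ω, k (supportDist H Ω x) * (|φ x| ^ p / (supportDist H Ω x + α) ^ p) ≤
      (∫ x in Ω, H (gradient φ x) ^ p) +
        (p - 1) * c ^ p * (∫ x in Ω, |φ x| ^ p / (supportDist H Ω x + α) ^ p) +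
        c ^ (p - 1) * α ^ (1 - p) *
          (1 / ε * ∫ x in Ω ∩ {x | supportDist H Ω x < ε}, |φ x| ^ p) := by
  set D := supportDist H Ω with hD
  obtain ⟨K, hK⟩ := exists_lipschitz_supportDist hH hΩ2 hΩb hnf
  have hDc := hK.continuous
  have hpos : ∀ x ∈ Ω, 0 < D x := fun x hx => supportDist_pos hH hΩ2 hΩb hΩo hΩc hnf hx
  have hgr : ∀ x ∈ Ω, DifferentiableAt ℝ D x → H (gradient D x) = 1 := fun x hx hd =>
    eikonal_supportDist hH hΩ2 hΩb hΩo hΩc hnf hx hd.hasGradientAt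
  have hgr0 : ∀ x ∈ Ω, DifferentiableAt ℝ D x → gradient D x ≠ 0 := fun x hx hd h0 => by
    have := hgr x hx hd
    rw [h0, hH.map_zero] at this
    exact zero_ne_one this
  have hkc : Continuous k := continuous_iff_continuousAt.mpr fun s => (hkm s).continuousAt
  set ψ : E → ℝ := fun x => |φ x| ^ p with hψd
  have hψ : ContDiff ℝ 1 ψ := by
    have := hφ.norm_rpow hp
    simpa only [Real.norm_eq_abs] using this
  have hψ0 : ∀ x, 0 ≤ ψ x := fun x => Real.rpow_nonneg (abs_nonneg _) _
  -- The derivative of the power is `-(p - 1) (s + α)^(-p)`, the Hardy weight; the derivative of `k`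
  -- lives in the boundary layer. Since `k` vanishes for `s ≤ 0`, the singularity at `s = -α` is
  -- never felt.
  set h : ℝ → ℝ := fun s => k s * (s + α) ^ (1 - p) with hh
  set h' : ℝ → ℝ := fun s => m s * (s + α) ^ (1 - p) + k s * ((1 - p) * (s + α) ^ (1 - p - 1))
    with hh'
  have hder : ∀ s, HasDerivAt h (h' s) s := by
    intro s
    rcases lt_or_ge s 0 with hs | hs
    · have e : h' s = 0 := by simp [hh', hmn s hs.le, hkn s hs.le]
      rw [e]
      refine (hasDerivAt_const s (0 : ℝ)).congr_of_eventuallyEq ?_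
      filter_upwards [gt_mem_nhds hs] with t ht
      simp [hh, hkn t ht.le]
    · have h1 : HasDerivAt (fun s : ℝ => (s + α) ^ (1 - p)) ((1 - p) * (s + α) ^ (1 - p - 1)) s := by
        have := ((hasDerivAt_id s).add_const α).rpow_const (p := 1 - p)
          (Or.inl (by simp only [id]; linarith))
        simpa using this
      exact (hkm s).mul h1
  have hcont : Continuous h' := by
    refine continuous_iff_continuousAt.mpr fun s => ?_
    rcases lt_or_ge s 0 with hs | hs
    · refine (continuousAt_const (y := (0 : ℝ))).congr ?_
      filter_upwards [gt_mem_nhds hs] with t ht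
      simp [hh', hmn t ht.le, hkn t ht.le]
    · have hr : ∀ r : ℝ, ContinuousAt (fun s : ℝ => (s + α) ^ r) s := fun r =>
        (continuousAt_id.add continuousAt_const).rpow_const (Or.inl (by change s + α ≠ 0; linarith))
      exact (hm.continuousAt.mul (hr _)).add (hkc.continuousAt.mul (continuousAt_const.mul (hr _)))
  have h_nonneg : ∀ s, 0 ≤ h s := fun s => by
    rcases le_total s 0 with hs | hs
    · simp [hh, hkn s hs]
    · have := hk0 s
      simp only [hh]; positivity
  obtain ⟨hI, hI0⟩ := integral_anisotropic_nonneg hH hΩo.measurableSet hΩb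
    (f := D) (concaveOn_supportDist hH hΩ2 hΩb hnf).neg hK
    (fun x hx => supportDist_nonpos hH hΩ2 hΩb hΩo hΩc hne hx) hgr0 hψ hψ0 (h := h) (h' := h')
    hder hcont h_nonneg (fun s hs => by simp [hh, hkn s hs])
    (fun s hs => by simp [hh', hkn s hs, hmn s hs])
  have hcpt : IsCompact (closure Ω) := hΩb.isCompact_closure
  have hintc : ∀ f : E → ℝ, Continuous f → IntegrableOn f Ω := fun f hf =>
    (hf.continuousOn.integrableOn_compact hcpt).mono_set subset_closure
  have hgφ : Continuous (gradient φ) := (InnerProductSpace.toDual ℝ E).symm.continuous.comp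
    (hφ.continuous_fderiv one_ne_zero)
  have i1 : IntegrableOn (fun x => H (gradient φ x) ^ p) Ω :=
    hintc _ ((hH.continuous.comp hgφ).rpow_const fun x => Or.inr (by linarith))
  -- The absolute value makes the weight continuous on the whole space without changing it in `Ω`,
  -- so integrability follows from compactness of the closure.
  have hcr : Continuous fun x => |φ x| ^ p / (|D x| + α) ^ p := by
    refine hψ.continuous.div ((hDc.abs.add continuous_const).rpow_const fun x =>
      Or.inr (by linarith)) fun x => ?_
    positivity
  have i2 : IntegrableOn (fun x => |φ x| ^ p / (D x + α) ^ p) Ω :=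
    (hintc _ hcr).congr_fun (fun x hx => by simp only [abs_of_pos (hpos x hx)]) hΩo.measurableSet
  have i3 : IntegrableOn (fun x => k (D x) * (|φ x| ^ p / (D x + α) ^ p)) Ω :=
    (hintc _ ((hkc.comp hDc).mul hcr)).congr_fun
      (fun x hx => by
        change k (D x) * (|φ x| ^ p / (|D x| + α) ^ p) = _
        rw [abs_of_pos (hpos x hx)]) hΩo.measurableSet
  have hms : MeasurableSet {x | D x < ε} := (isOpen_lt hDc continuous_const).measurableSet
  have i4 : IntegrableOn ({x | D x < ε}.indicator ψ) Ω := (hintc ψ hψ.continuous).indicator hms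
  have hmono := integral_mono_ae (μ := volume.restrict Ω) (hI.const_mul (c ^ (p - 1)))
    (((i1.add (i2.const_mul ((p - 1) * c ^ p))).add
      (i4.const_mul (c ^ (p - 1) * α ^ (1 - p) * (1 / ε)))).sub
      (i3.const_mul (c ^ (p - 1) * (p - 1)))) ?_
  · rw [integral_const_mul] at hmono
    rw [integral_sub' ((i1.add (i2.const_mul ((p - 1) * c ^ p))).add
      (i4.const_mul (c ^ (p - 1) * α ^ (1 - p) * (1 / ε)))) (i3.const_mul (c ^ (p - 1) * (p - 1))),
      integral_add' (i1.add (i2.const_mul ((p - 1) * c ^ p)))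
        (i4.const_mul (c ^ (p - 1) * α ^ (1 - p) * (1 / ε))),
      integral_add' i1 (i2.const_mul ((p - 1) * c ^ p)), integral_const_mul, integral_const_mul,
      integral_const_mul, setIntegral_indicator hms] at hmono
    have h0 : 0 ≤ c ^ (p - 1) := by positivity
    have := (mul_nonneg h0 hI0).trans hmono
    linarith
  · filter_upwards [ae_restrict_mem hΩo.measurableSet,
      ae_restrict_of_ae hK.ae_differentiableAt] with x hx hd
    have hDx := hpos x hx
    have hρ : 0 < D x + α := by linarith
    have h1 := hardy_pointwise hH hp hc hρ (hφ.differentiable one_ne_zero x) (hgr0 x hx hd)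
    set T := ⟪gradient H (gradient D x), gradient (fun y => |φ y| ^ p) x⟫ with hT
    set R := H (gradient φ x) ^ p + (p - 1) * c ^ p * (|φ x| ^ p / (D x + α) ^ p) with hR
    have hR0 : 0 ≤ R := by
      have := hH.nonneg (gradient φ x)
      have : 0 ≤ p - 1 := by linarith
      positivity
    have h2 : c ^ (p - 1) * (h (D x) * T) ≤ R := by
      have : c ^ (p - 1) * (h (D x) * T) = k (D x) * (c ^ (p - 1) * ((D x + α) ^ (1 - p) * T)) := by
        simp only [hh]; ring
      rw [this]
      calc _ ≤ k (D x) * R := mul_le_mul_of_nonneg_left h1 (hk0 _)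
        _ ≤ 1 * R := mul_le_mul_of_nonneg_right (hk1 _) hR0
        _ = R := one_mul R
    -- In the layer `m ≤ 1 / ε` and, since `1 - p < 0`, the power is largest at distance `0`;
    -- outside the layer `m` vanishes.
    have h3 : m (D x) * (D x + α) ^ (1 - p) * ψ x ≤
        α ^ (1 - p) * (1 / ε) * {x | D x < ε}.indicator ψ x := by
      by_cases hε : D x < ε
      · rw [Set.indicator_of_mem (show x ∈ {x | D x < ε} from hε)]
        refine mul_le_mul_of_nonneg_right ?_ (hψ0 x)
        rw [mul_comm]
        refine mul_le_mul ?_ (hm1 _) (hm0 _) (by positivity)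
        exact Real.rpow_le_rpow_of_nonpos hα (by linarith) (by linarith)
      · rw [Set.indicator_of_notMem (show x ∉ {x | D x < ε} from hε), hmε _ (not_lt.mp hε)]
        simp
    have e1 : (D x + α) ^ (1 - p - 1) = 1 / (D x + α) ^ p := by
      rw [show 1 - p - 1 = -p by ring, Real.rpow_neg hρ.le, one_div]
    -- The eikonal equation replaces `H (gradient D x)` by `1`.
    have e2 : c ^ (p - 1) * (h (D x) * T + ψ x * h' (D x) * H (gradient D x)) =
        c ^ (p - 1) * (h (D x) * T) + c ^ (p - 1) * (m (D x) * (D x + α) ^ (1 - p) * ψ x) -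
        c ^ (p - 1) * (p - 1) * (k (D x) * (|φ x| ^ p / (D x + α) ^ p)) := by
      rw [hgr x hx hd]
      simp only [hh', e1, hψd]
      ring
    have h4 : c ^ (p - 1) * (m (D x) * (D x + α) ^ (1 - p) * ψ x) ≤
        c ^ (p - 1) * α ^ (1 - p) * (1 / ε) * {x | D x < ε}.indicator ψ x := by
      calc _ ≤ c ^ (p - 1) * (α ^ (1 - p) * (1 / ε) * {x | D x < ε}.indicator ψ x) :=
            mul_le_mul_of_nonneg_left h3 (by positivity)
        _ = _ := by ring
    simp only [Pi.sub_apply, Pi.add_apply]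
    rw [e2]
    linarith

end Hardy

/-! ### Boundary patches as graphs over a hyperplane, and their surface measure -/

section Charts

variable {n : ℕ}

local notation "E" => EuclideanSpace ℝ (Fin n)

/-- Tonelli for the orthogonal splitting along a unit vector: the splitting and the parametrization
`t ↦ t • N` preserve measure, so no constant appears. -/
theorem lintegral_eq_lintegral_orthogonal {N : E} (hN : ‖N‖ = 1) {f : E → ENNReal}
    (hf : Measurable f) : ∫⁻ x, f x = ∫⁻ w : (ℝ ∙ N)ᗮ, ∫⁻ t : ℝ, f (t • N + w) := by
  have h1 := (ℝ ∙ N).measurePreserving_measurableEquivProd (0 : E)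
  rw [InnerProductSpace.euclideanHausdorffMeasure_eq_volume] at h1
  have h2 : MeasurePreserving (LinearIsometryEquiv.toSpanUnitSingleton N hN) volume volume :=
    (LinearIsometryEquiv.toSpanUnitSingleton N hN).measurePreserving
  have h3 := (h1.symm _).comp (h2.prod (MeasurePreserving.id (volume : Measure (ℝ ∙ N)ᗮ)))
  rw [← h3.lintegral_comp hf]
  refine (lintegral_prod_symm _ (hf.comp h3.measurable).aemeasurable).trans ?_
  refine lintegral_congr fun w => lintegral_congr fun t => ?_
  simp

theorem finrank_orthogonal_span_singleton' {N : E} (hN : ‖N‖ = 1) :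
    Module.finrank ℝ (ℝ ∙ N)ᗮ = n - 1 := by
  have h0 : N ≠ 0 := norm_ne_zero_iff.mp (by rw [hN]; exact one_ne_zero)
  have h1 := Submodule.finrank_add_finrank_orthogonal (ℝ ∙ N)
  rw [finrank_span_singleton h0] at h1
  simp at h1
  omega

theorem LipschitzOnWith.euclideanHausdorffMeasure_image_le {X Y : Type*} [EMetricSpace X]
    [MeasurableSpace X] [BorelSpace X] [EMetricSpace Y] [MeasurableSpace Y] [BorelSpace Y]
    {f : X → Y} {K : NNReal} {s : Set X} (hf : LipschitzOnWith K f s) (d : ℕ) :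
    (Measure.euclideanHausdorffMeasure d : Measure Y) (f '' s) ≤
      (K : ENNReal) ^ d * (Measure.euclideanHausdorffMeasure d : Measure X) s := by
  simp_rw [Measure.euclideanHausdorffMeasure_def, Measure.smul_apply]
  have := hf.hausdorffMeasure_image_le (d := d) (by positivity)
  rw [ENNReal.rpow_natCast] at this
  calc _ ≤ _ := by
        simp only [ENNReal.smul_def]
        exact mul_le_mul_right this _
    _ = _ := by simp only [ENNReal.smul_def, smul_eq_mul]; ring

/-- The orthogonal projection onto a hyperplane does not increase surface measure. -/
theorem volume_image_projection_le {N : E} (hN : ‖N‖ = 1) (s : Set E) :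
    volume ((ℝ ∙ N)ᗮ.orthogonalProjectionOnto '' s) ≤
      (Measure.euclideanHausdorffMeasure (n - 1) : Measure E) s := by
  have h1 : LipschitzWith 1 (ℝ ∙ N)ᗮ.orthogonalProjectionOnto :=
    ((ℝ ∙ N)ᗮ.orthogonalProjectionOnto).lipschitz.weaken
      (Submodule.orthogonalProjectionOnto_norm_le _)
  have h2 := (h1.lipschitzOnWith (s := s)).euclideanHausdorffMeasure_image_le (n - 1)
  rw [← finrank_orthogonal_span_singleton' hN,
    InnerProductSpace.euclideanHausdorffMeasure_eq_volume] at h2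
  rw [← finrank_orthogonal_span_singleton' hN]
  simpa using h2

/-- Integrated form of `volume_image_projection_le`: Lebesgue measure on the projection of `Γ` is
dominated by the pushforward of surface measure, and `γ` inverts the projection on `Γ`. -/
theorem lintegral_projection_le {N : E} (hN : ‖N‖ = 1) {Γ : Set E} (hΓ : IsCompact Γ)
    {γ : (ℝ ∙ N)ᗮ → E} (hγ : ∀ x ∈ Γ, γ ((ℝ ∙ N)ᗮ.orthogonalProjectionOnto x) = x)
    (F : E → ENNReal) :
    ∫⁻ w in (ℝ ∙ N)ᗮ.orthogonalProjectionOnto '' Γ, F (γ w) ≤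
      ∫⁻ x in Γ, F x ∂(Measure.euclideanHausdorffMeasure (n - 1)) := by
  set π := (ℝ ∙ N)ᗮ.orthogonalProjectionOnto with hπ
  have hπm : Measurable π := π.continuous.measurable
  have hle : volume.restrict (π '' Γ) ≤
      ((Measure.euclideanHausdorffMeasure (n - 1) : Measure E).restrict Γ).map π := by
    refine Measure.le_iff.mpr fun A hA => ?_
    rw [Measure.restrict_apply hA, Measure.map_apply hπm hA, Measure.restrict_apply (hπm hA)]
    refine (measure_mono ?_).trans (volume_image_projection_le hN (π ⁻¹' A ∩ Γ))
    rintro _ ⟨h1, x, hx, rfl⟩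
    exact ⟨x, ⟨h1, hx⟩, rfl⟩
  refine (lintegral_mono' hle le_rfl).trans ((lintegral_map_le _ _).trans ?_)
  refine (setLIntegral_congr_fun hΓ.measurableSet fun x hx => ?_).le
  exact congrArg F (hγ x hx)

theorem norm_le_norm_projection_add {N : E} (hN : ‖N‖ = 1) (v : E) :
    ‖v‖ ≤ ‖(ℝ ∙ N)ᗮ.orthogonalProjectionOnto v‖ + |⟪v, N⟫| := by
  have h1 := Submodule.starProjection_add_starProjection_orthogonal (K := ℝ ∙ N) v
  have h2 : (ℝ ∙ N).starProjection v = ⟪N, v⟫ • N := by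
    rw [Submodule.starProjection_unit_singleton ℝ hN]
  rw [h2] at h1
  calc ‖v‖ = ‖⟪N, v⟫ • N + (ℝ ∙ N)ᗮ.starProjection v‖ := by rw [h1]
    _ ≤ ‖⟪N, v⟫ • N‖ + ‖(ℝ ∙ N)ᗮ.starProjection v‖ := norm_add_le _ _
    _ = _ := by
      rw [norm_smul, hN, mul_one, Real.norm_eq_abs, real_inner_comm, add_comm]
      rfl

theorem eq_inner_smul_add_projection {N : E} (hN : ‖N‖ = 1) (v : E) :
    v = ⟪v, N⟫ • N + ((ℝ ∙ N)ᗮ.orthogonalProjectionOnto v : E) := by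
  have h1 := Submodule.starProjection_add_starProjection_orthogonal (K := ℝ ∙ N) v
  have h2 : (ℝ ∙ N).starProjection v = ⟪N, v⟫ • N := by
    rw [Submodule.starProjection_unit_singleton ℝ hN]
  rw [h2, real_inner_comm] at h1
  exact h1.symm

/-- A compact set with small slopes over a hyperplane has surface measure controlled by its
projection. -/
theorem euclideanHausdorffMeasure_le_of_slope {N : E} (hN : ‖N‖ = 1) {Γ : Set E}
    (hΓ : ∀ x ∈ Γ, ∀ y ∈ Γ, |⟪x - y, N⟫| ≤ 1 / 2 * ‖x - y‖) :
    (Measure.euclideanHausdorffMeasure (n - 1) : Measure E) Γ ≤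
      2 ^ (n - 1) * volume ((ℝ ∙ N)ᗮ.orthogonalProjectionOnto '' Γ) := by
  set π := (ℝ ∙ N)ᗮ.orthogonalProjectionOnto with hπ
  -- Slope at most `1 / 2` lets the normal component be absorbed on the left, so the inverse of the
  -- projection is `2`-Lipschitz.
  have hlip : ∀ x ∈ Γ, ∀ y ∈ Γ, ‖x - y‖ ≤ 2 * ‖π x - π y‖ := fun x hx y hy => by
    have h1 := norm_le_norm_projection_add hN (x - y)
    have h2 := hΓ x hx y hy
    rw [← hπ, _root_.map_sub] at h1
    linarith
  have hinj : Set.InjOn π Γ := fun x hx y hy h => by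
    have := hlip x hx y hy
    rw [h, sub_self, norm_zero, mul_zero] at this
    exact sub_eq_zero.mp (norm_le_zero_iff.mp this)
  rcases Γ.eq_empty_or_nonempty with rfl | hne
  · simp
  have : Nonempty E := ⟨0⟩
  set γ := Function.invFunOn π Γ with hγ
  have hγl : LipschitzOnWith 2 γ (π '' Γ) := by
    refine LipschitzOnWith.of_dist_le_mul ?_
    rintro _ ⟨x, hx, rfl⟩ _ ⟨y, hy, rfl⟩
    rw [hγ, hinj.leftInvOn_invFunOn hx, hinj.leftInvOn_invFunOn hy, dist_eq_norm, dist_eq_norm]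
    exact hlip x hx y hy
  have h1 := hγl.euclideanHausdorffMeasure_image_le (n - 1)
  rw [hinj.leftInvOn_invFunOn.image_image] at h1
  refine h1.trans_eq ?_
  rw [← InnerProductSpace.euclideanHausdorffMeasure_eq_volume,
    finrank_orthogonal_span_singleton' hN]
  rfl

variable {Ω : Set (EuclideanSpace ℝ (Fin n))}

/-- The supporting hyperplane at `y` gives `⟪x - y, ν(y)⟫ ≤ 0`. Replacing `ν(y)` by the nearby
normal at `x₀` costs `η * ‖x - y‖`, and exchanging `x` and `y` makes the bound two-sided. Thus a
small patch is a nearly flat graph. -/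
theorem exists_small_slope (hΩ : HasC2Boundary Ω) (hΩo : IsOpen Ω) (hΩc : Convex ℝ Ω) {x₀ : E}
    (hx₀ : x₀ ∈ frontier Ω) {η : ℝ} (hη : 0 < η) : ∃ r > 0,
      (∀ y ∈ frontier Ω ∩ Metric.closedBall x₀ r,
        ‖outerUnitNormal Ω x₀ - outerUnitNormal Ω y‖ ≤ η) ∧
      ∀ x ∈ frontier Ω ∩ Metric.closedBall x₀ r, ∀ y ∈ frontier Ω ∩ Metric.closedBall x₀ r,
        |⟪x - y, outerUnitNormal Ω x₀⟫| ≤ η * ‖x - y‖ := by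
  obtain ⟨r, hr, h⟩ := Metric.continuousWithinAt_iff.mp
    (continuousOn_outerUnitNormal hΩ x₀ hx₀) η hη
  have h' : ∀ y ∈ frontier Ω ∩ Metric.closedBall x₀ (r / 2),
      ‖outerUnitNormal Ω x₀ - outerUnitNormal Ω y‖ ≤ η := fun y hy => by
    have := h hy.1 ((Metric.mem_closedBall.mp hy.2).trans_lt (half_lt_self hr))
    rw [dist_comm, dist_eq_norm] at this
    exact this.le
  have key : ∀ x ∈ frontier Ω ∩ Metric.closedBall x₀ (r / 2),
      ∀ y ∈ frontier Ω ∩ Metric.closedBall x₀ (r / 2),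
        ⟪x - y, outerUnitNormal Ω x₀⟫ ≤ η * ‖x - y‖ := fun x hx y hy => by
    have h1 := inner_sub_outerUnitNormal_nonpos hΩ hΩo hΩc hy.1 (frontier_subset_closure hx.1)
    have h2 := real_inner_le_norm (x - y) (outerUnitNormal Ω x₀ - outerUnitNormal Ω y)
    rw [inner_sub_right] at h2
    have h3 := mul_le_mul_of_nonneg_left (h' y hy) (norm_nonneg (x - y))
    linarith
  refine ⟨r / 2, half_pos hr, h', fun x hx y hy => abs_le.mpr ⟨?_, key x hx y hy⟩⟩
  have := key y hy x hx
  rw [← neg_sub, inner_neg_left, norm_neg] at this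
  linarith

theorem surfaceMeasure_lt_top (hΩ : HasC2Boundary Ω) (hΩo : IsOpen Ω) (hΩc : Convex ℝ Ω)
    (hΩb : Bornology.IsBounded Ω) :
    (Measure.euclideanHausdorffMeasure (n - 1) : Measure E) (frontier Ω) < ⊤ := by
  have hK := isCompact_frontier_of_isBounded hΩb
  have hloc : ∀ x ∈ frontier Ω, ∃ r > 0, (Measure.euclideanHausdorffMeasure (n - 1) : Measure E)
      (frontier Ω ∩ Metric.closedBall x r) < ⊤ := by
    intro x hx
    obtain ⟨r, hr, -, h⟩ := exists_small_slope hΩ hΩo hΩc hx one_half_pos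
    refine ⟨r, hr, (euclideanHausdorffMeasure_le_of_slope (norm_outerUnitNormal hΩ hx) h).trans_lt
      (ENNReal.mul_lt_top (by simp) ?_)⟩
    exact ((hK.inter_right Metric.isClosed_closedBall).image
      (ContinuousLinearMap.continuous _)).measure_lt_top
  refine hK.measure_lt_top_of_nhdsWithin fun x hx => ?_
  obtain ⟨r, hr, h⟩ := hloc x hx
  exact ⟨_, inter_mem_nhdsWithin _ (Metric.closedBall_mem_nhds x hr), h⟩

end Charts

/-! ### Mass of a thin boundary layer in a small patch -/

section Layer

variable {n : ℕ} {Ω : Set (EuclideanSpace ℝ (Fin n))} {H : EuclideanSpace ℝ (Fin n) → ℝ}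

local notation "E" => EuclideanSpace ℝ (Fin n)

/-- Going from a point of the domain near `x₀` in the direction of the normal at `x₀` one meets the
boundary near `x₀`. -/
theorem exists_mem_frontier_add_smul (hΩ : HasC2Boundary Ω) (hΩo : IsOpen Ω) (hΩc : Convex ℝ Ω)
    {x₀ x : E} (hx₀ : x₀ ∈ frontier Ω) (hx : x ∈ Ω) : ∃ t : ℝ, 0 ≤ t ∧ t ≤ ‖x - x₀‖ ∧
      x + t • outerUnitNormal Ω x₀ ∈ frontier Ω := by
  set N := outerUnitNormal Ω x₀ with hN
  have hN1 : ‖N‖ = 1 := norm_outerUnitNormal hΩ hx₀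
  -- Because `⟪x - x₀, N⟫ ≥ -‖x - x₀‖`, a step of this length leaves the open half-space that
  -- supports `Ω` at `x₀`.
  have hz : x + ‖x - x₀‖ • N ∉ Ω := fun hz => by
    have h1 := inner_sub_outerUnitNormal_neg hΩ hΩo hΩc hx₀ hz
    rw [add_sub_right_comm, inner_add_left, inner_smul_left, ← hN, real_inner_self_eq_norm_sq,
      hN1] at h1
    have h2 := abs_le.mp (abs_real_inner_le_norm (x - x₀) N)
    rw [hN1] at h2
    simp only [RCLike.conj_to_real] at h1
    linarith [h2.1]
  obtain ⟨t, ht, h⟩ := exists_mem_frontier_segment hx hz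
  rw [add_sub_cancel_left, smul_smul] at h
  exact ⟨t * ‖x - x₀‖, mul_nonneg ht.1 (norm_nonneg _),
    mul_le_of_le_one_left (norm_nonneg _) ht.2, h⟩

/-- Local bound for the mass of a boundary layer. -/
theorem lintegral_layer_local (hH : IsAnisotropy H) (hΩ : HasC2Boundary Ω) (hΩo : IsOpen Ω)
    (hΩc : Convex ℝ Ω) (hΩb : Bornology.IsBounded Ω) {x₀ : E} (hx₀ : x₀ ∈ frontier Ω) {τ : ℝ}
    (hτ : 0 < τ) : ∃ r > 0, ∀ ψ : E → ℝ, UniformContinuous ψ → (∀ x, 0 ≤ ψ x) →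
      (∀ x ∉ Metric.ball x₀ r, ψ x = 0) → ∀ θ > 0, ∀ᶠ ε in 𝓝[>] (0 : ℝ),
      ∫⁻ x in Ω ∩ {x | supportDist H Ω x < ε}, ENNReal.ofReal (ψ x) ≤
        ENNReal.ofReal ε *
          ((∫⁻ x, ENNReal.ofReal (ψ x * (H (outerUnitNormal Ω x) + τ)) ∂(surfaceMeasure Ω)) +
            ENNReal.ofReal θ) := by
  have hnf : (frontier Ω).Nonempty := ⟨x₀, hx₀⟩
  set N := outerUnitNormal Ω x₀ with hN
  have hN1 : ‖N‖ = 1 := norm_outerUnitNormal hΩ hx₀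
  obtain ⟨c, C, hc, hC, hcC⟩ := hH.polar_comparable
  obtain ⟨a, b, ha, hab, hH'⟩ := hH.comparable
  have hb : 0 < b := ha.trans_le hab
  -- choice of the slope
  obtain ⟨η, hη0, hη1, hη⟩ : ∃ η : ℝ, 0 < η ∧ η ≤ 1 / 2 ∧
      (H N + η / c) / (1 - η) + b * η < H N + τ := by
    have h1 : ContinuousAt (fun η : ℝ => (H N + η / c) / (1 - η) + b * η) 0 := by
      refine ContinuousAt.add (ContinuousAt.div (by fun_prop) (by fun_prop) (by norm_num))
        (by fun_prop)
    have h2 := (h1.tendsto.mono_left (nhdsWithin_le_nhds (s := Set.Ioi 0))).eventually_lt_const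
      (u := H N + τ) (by simpa using hτ)
    have h3 : ∀ᶠ η : ℝ in 𝓝[>] 0, η < 1 / 2 := nhdsWithin_le_nhds (gt_mem_nhds one_half_pos)
    obtain ⟨η, h2, h3, h4⟩ := (h2.and (h3.and self_mem_nhdsWithin)).exists
    exact ⟨η, h4, h3.le, h2⟩
  -- `ε * κ` will bound the length of the layer `{d < ε}` along `N`. As `η → 0`, `κ → H N`; the term
  -- `b * η` in the choice of `η` pays for replacing `N` by the normal at other points of the patch.
  set κ := (H N + η / c) / (1 - η) with hκ
  have hHN : 0 ≤ H N := hH.nonneg N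
  have hκ0 : 0 ≤ κ := div_nonneg (by positivity) (by linarith)
  obtain ⟨R, hR, hslope1, hslope2⟩ := exists_small_slope hΩ hΩo hΩc hx₀ hη0
  set Γ := frontier Ω ∩ Metric.closedBall x₀ R with hΓ
  have hΓc : IsCompact Γ :=
    (isCompact_frontier_of_isBounded hΩb).inter_right Metric.isClosed_closedBall
  have hκN : ∀ y ∈ Γ, κ ≤ H (outerUnitNormal Ω y) + τ := fun y hy => by
    have h1 := hH.add_le (outerUnitNormal Ω y) (N - outerUnitNormal Ω y)
    have h2 := (hH' (N - outerUnitNormal Ω y)).2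
    rw [add_sub_cancel] at h1
    have h3 := mul_le_mul_of_nonneg_left (hslope1 y hy) hb.le
    linarith
  set π := (ℝ ∙ N)ᗮ.orthogonalProjectionOnto with hπ
  have hπN : π N = 0 :=
    Submodule.orthogonalProjectionOnto_orthogonal_apply_eq_zero (Submodule.mem_span_singleton_self N)
  have hinj : Set.InjOn π Γ := fun x hx y hy h => by
    have h1 := norm_le_norm_projection_add hN1 (x - y)
    have h2 := hslope2 x hx y hy
    rw [← hπ, _root_.map_sub, h, sub_self, norm_zero, zero_add] at h1
    have h3 : ‖x - y‖ ≤ 0 := by nlinarith [norm_nonneg (x - y)]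
    exact sub_eq_zero.mp (norm_le_zero_iff.mp h3)
  have : Nonempty E := ⟨0⟩
  set γ := Function.invFunOn π Γ with hγ
  have hγπ : ∀ x ∈ Γ, γ (π x) = x := fun x hx => hinj.leftInvOn_invFunOn hx
  obtain ⟨K, hK⟩ := exists_lipschitz_supportDist hH hΩ hΩb hnf
  refine ⟨R / 2, half_pos hR, fun ψ hψu hψ0 hψs θ hθ => ?_⟩
  -- choice of the modulus
  set σΓ := (surfaceMeasure Ω Γ).toReal with hσΓ
  have hσfin : surfaceMeasure Ω Γ ≠ ⊤ := by
    refine ((measure_mono (Set.subset_univ _)).trans_lt ?_).ne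
    rw [surfaceMeasure, Measure.restrict_apply_univ]
    exact surfaceMeasure_lt_top hΩ hΩo hΩc hΩb
  -- Chosen so that `κ * ω * σΓ ≤ θ`; the added ones avoid division by zero.
  set ω := θ / ((κ + 1) * (σΓ + 1)) with hω
  have hσ0 : 0 ≤ σΓ := ENNReal.toReal_nonneg
  have hω0 : 0 < ω := by positivity
  obtain ⟨δ, hδ, hδψ⟩ := Metric.uniformContinuous_iff.mp hψu ω hω0
  have e1 : ∀ᶠ ε : ℝ in 𝓝[>] 0, ε * κ < min δ (R / 2) := by
    have : Tendsto (fun ε : ℝ => ε * κ) (𝓝[>] 0) (𝓝 0) := by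
      have : Continuous fun ε : ℝ => ε * κ := by fun_prop
      simpa using (this.tendsto 0).mono_left nhdsWithin_le_nhds
    exact this.eventually_lt_const (by positivity)
  have e2 : ∀ᶠ ε : ℝ in 𝓝[>] 0, ε < c * (R / 2) :=
    nhdsWithin_le_nhds (gt_mem_nhds (by positivity))
  filter_upwards [e1, e2, self_mem_nhdsWithin] with ε hε1 hε2 hε3
  have hε : 0 < ε := hε3
  set L := Ω ∩ {x | supportDist H Ω x < ε} with hL
  have hLm : MeasurableSet L :=
    hΩo.measurableSet.inter (isOpen_lt hK.continuous continuous_const).measurableSet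
  -- depth of the layer
  have hdepth : ∀ x ∈ L ∩ Metric.ball x₀ (R / 2), ∃ t : ℝ, 0 ≤ t ∧ t ≤ ε * κ ∧ x + t • N ∈ Γ := by
    intro x hx
    obtain ⟨t, ht0, ht1, hy⟩ := exists_mem_frontier_add_smul hΩ hΩo hΩc hx₀ hx.1.1
    have hxr : ‖x - x₀‖ < R / 2 := by simpa [dist_eq_norm] using hx.2
    have hyΓ : x + t • N ∈ Γ := by
      refine ⟨hy, ?_⟩
      rw [Metric.mem_closedBall, dist_eq_norm, add_sub_right_comm]
      refine (norm_add_le _ _).trans ?_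
      rw [norm_smul, hN1, mul_one, Real.norm_eq_abs, abs_of_nonneg ht0]
      linarith
    refine ⟨t, ht0, ?_, hyΓ⟩
    obtain ⟨z, hz, hzd⟩ := exists_polar_eq_anisotropicDist hH hΩb hnf x
    rw [anisotropicDist_eq_supportDist hH hΩ hΩb hΩo hΩc hnf hx.1.1] at hzd
    have hzε : polar H (x - z) < ε := hzd ▸ hx.1.2
    have hxz : ‖x - z‖ ≤ ε / c := by
      rw [le_div_iff₀ hc, mul_comm]
      exact (hcC (x - z)).1.trans hzε.le
    have hzΓ : z ∈ Γ := by
      refine ⟨hz, ?_⟩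
      rw [Metric.mem_closedBall, dist_eq_norm]
      have h1 : ‖z - x₀‖ ≤ ‖x - z‖ + ‖x - x₀‖ := by
        rw [← norm_sub_rev z x]
        calc _ = ‖(z - x) + (x - x₀)‖ := by rw [sub_add_sub_cancel]
          _ ≤ _ := norm_add_le _ _
      have h2 : ε / c ≤ R / 2 := by
        rw [div_le_iff₀ hc]; linarith
      linarith
    -- With `z` a nearest boundary point, the slope between `x + t • N` and `z` gives `⟪x - z, N⟫ +
    -- t ≤ η (ε / c + t)`, while duality gives `-⟪x - z, N⟫ ≤ H N * ε`. Together `(1 - η) t ≤ ε (H N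
    -- + η / c)`, that is, `t ≤ ε * κ`.
    have s1 := (abs_le.mp (hslope2 _ hyΓ z hzΓ)).2
    have s2 : ⟪x + t • N - z, N⟫ = ⟪x - z, N⟫ + t := by
      rw [add_sub_right_comm, inner_add_left, inner_smul_left, real_inner_self_eq_norm_sq, hN1]
      simp
    have s3 : -⟪x - z, N⟫ ≤ H N * ε := by
      have h1 := hH.inner_le_mul_polar N (-(x - z))
      rw [hH.polar_neg, inner_neg_right, real_inner_comm] at h1
      exact h1.trans (mul_le_mul_of_nonneg_left hzε.le hHN)
    have s4 : ‖x + t • N - z‖ ≤ ε / c + t := by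
      rw [add_sub_right_comm]
      refine (norm_add_le _ _).trans ?_
      rw [norm_smul, hN1, mul_one, Real.norm_eq_abs, abs_of_nonneg ht0]
      linarith
    have s5 := mul_le_mul_of_nonneg_left s4 hη0.le
    rw [hκ, ← mul_div_assoc, le_div_iff₀ (by linarith)]
    rw [s2] at s1
    have s6 : η * (ε / c) = ε * (η / c) := by ring
    nlinarith
  -- Fubini in the direction of the normal
  have hψc := hψu.continuous
  have hmeas : Measurable (L.indicator fun x => ENNReal.ofReal (ψ x)) :=
    (ENNReal.measurable_ofReal.comp hψc.measurable).indicator hLm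
  rw [← lintegral_indicator hLm, lintegral_eq_lintegral_orthogonal hN1 hmeas]
  set F : E → ENNReal := fun y => ENNReal.ofReal (ε * κ) * ENNReal.ofReal (ψ y + ω) with hF
  -- On the line over `w`, the part of the layer where `ψ ≠ 0` sits in an interval of length `ε * κ`
  -- ending at the boundary point `γ w`, and there `ψ ≤ ψ (γ w) + ω` by uniform continuity. Lines
  -- missing the patch contribute nothing.
  have hinner : ∀ w : (ℝ ∙ N)ᗮ, ∫⁻ t : ℝ, L.indicator (fun x => ENNReal.ofReal (ψ x)) (t • N + w) ≤
      (π '' Γ).indicator (fun w => F (γ w)) w := by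
    intro w
    have hπw : ∀ t : ℝ, π (t • N + w) = w := fun t => by
      rw [_root_.map_add, _root_.map_smul, hπN, smul_zero, zero_add]
      exact Submodule.orthogonalProjectionOnto_mem_subspace_eq_self w
    have hmem : ∀ t : ℝ, L.indicator (fun x => ENNReal.ofReal (ψ x)) (t • N + w) ≠ 0 →
        t • N + w ∈ L ∩ Metric.ball x₀ (R / 2) := fun t ht => by
      have h1 := Set.mem_of_indicator_ne_zero ht
      refine ⟨h1, by_contra fun h2 => ht ?_⟩
      rw [Set.indicator_of_mem h1, hψs _ h2, ENNReal.ofReal_zero]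
    have hmemΓ : ∀ t s : ℝ, t • N + w + s • N ∈ Γ → w ∈ π '' Γ ∧
        γ w = t • N + w + s • N := fun t s h => by
      have h1 : π (t • N + w + s • N) = w := by
        rw [_root_.map_add, hπw, _root_.map_smul, hπN, smul_zero, add_zero]
      refine ⟨⟨_, h, h1⟩, ?_⟩
      rw [← hγπ _ h, h1]
    by_cases hw : w ∈ π '' Γ
    · rw [Set.indicator_of_mem hw]
      obtain ⟨y, hy, hyw⟩ := hw
      have hγw : γ w = y := by rw [← hyw, hγπ y hy]
      have hyd : y = ⟪y, N⟫ • N + (w : E) := by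
        rw [← hyw]; exact eq_inner_smul_add_projection hN1 y
      set g := ⟪y, N⟫ with hg
      calc _ ≤ ∫⁻ t : ℝ, (Set.Icc (g - ε * κ) g).indicator
            (fun _ => ENNReal.ofReal (ψ y + ω)) t := by
            refine lintegral_mono fun t => ?_
            by_cases h0 : L.indicator (fun x => ENNReal.ofReal (ψ x)) (t • N + w) = 0
            · rw [h0]; exact zero_le
            obtain ⟨s, hs0, hs1, hs⟩ := hdepth _ (hmem t h0)
            obtain ⟨-, h2⟩ := hmemΓ t s hs
            rw [hγw] at h2
            have h3 : g = t + s := by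
              have h4 : (g - (t + s)) • N = 0 := by
                rw [sub_smul, add_smul]
                rw [hyd] at h2
                rw [sub_eq_zero]
                exact add_right_cancel (b := (w : E)) (by rw [h2]; abel)
              rcases smul_eq_zero.mp h4 with h | h
              · linarith
              · rw [h, norm_zero] at hN1; exact absurd hN1 zero_ne_one
            rw [Set.indicator_of_mem (hmem t h0).1, Set.indicator_of_mem
              (show t ∈ Set.Icc (g - ε * κ) g from ⟨by linarith, by linarith⟩)]
            refine ENNReal.ofReal_le_ofReal ?_
            have h5 : dist (t • N + (w : E)) y < δ := by
              rw [h2, dist_eq_norm, sub_add_cancel_left, norm_neg, norm_smul, hN1, mul_one,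
                Real.norm_eq_abs, abs_of_nonneg hs0]
              exact hs1.trans_lt (hε1.trans_le (min_le_left _ _))
            have h6 := hδψ h5
            rw [Real.dist_eq] at h6
            linarith [(abs_lt.mp h6).2]
        _ = F (γ w) := by
            rw [lintegral_indicator measurableSet_Icc, setLIntegral_const, Real.volume_Icc,
              sub_sub_cancel, hγw, mul_comm]
    · rw [Set.indicator_of_notMem hw]
      refine (lintegral_eq_zero_of_ae_eq_zero (Eventually.of_forall fun t => ?_)).le
      by_contra h0
      obtain ⟨s, -, -, hs⟩ := hdepth _ (hmem t h0)
      exact hw (hmemΓ t s hs).1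
  have hπΓ : MeasurableSet (π '' Γ) := (hΓc.image π.continuous).measurableSet
  have hrestr : (Measure.euclideanHausdorffMeasure (n - 1) : Measure E).restrict Γ =
      (surfaceMeasure Ω).restrict Γ := by
    rw [surfaceMeasure, Measure.restrict_restrict_of_subset Set.inter_subset_left]
  calc _ ≤ ∫⁻ w, (π '' Γ).indicator (fun w => F (γ w)) w := lintegral_mono hinner
    _ = ∫⁻ w in π '' Γ, F (γ w) := lintegral_indicator hπΓ _
    _ ≤ ∫⁻ x in Γ, F x ∂(Measure.euclideanHausdorffMeasure (n - 1)) :=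
      lintegral_projection_le hN1 hΓc hγπ F
    _ = ∫⁻ x in Γ, F x ∂(surfaceMeasure Ω) := by rw [hrestr]
    _ ≤ ∫⁻ x in Γ, ENNReal.ofReal ε * (ENNReal.ofReal (ψ x * (H (outerUnitNormal Ω x) + τ)) +
          ENNReal.ofReal (κ * ω)) ∂(surfaceMeasure Ω) := by
      refine setLIntegral_mono' hΓc.measurableSet fun x hx => ?_
      rw [hF]
      simp only
      rw [ENNReal.ofReal_mul hε.le, mul_assoc, ← ENNReal.ofReal_mul hκ0, mul_add,
        ← ENNReal.ofReal_add]
      · refine mul_le_mul_right (ENNReal.ofReal_le_ofReal ?_) _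
        have := mul_le_mul_of_nonneg_left (hκN x hx) (hψ0 x)
        linarith
      · exact mul_nonneg (hψ0 x) (add_nonneg (hH.nonneg _) hτ.le)
      · positivity
    _ = ENNReal.ofReal ε * (∫⁻ x in Γ, ENNReal.ofReal (ψ x * (H (outerUnitNormal Ω x) + τ))
          ∂(surfaceMeasure Ω) + ENNReal.ofReal (κ * ω) * surfaceMeasure Ω Γ) := by
      rw [lintegral_const_mul' _ _ ENNReal.ofReal_ne_top, lintegral_add_right _ measurable_const,
        setLIntegral_const]
    _ ≤ _ := by
      refine mul_le_mul_right (add_le_add (setLIntegral_le_lintegral _ _) ?_) _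
      rw [← ENNReal.ofReal_toReal hσfin, ← ENNReal.ofReal_mul (by positivity)]
      refine ENNReal.ofReal_le_ofReal ?_
      rw [← hσΓ, hω]
      calc κ * (θ / ((κ + 1) * (σΓ + 1))) * σΓ
          = θ * (κ / (κ + 1)) * (σΓ / (σΓ + 1)) := by field_simp
        _ ≤ θ * 1 * 1 := by
          gcongr
          · exact (div_le_one (by positivity)).mpr (by linarith)
          · exact (div_le_one (by positivity)).mpr (by linarith)
        _ = θ := by ring

end Layer

/-! ### From patches to the whole boundary; the Hardy inequality for `C¹` functions -/

section Global

variable {n : ℕ} {Ω : Set (EuclideanSpace ℝ (Fin n))} {H : EuclideanSpace ℝ (Fin n) → ℝ}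

local notation "E" => EuclideanSpace ℝ (Fin n)

theorem aemeasurable_outerUnitNormal (hΩ : HasC2Boundary Ω) :
    AEMeasurable (outerUnitNormal Ω) (surfaceMeasure Ω) :=
  (continuousOn_outerUnitNormal hΩ).aemeasurable isClosed_frontier.measurableSet

theorem isFiniteMeasure_surfaceMeasure (hΩ : HasC2Boundary Ω) (hΩo : IsOpen Ω)
    (hΩc : Convex ℝ Ω) (hΩb : Bornology.IsBounded Ω) : IsFiniteMeasure (surfaceMeasure Ω) :=
  ⟨by
    rw [surfaceMeasure, Measure.restrict_apply_univ]
    exact surfaceMeasure_lt_top hΩ hΩo hΩc hΩb⟩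

theorem ae_surfaceMeasure_mem_frontier (Ω : Set E) :
    ∀ᵐ x ∂(surfaceMeasure Ω), x ∈ frontier Ω :=
  ae_restrict_mem isClosed_frontier.measurableSet

theorem integrable_surfaceMeasure_of_continuous (hΩ : HasC2Boundary Ω) (hΩo : IsOpen Ω)
    (hΩc : Convex ℝ Ω) (hΩb : Bornology.IsBounded Ω) {f : E → ℝ}
    (hf : ContinuousOn f (frontier Ω)) : Integrable f (surfaceMeasure Ω) := by
  have := isFiniteMeasure_surfaceMeasure hΩ hΩo hΩc hΩb
  obtain ⟨M, hM⟩ := (isCompact_frontier_of_isBounded hΩb).exists_bound_of_continuousOn hf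
  refine Integrable.of_bound (hf.aestronglyMeasurable isClosed_frontier.measurableSet) M ?_
  filter_upwards [ae_surfaceMeasure_mem_frontier Ω] with x hx using hM x hx

/-- Sharp bound for the mass of a thin boundary layer. -/
theorem lintegral_layer (hH : IsAnisotropy H) (hΩ : HasC2Boundary Ω) (hΩo : IsOpen Ω)
    (hΩc : Convex ℝ Ω) (hΩb : Bornology.IsBounded Ω) (hnf : (frontier Ω).Nonempty) {ψ : E → ℝ}
    (hψ : Continuous ψ) (hψ0 : ∀ x, 0 ≤ ψ x) {θ : ℝ} (hθ : 0 < θ) : ∀ᶠ ε in 𝓝[>] (0 : ℝ),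
      ∫⁻ x in Ω ∩ {x | supportDist H Ω x < ε}, ENNReal.ofReal (ψ x) ≤
        ENNReal.ofReal ε *
          ((∫⁻ x, ENNReal.ofReal (ψ x * H (outerUnitNormal Ω x)) ∂(surfaceMeasure Ω)) +
            ENNReal.ofReal θ) := by
  have hK := isCompact_frontier_of_isBounded hΩb
  have hfin := isFiniteMeasure_surfaceMeasure hΩ hΩo hΩc hΩb
  have hψi : Integrable ψ (surfaceMeasure Ω) :=
    integrable_surfaceMeasure_of_continuous hΩ hΩo hΩc hΩb hψ.continuousOn
  set S := ∫ x, ψ x ∂(surfaceMeasure Ω) with hS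
  have hS0 : 0 ≤ S := integral_nonneg hψ0
  set τ := θ / (2 * (S + 1)) with hτd
  have hτ : 0 < τ := by positivity
  have hloc : ∀ x₀ : frontier Ω, _ := fun x₀ =>
    lintegral_layer_local hH hΩ hΩo hΩc hΩb x₀.2 hτ
  -- Half of the error `θ` is spent on `τ * ∫ ψ`, the other half on the finitely many local errors
  -- `θ'`.
  choose r hr hr' using hloc
  obtain ⟨t, ht⟩ := hK.elim_finite_subcover (fun x₀ : frontier Ω => Metric.ball (x₀ : E) (r x₀))
    (fun _ => Metric.isOpen_ball) fun x hx =>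
      Set.mem_iUnion.mpr ⟨⟨x, hx⟩, Metric.mem_ball_self (hr ⟨x, hx⟩)⟩
  obtain ⟨δ, hδ, hδt⟩ := hK.exists_cthickening_subset_open
    (isOpen_biUnion fun _ _ => Metric.isOpen_ball) ht
  -- The partition must sum to `1` on a whole neighbourhood of the boundary, since it is applied to
  -- the layer inside `Ω` as well as on `∂Ω`.
  obtain ⟨ρ, hρ⟩ := PartitionOfUnity.exists_isSubordinate
    (show IsClosed (Metric.cthickening δ (frontier Ω)) from Metric.isClosed_cthickening)
    (fun i : t => Metric.ball ((i : frontier Ω) : E) (r i)) (fun _ => Metric.isOpen_ball)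
    (fun x hx => by
      obtain ⟨i, hi, hxi⟩ := Set.mem_iUnion₂.mp (hδt hx)
      exact Set.mem_iUnion.mpr ⟨⟨i, hi⟩, hxi⟩)
  have hsum : ∀ x ∈ Metric.cthickening δ (frontier Ω), ∑ i, ρ i x = 1 := fun x hx => by
    rw [← finsum_eq_sum_of_fintype]; exact ρ.sum_eq_one hx
  set ψi : t → E → ℝ := fun i x => ρ i x * ψ x with hψid
  have hψi0 : ∀ i x, 0 ≤ ψi i x := fun i x => mul_nonneg (ρ.nonneg i x) (hψ0 x)
  have hψic : ∀ i, Continuous (ψi i) := fun i => (ρ i).continuous.mul hψ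
  have hψis : ∀ i, HasCompactSupport (ψi i) := fun i => by
    refine HasCompactSupport.mul_right ?_
    exact (Metric.isBounded_ball.subset (hρ i)).isCompact_closure.of_isClosed_subset
      (isClosed_tsupport _) subset_closure
  have hψiz : ∀ i : t, ∀ x ∉ Metric.ball ((i : frontier Ω) : E) (r i), ψi i x = 0 := fun i x hx => by
    have : ρ i x = 0 := image_eq_zero_of_notMem_tsupport fun h => hx (hρ i h)
    simp [hψid, this]
  set θ' := θ / (2 * (t.card + 1)) with hθ'
  have hθ'0 : 0 < θ' := by positivity
  have hev : ∀ᶠ ε in 𝓝[>] (0 : ℝ), ∀ i : t, _ := eventually_all.mpr fun i : t =>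
    hr' i (ψi i) ((hψis i).uniformContinuous_of_continuous (hψic i)) (hψi0 i)
      (hψiz i) θ' hθ'0
  obtain ⟨c, C, hc, hC, hcC⟩ := hH.polar_comparable
  have e2 : ∀ᶠ ε : ℝ in 𝓝[>] 0, ε < c * δ := nhdsWithin_le_nhds (gt_mem_nhds (by positivity))
  obtain ⟨K, hKl⟩ := exists_lipschitz_supportDist hH hΩ hΩb hnf
  filter_upwards [hev, e2] with ε h1 h2
  set L := Ω ∩ {x | supportDist H Ω x < ε} with hL
  have hLm : MeasurableSet L :=
    hΩo.measurableSet.inter (isOpen_lt hKl.continuous continuous_const).measurableSet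
  -- A layer point is within Euclidean distance `ε / c < δ` of the boundary.
  have hLδ : ∀ x ∈ L, x ∈ Metric.cthickening δ (frontier Ω) := fun x hx => by
    obtain ⟨z, hz, hzd⟩ := exists_polar_eq_anisotropicDist hH hΩb hnf x
    rw [anisotropicDist_eq_supportDist hH hΩ hΩb hΩo hΩc hnf hx.1] at hzd
    have hzε : polar H (x - z) < ε := hzd ▸ hx.2
    refine Metric.mem_cthickening_of_dist_le x z δ _ hz ?_
    rw [dist_eq_norm]
    have := (hcC (x - z)).1
    nlinarith
  have hsplit : ∀ x ∈ Metric.cthickening δ (frontier Ω), ψ x = ∑ i, ψi i x := fun x hx => by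
    simp only [hψid]
    rw [← Finset.sum_mul, hsum x hx, one_mul]
  have hNm := aemeasurable_outerUnitNormal hΩ
  have hHN0 : ∀ x, 0 ≤ H (outerUnitNormal Ω x) + τ := fun x => add_nonneg (hH.nonneg _) hτ.le
  have hHm : AEMeasurable (fun x => H (outerUnitNormal Ω x)) (surfaceMeasure Ω) :=
    hH.continuous.measurable.comp_aemeasurable hNm
  calc ∫⁻ x in L, ENNReal.ofReal (ψ x) = ∫⁻ x in L, ∑ i, ENNReal.ofReal (ψi i x) := by
        refine setLIntegral_congr_fun hLm fun x hx => ?_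
        rw [hsplit x (hLδ x hx), ENNReal.ofReal_sum_of_nonneg fun i _ => hψi0 i x]
    _ = ∑ i, ∫⁻ x in L, ENNReal.ofReal (ψi i x) :=
        lintegral_finsetSum _ fun i _ => ENNReal.measurable_ofReal.comp (hψic i).measurable
    _ ≤ ∑ i, ENNReal.ofReal ε * ((∫⁻ x, ENNReal.ofReal (ψi i x * (H (outerUnitNormal Ω x) + τ))
          ∂(surfaceMeasure Ω)) + ENNReal.ofReal θ') := Finset.sum_le_sum fun i _ => h1 i
    _ = ENNReal.ofReal ε * ((∫⁻ x, ∑ i, ENNReal.ofReal (ψi i x * (H (outerUnitNormal Ω x) + τ))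
          ∂(surfaceMeasure Ω)) + t.card * ENNReal.ofReal θ') := by
        rw [← Finset.mul_sum, Finset.sum_add_distrib, lintegral_finsetSum' _ fun i _ => ?_]
        · simp
        · exact ENNReal.measurable_ofReal.comp_aemeasurable
            ((hψic i).measurable.aemeasurable.mul (hHm.add_const _))
    _ = ENNReal.ofReal ε * ((∫⁻ x, (ENNReal.ofReal (ψ x * H (outerUnitNormal Ω x)) +
          ENNReal.ofReal (τ * ψ x)) ∂(surfaceMeasure Ω)) + t.card * ENNReal.ofReal θ') := by
        congr 2
        refine lintegral_congr_ae ?_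
        filter_upwards [ae_surfaceMeasure_mem_frontier Ω] with x hx
        rw [← ENNReal.ofReal_sum_of_nonneg fun i _ => mul_nonneg (hψi0 i x) (hHN0 x),
          ← Finset.sum_mul, ← hsplit x (Metric.self_subset_cthickening _ hx),
          ← ENNReal.ofReal_add (mul_nonneg (hψ0 x) (hH.nonneg _)) (mul_nonneg hτ.le (hψ0 x))]
        congr 1; ring
    _ ≤ _ := by
        refine mul_le_mul_right ?_ _
        have hm : Measurable fun x => ENNReal.ofReal (τ * ψ x) :=
          ENNReal.measurable_ofReal.comp (hψ.measurable.const_mul τ)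
        rw [lintegral_add_right _ hm, add_assoc]
        refine add_le_add le_rfl ?_
        rw [← ofReal_integral_eq_lintegral_ofReal (hψi.const_mul τ)
          (Eventually.of_forall fun x => mul_nonneg hτ.le (hψ0 x)), integral_const_mul, ← hS,
          ← ENNReal.ofReal_natCast, ← ENNReal.ofReal_mul (Nat.cast_nonneg _),
          ← ENNReal.ofReal_add (by positivity) (by positivity)]
        refine ENNReal.ofReal_le_ofReal ?_
        have a1 : τ * S ≤ θ / 2 := by
          rw [hτd, div_mul_eq_mul_div, div_le_div_iff₀ (by positivity) two_pos]
          nlinarith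
        have a2 : t.card * θ' ≤ θ / 2 := by
          rw [hθ', mul_div_assoc', div_le_div_iff₀ (by positivity) two_pos]
          nlinarith
        linarith

theorem integral_layer (hH : IsAnisotropy H) (hΩ : HasC2Boundary Ω) (hΩo : IsOpen Ω)
    (hΩc : Convex ℝ Ω) (hΩb : Bornology.IsBounded Ω) (hnf : (frontier Ω).Nonempty) {ψ : E → ℝ}
    (hψ : Continuous ψ) (hψ0 : ∀ x, 0 ≤ ψ x) {θ : ℝ} (hθ : 0 < θ) : ∀ᶠ ε in 𝓝[>] (0 : ℝ),
      1 / ε * ∫ x in Ω ∩ {x | supportDist H Ω x < ε}, ψ x ≤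
        (∫ x, ψ x * H (outerUnitNormal Ω x) ∂(surfaceMeasure Ω)) + θ := by
  filter_upwards [lintegral_layer hH hΩ hΩo hΩc hΩb hnf hψ hψ0 hθ, self_mem_nhdsWithin] with ε h hε
  have hε' : (0 : ℝ) < ε := hε
  have h0 : ∀ x, 0 ≤ ψ x * H (outerUnitNormal Ω x) := fun x => mul_nonneg (hψ0 x) (hH.nonneg _)
  have hi : Integrable (fun x => ψ x * H (outerUnitNormal Ω x)) (surfaceMeasure Ω) :=
    integrable_surfaceMeasure_of_continuous hΩ hΩo hΩc hΩb
      (hψ.continuousOn.mul (hH.continuous.comp_continuousOn (continuousOn_outerUnitNormal hΩ)))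
  have hi2 : IntegrableOn ψ (Ω ∩ {x | supportDist H Ω x < ε}) :=
    (hψ.continuousOn.integrableOn_compact hΩb.isCompact_closure).mono_set
      (Set.inter_subset_left.trans subset_closure)
  have hb0 : 0 ≤ ∫ x, ψ x * H (outerUnitNormal Ω x) ∂(surfaceMeasure Ω) := integral_nonneg h0
  rw [← ofReal_integral_eq_lintegral_ofReal hi2 (Eventually.of_forall hψ0),
    ← ofReal_integral_eq_lintegral_ofReal hi (Eventually.of_forall h0),
    ← ENNReal.ofReal_add hb0 hθ.le,
    ← ENNReal.ofReal_mul hε'.le, ENNReal.ofReal_le_ofReal_iff (by positivity)] at h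
  rw [one_div, inv_mul_le_iff₀ hε']
  exact h

/-- The Hardy inequality for functions of class `C¹` up to the boundary. -/
theorem hardy_of_contDiff (hH : IsAnisotropy H) {p : ℝ} (hp : 1 < p)
    (hΩo : IsOpen Ω) (hΩb : Bornology.IsBounded Ω) (hΩc : Convex ℝ Ω) (hΩ : HasC2Boundary Ω)
    (hne : Ω.Nonempty) (hnf : (frontier Ω).Nonempty) {α ϑ : ℝ} (hα : 0 < α) (hϑ : 0 < ϑ)
    {φ : E → ℝ} (hφ : ContDiff ℝ 1 φ) :
    (p - 1) * (α * ϑ) ^ (p - 1) * (1 - α * ϑ) *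
        ∫ x in Ω, |φ x| ^ p / (anisotropicDist H Ω x + α) ^ p ≤
      (∫ x in Ω, H (gradient φ x) ^ p) +
        ϑ ^ (p - 1) * ∫ x, |φ x| ^ p * H (outerUnitNormal Ω x) ∂(surfaceMeasure Ω) := by
  have hcongr : ∫ x in Ω, |φ x| ^ p / (anisotropicDist H Ω x + α) ^ p =
      ∫ x in Ω, |φ x| ^ p / (supportDist H Ω x + α) ^ p :=
    setIntegral_congr_fun hΩo.measurableSet fun x hx => by
      rw [anisotropicDist_eq_supportDist hH hΩ hΩb hΩo hΩc hnf hx]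
  rw [hcongr]
  set D := supportDist H Ω with hD
  set I := ∫ x in Ω, |φ x| ^ p / (D x + α) ^ p with hI
  set A := ∫ x in Ω, H (gradient φ x) ^ p with hA
  set B := ∫ x, |φ x| ^ p * H (outerUnitNormal Ω x) ∂(surfaceMeasure Ω) with hB
  set c := α * ϑ with hc
  have hc0 : 0 < c := mul_pos hα hϑ
  have hcut : ∀ ε : ℝ, 0 < ε ∧ ε < 1 / 2 → _ := fun ε h => exists_cutoff h.1 h.2
  choose! k m hkm using hcut
  have hpos : ∀ x ∈ Ω, 0 < D x := fun x hx => supportDist_pos hH hΩ hΩb hΩo hΩc hnf hx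
  obtain ⟨K, hK⟩ := exists_lipschitz_supportDist hH hΩ hΩb hnf
  have hDc : Continuous D := hK.continuous
  have hψ : Continuous fun x => |φ x| ^ p :=
    hφ.continuous.abs.rpow_const fun x => Or.inr (by linarith)
  have hcr : Continuous fun x => |φ x| ^ p / (|D x| + α) ^ p := by
    refine hψ.div ((hDc.abs.add continuous_const).rpow_const fun x =>
      Or.inr (by linarith)) fun x => ?_
    positivity
  have hi : IntegrableOn (fun x => |φ x| ^ p / (D x + α) ^ p) Ω :=
    ((hcr.continuousOn.integrableOn_compact hΩb.isCompact_closure).mono_set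
      subset_closure).congr_fun (fun x hx => by simp only [abs_of_pos (hpos x hx)])
        hΩo.measurableSet
  have hsmall : ∀ᶠ ε : ℝ in 𝓝[>] 0, 0 < ε ∧ ε < 1 / 2 := by
    filter_upwards [self_mem_nhdsWithin, nhdsWithin_le_nhds (gt_mem_nhds one_half_pos)]
      with ε h1 h2 using ⟨h1, h2⟩
  -- For each `x ∈ Ω`, `D x > 0`, so eventually `ε ≤ D x` and the cutoff value lies between `1 - 2 *
  -- ε` and `1`.
  have hlim : Tendsto (fun ε => ∫ x in Ω, k ε (D x) * (|φ x| ^ p / (D x + α) ^ p)) (𝓝[>] 0)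
      (𝓝 I) := by
    refine tendsto_integral_filter_of_dominated_convergence
      (fun x => |φ x| ^ p / (D x + α) ^ p) ?_ ?_ hi ?_
    · filter_upwards [hsmall] with ε hε
      have hkc : Continuous (k ε) :=
        continuous_iff_continuousAt.mpr fun s => ((hkm ε hε).1 s).continuousAt
      exact (hkc.comp hDc).aestronglyMeasurable.mul hi.aestronglyMeasurable
    · filter_upwards [hsmall] with ε hε
      obtain ⟨-, -, -, -, -, -, -, k0, k1, -⟩ := hkm ε hε
      filter_upwards [ae_restrict_mem hΩo.measurableSet] with x hx
      have := hpos x hx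
      have h0 : 0 ≤ |φ x| ^ p / (D x + α) ^ p := by positivity
      rw [Real.norm_eq_abs, abs_of_nonneg (mul_nonneg (k0 _) h0)]
      exact mul_le_of_le_one_left h0 (k1 _)
    · filter_upwards [ae_restrict_mem hΩo.measurableSet] with x hx
      have hk : Tendsto (fun ε => k ε (D x)) (𝓝[>] 0) (𝓝 1) := by
        have h1 : Tendsto (fun ε : ℝ => 1 - 2 * ε) (𝓝[>] 0) (𝓝 1) := by
          have : Continuous fun ε : ℝ => 1 - 2 * ε := by fun_prop
          simpa using (this.tendsto 0).mono_left nhdsWithin_le_nhds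
        refine tendsto_of_tendsto_of_tendsto_of_le_of_le' h1 tendsto_const_nhds ?_ ?_
        · filter_upwards [hsmall, nhdsWithin_le_nhds (gt_mem_nhds (hpos x hx))] with ε hε hεx
          obtain ⟨-, -, -, -, -, -, -, -, -, h⟩ := hkm ε hε
          exact h _ hεx.le
        · filter_upwards [hsmall] with ε hε
          obtain ⟨-, -, -, -, -, -, -, -, k1, -⟩ := hkm ε hε
          exact k1 _
      simpa using hk.mul_const (|φ x| ^ p / (D x + α) ^ p)
  -- The choice `c = α * ϑ` is dictated by this identity: it gives the boundary term the required
  -- coefficient.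
  have hϑe : c ^ (p - 1) * α ^ (1 - p) = ϑ ^ (p - 1) := by
    rw [hc, Real.mul_rpow hα.le hϑ.le, show 1 - p = -(p - 1) by ring, Real.rpow_neg hα.le]
    field_simp
  have key : ∀ θ > 0, c ^ (p - 1) * (p - 1) * I ≤ A + (p - 1) * c ^ p * I +
      ϑ ^ (p - 1) * (B + θ) := by
    intro θ hθ
    refine le_of_tendsto (hlim.const_mul (c ^ (p - 1) * (p - 1))) ?_
    filter_upwards [hsmall, integral_layer hH hΩ hΩo hΩc hΩb hnf hψ
      (fun x => Real.rpow_nonneg (abs_nonneg _) _) hθ] with ε hε hB'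
    obtain ⟨h1, h2, h3, h4, h5, h6, h7, h8, h9, -⟩ := hkm ε hε
    refine (hardy_cutoff hH hp hΩo hΩb hΩc hΩ hne hnf hα hc0 hφ h1 h2 h3 h4 h5 h6 h7 h8 h9).trans ?_
    rw [hϑe]
    have : 0 ≤ ϑ ^ (p - 1) := by positivity
    have := mul_le_mul_of_nonneg_left hB' this
    linarith
  have key2 : c ^ (p - 1) * (p - 1) * I ≤ A + (p - 1) * c ^ p * I + ϑ ^ (p - 1) * B := by
    refine le_of_forall_pos_le_add fun θ hθ => ?_
    have hpos : 0 < ϑ ^ (p - 1) := by positivity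
    have := key (θ / ϑ ^ (p - 1)) (by positivity)
    rw [mul_add, mul_div_cancel₀ _ hpos.ne'] at this
    linarith
  have e : c ^ p = c ^ (p - 1) * c := by rw [← Real.rpow_add_one hc0.ne']; congr 1; ring
  rw [e] at key2
  linarith

end Global

/-! ### The trace inequality -/

section TraceInequality

variable {n : ℕ} {Ω : Set (EuclideanSpace ℝ (Fin n))}

local notation "E" => EuclideanSpace ℝ (Fin n)

/-- Integrating the derivative of `(t - δ) * g t` over `[0, δ]` gives `δ * g 0` exactly; then `|t -
δ| ≤ δ`. -/
theorem le_integral_div_add_abs_deriv {g g' : ℝ → ℝ} {δ : ℝ} (hδ : 0 < δ)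
    (hg : ∀ t, HasDerivAt g (g' t) t) (hg' : Continuous g') :
    g 0 ≤ ∫ t in (0 : ℝ)..δ, (1 / δ * g t + |g' t|) := by
  have hgc : Continuous g := continuous_iff_continuousAt.mpr fun t => (hg t).continuousAt
  have h1 : ∀ t, HasDerivAt (fun t => (t - δ) * g t) (1 * g t + (t - δ) * g' t) t := fun t =>
    ((hasDerivAt_id t).sub_const δ).mul (hg t)
  have hc : Continuous fun t => 1 * g t + (t - δ) * g' t := by fun_prop
  have h2 := intervalIntegral.integral_eq_sub_of_hasDerivAt (a := 0) (b := δ) (fun t _ => h1 t)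
    (hc.intervalIntegrable _ _)
  have h3 : ∫ t in (0 : ℝ)..δ, (1 * g t + (t - δ) * g' t) ≤
      ∫ t in (0 : ℝ)..δ, δ * (1 / δ * g t + |g' t|) := by
    refine intervalIntegral.integral_mono_on hδ.le (hc.intervalIntegrable _ _)
      (Continuous.intervalIntegrable (by fun_prop) _ _) fun t ht => ?_
    have h4 : (t - δ) * g' t ≤ δ * |g' t| := by
      calc _ ≤ |(t - δ) * g' t| := le_abs_self _
        _ = |t - δ| * |g' t| := abs_mul _ _
        _ ≤ δ * |g' t| := by
          gcongr
          rw [abs_le]; constructor <;> linarith [ht.1, ht.2]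
    have h5 : δ * (1 / δ * g t + |g' t|) = g t + δ * |g' t| := by field_simp
    linarith
  rw [h2, intervalIntegral.integral_const_mul] at h3
  have h4 : δ * g 0 ≤ δ * ∫ t in (0 : ℝ)..δ, (1 / δ * g t + |g' t|) := by linarith
  exact le_of_mul_le_mul_left h4 hδ

/-- The one-dimensional bound is applied along inward segments of uniform length `δ` starting on the
patch. Projecting the patch to the hyperplane orthogonal to `N` and using Tonelli turns the family
of line integrals into an integral over `Ω`. -/
theorem exists_lintegral_trace_local (hΩ : HasC2Boundary Ω) (hΩo : IsOpen Ω) (hΩc : Convex ℝ Ω)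
    (hΩb : Bornology.IsBounded Ω) {x₀ : E} (hx₀ : x₀ ∈ frontier Ω) : ∃ r > 0, ∃ C : NNReal,
      ∀ ψ : E → ℝ, ContDiff ℝ 1 ψ → (∀ x, 0 ≤ ψ x) →
        ∫⁻ x in frontier Ω ∩ Metric.closedBall x₀ r, ENNReal.ofReal (ψ x)
            ∂(Measure.euclideanHausdorffMeasure (n - 1)) ≤
          C * ∫⁻ x in Ω, ENNReal.ofReal (ψ x + ‖gradient ψ x‖) := by
  set N := outerUnitNormal Ω x₀ with hN
  have hN1 : ‖N‖ = 1 := norm_outerUnitNormal hΩ hx₀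
  obtain ⟨r₁, hr₁, δ, hδ, hseg⟩ := exists_inward_segments hΩ hΩo hΩc hx₀
  obtain ⟨r₂, hr₂, -, hslope⟩ := exists_small_slope hΩ hΩo hΩc hx₀ one_half_pos
  set r := min (r₁ / 2) r₂ with hr
  have hr0 : 0 < r := lt_min (half_pos hr₁) hr₂
  set Γ := frontier Ω ∩ Metric.closedBall x₀ r with hΓ
  have hΓc : IsCompact Γ :=
    (isCompact_frontier_of_isBounded hΩb).inter_right Metric.isClosed_closedBall
  set π := (ℝ ∙ N)ᗮ.orthogonalProjectionOnto with hπ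
  have hπm : Measurable π := π.continuous.measurable
  set μ := (Measure.euclideanHausdorffMeasure (n - 1) : Measure E) with hμ
  -- The slope bound makes the inverse of the projection `2`-Lipschitz, whence the factor `2 ^ (n -
  -- 1)`.
  have hle : (μ.restrict Γ).map π ≤ (2 : ENNReal) ^ (n - 1) • volume := by
    refine Measure.le_iff.mpr fun A hA => ?_
    rw [Measure.map_apply hπm hA, Measure.restrict_apply (hπm hA), Measure.smul_apply,
      smul_eq_mul]
    refine (euclideanHausdorffMeasure_le_of_slope hN1 fun x hx y hy => ?_).trans ?_
    · have hsub : Metric.closedBall x₀ r ⊆ Metric.closedBall x₀ r₂ :=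
        Metric.closedBall_subset_closedBall (min_le_right _ _)
      exact hslope x ⟨hx.2.1, hsub hx.2.2⟩ y ⟨hy.2.1, hsub hy.2.2⟩
    · refine mul_le_mul_right (measure_mono ?_) _
      rintro _ ⟨x, hx, rfl⟩
      exact hx.1
  -- The second factor comes from `ψ / δ + ‖Dψ‖ ≤ (1 / δ + 1) (ψ + ‖Dψ‖)`.
  refine ⟨r, hr0, 2 ^ (n - 1) * (1 / δ + 1).toNNReal, fun ψ hψ hψ0 => ?_⟩
  have hgc : Continuous (gradient ψ) := (InnerProductSpace.toDual ℝ E).symm.continuous.comp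
    (hψ.continuous_fderiv one_ne_zero)
  have hψc := hψ.continuous
  set Ψ : E → ENNReal := Ω.indicator fun x => ENNReal.ofReal (1 / δ * ψ x + ‖gradient ψ x‖) with hΨ
  have hΨm : Measurable Ψ := (ENNReal.measurable_ofReal.comp
    (Continuous.measurable (by fun_prop))).indicator hΩo.measurableSet
  set P : (ℝ ∙ N)ᗮ → ENNReal := fun w => ∫⁻ t : ℝ, Ψ (t • N + w) with hP
  have hPm : Measurable P := by
    refine Measurable.lintegral_prod_right' (f := fun q : (ℝ ∙ N)ᗮ × ℝ => Ψ (q.2 • N + q.1)) ?_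
    exact hΨm.comp (Continuous.measurable (by fun_prop))
  have hpt : ∀ y ∈ Γ, ENNReal.ofReal (ψ y) ≤ P (π y) := by
    intro y hy
    have hyd := eq_inner_smul_add_projection hN1 y
    set g := ⟪y, N⟫ with hg
    have hline : ∀ t : ℝ, HasDerivAt (fun t : ℝ => y - t • N) (-N) t := fun t => by
      simpa using ((hasDerivAt_id t).smul_const N).const_sub y
    have hd : ∀ t : ℝ, HasDerivAt (fun t : ℝ => ψ (y - t • N)) ⟪gradient ψ (y - t • N), -N⟫ t := by
      intro t
      have := ((hψ.differentiable one_ne_zero (y - t • N)).hasFDerivAt).comp_hasDerivAt t (hline t)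
      rw [inner_gradient_eq_fderiv]
      exact this
    have h1 := le_integral_div_add_abs_deriv hδ hd (by fun_prop)
    simp only [zero_smul, sub_zero] at h1
    have h2 : ∫ t in (0 : ℝ)..δ, (1 / δ * ψ (y - t • N) + |⟪gradient ψ (y - t • N), -N⟫|) ≤
        ∫ t in (0 : ℝ)..δ, (1 / δ * ψ (y - t • N) + ‖gradient ψ (y - t • N)‖) := by
      refine intervalIntegral.integral_mono_on hδ.le (Continuous.intervalIntegrable (by fun_prop) _ _)
        (Continuous.intervalIntegrable (by fun_prop) _ _) fun t _ => ?_
      have := abs_real_inner_le_norm (gradient ψ (y - t • N)) (-N)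
      rw [norm_neg, hN1, mul_one] at this
      linarith
    refine (ENNReal.ofReal_le_ofReal (h1.trans h2)).trans ?_
    have h0 : ∀ t : ℝ, 0 ≤ 1 / δ * ψ (y - t • N) + ‖gradient ψ (y - t • N)‖ := fun t => by
      have := hψ0 (y - t • N)
      positivity
    rw [intervalIntegral.integral_of_le hδ.le, ofReal_integral_eq_lintegral_ofReal
      ((Continuous.integrableOn_Icc (by fun_prop)).mono_set Set.Ioc_subset_Icc_self)
      (Eventually.of_forall h0)]
    have h3 : ∫⁻ t in Set.Ioc 0 δ,
        ENNReal.ofReal (1 / δ * ψ (y - t • N) + ‖gradient ψ (y - t • N)‖) ≤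
        ∫⁻ t : ℝ, Ψ (y - t • N) := by
      rw [← lintegral_indicator measurableSet_Ioc]
      refine lintegral_mono fun t => ?_
      by_cases ht : t ∈ Set.Ioc 0 δ
      · have hmem : y - t • N ∈ Ω := hseg y ⟨hy.1, ?_⟩ t ht.1 ht.2
        · rw [Set.indicator_of_mem ht, hΨ, Set.indicator_of_mem hmem]
        · have h4 : r ≤ r₁ / 2 := min_le_left _ _
          have h5 := Metric.mem_closedBall.mp hy.2
          exact Metric.mem_ball.mpr (by linarith)
      · rw [Set.indicator_of_notMem ht]; exact zero_le
    refine h3.trans_eq ?_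
    rw [hP]
    simp only
    -- The substitution `t ↦ g - t` passes from depth below `y` to the coordinate along `N`.
    rw [← lintegral_sub_left_eq_self (fun t : ℝ => Ψ (t • N + π y)) g]
    refine lintegral_congr fun t => ?_
    congr 1
    rw [sub_smul]
    nth_rw 1 [hyd]
    abel
  calc ∫⁻ x in Γ, ENNReal.ofReal (ψ x) ∂μ ≤ ∫⁻ x in Γ, P (π x) ∂μ :=
        setLIntegral_mono' hΓc.measurableSet hpt
    _ = ∫⁻ w, P w ∂((μ.restrict Γ).map π) := (lintegral_map hPm hπm).symm
    _ ≤ ∫⁻ w, P w ∂((2 : ENNReal) ^ (n - 1) • volume) := lintegral_mono' hle le_rfl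
    _ = 2 ^ (n - 1) * ∫⁻ x, Ψ x := by
      rw [lintegral_smul_measure, lintegral_eq_lintegral_orthogonal hN1 hΨm, smul_eq_mul]
    _ = 2 ^ (n - 1) * ∫⁻ x in Ω, ENNReal.ofReal (1 / δ * ψ x + ‖gradient ψ x‖) := by
      rw [hΨ, lintegral_indicator hΩo.measurableSet]
    _ ≤ 2 ^ (n - 1) * ∫⁻ x in Ω, ENNReal.ofReal (1 / δ + 1) *
          ENNReal.ofReal (ψ x + ‖gradient ψ x‖) := by
      refine mul_le_mul_right (lintegral_mono fun x => ?_) _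
      rw [← ENNReal.ofReal_mul (by positivity)]
      refine ENNReal.ofReal_le_ofReal ?_
      have h1 := hψ0 x
      have h2 : 0 ≤ 1 / δ * ‖gradient ψ x‖ := by positivity
      linarith
    _ = _ := by
      rw [lintegral_const_mul' _ _ ENNReal.ofReal_ne_top, ← mul_assoc]
      simp [ENNReal.ofReal]

theorem exists_lintegral_trace (hΩ : HasC2Boundary Ω) (hΩo : IsOpen Ω) (hΩc : Convex ℝ Ω)
    (hΩb : Bornology.IsBounded Ω) : ∃ C : NNReal, ∀ ψ : E → ℝ, ContDiff ℝ 1 ψ → (∀ x, 0 ≤ ψ x) →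
      ∫⁻ x, ENNReal.ofReal (ψ x) ∂(surfaceMeasure Ω) ≤
        C * ∫⁻ x in Ω, ENNReal.ofReal (ψ x + ‖gradient ψ x‖) := by
  refine (isCompact_frontier_of_isBounded hΩb).induction_on
    (p := fun s => ∃ C : NNReal, ∀ ψ : E → ℝ, ContDiff ℝ 1 ψ → (∀ x, 0 ≤ ψ x) →
      ∫⁻ x in s, ENNReal.ofReal (ψ x) ∂(Measure.euclideanHausdorffMeasure (n - 1)) ≤
        C * ∫⁻ x in Ω, ENNReal.ofReal (ψ x + ‖gradient ψ x‖)) ⟨0, by simp⟩ ?_ ?_ ?_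
  · rintro s t hst ⟨C, hC⟩
    exact ⟨C, fun ψ h1 h2 => (lintegral_mono_set hst).trans (hC ψ h1 h2)⟩
  · rintro s t ⟨C, hC⟩ ⟨C', hC'⟩
    refine ⟨C + C', fun ψ h1 h2 => (lintegral_union_le _ _ _).trans ?_⟩
    push_cast
    rw [add_mul]
    exact add_le_add (hC ψ h1 h2) (hC' ψ h1 h2)
  · intro x hx
    obtain ⟨r, hr, C, hC⟩ := exists_lintegral_trace_local hΩ hΩo hΩc hΩb hx
    exact ⟨_, inter_mem_nhdsWithin _ (Metric.closedBall_mem_nhds x hr), C, hC⟩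

/-- The trace inequality in `W^{1,p}`. -/
theorem exists_eLpNorm_trace (hΩ : HasC2Boundary Ω) (hΩo : IsOpen Ω) (hΩc : Convex ℝ Ω)
    (hΩb : Bornology.IsBounded Ω) {p : ℝ} (hp : 1 < p) : ∃ C : NNReal, ∀ φ : E → ℝ,
      ContDiff ℝ 1 φ → eLpNorm φ (ENNReal.ofReal p) (surfaceMeasure Ω) ≤
        C * (eLpNorm φ (ENNReal.ofReal p) (volume.restrict Ω) +
          eLpNorm (gradient φ) (ENNReal.ofReal p) (volume.restrict Ω)) := by
  have hp0 : 0 < p := by linarith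
  obtain ⟨C, hC⟩ := exists_lintegral_trace hΩ hΩo hΩc hΩb
  -- The `L¹` estimate is applied to `|φ|^p`. By Young, `|φ|^p + p |φ|^(p-1) ‖Dφ‖ ≤ p |φ|^p + ‖Dφ‖^p
  -- ≤ p (|φ|^p + ‖Dφ‖^p)`; then the `p`-th root is taken.
  refine ⟨(C * p.toNNReal) ^ (1 / p), fun φ hφ => ?_⟩
  have hψ : ContDiff ℝ 1 fun x => |φ x| ^ p := by
    simpa only [Real.norm_eq_abs] using hφ.norm_rpow hp
  have h1 := hC _ hψ fun x => Real.rpow_nonneg (abs_nonneg _) _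
  have hpE : ENNReal.ofReal p ≠ 0 := by simpa using hp0
  have htr : (ENNReal.ofReal p).toReal = p := ENNReal.toReal_ofReal hp0.le
  have hgc : Continuous (gradient φ) := (InnerProductSpace.toDual ℝ E).symm.continuous.comp
    (hφ.continuous_fderiv one_ne_zero)
  rw [eLpNorm_eq_lintegral_rpow_enorm_toReal hpE ENNReal.ofReal_ne_top,
    eLpNorm_eq_lintegral_rpow_enorm_toReal hpE ENNReal.ofReal_ne_top,
    eLpNorm_eq_lintegral_rpow_enorm_toReal hpE ENNReal.ofReal_ne_top, htr]
  have he : ∀ {V : Type} [NormedAddCommGroup V] (v : V), ‖v‖ₑ ^ p = ENNReal.ofReal (‖v‖ ^ p) := by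
    intro V _ v
    rw [← ofReal_norm, ENNReal.ofReal_rpow_of_nonneg (norm_nonneg v) hp0.le]
  have h2 : ∫⁻ x, ‖φ x‖ₑ ^ p ∂(surfaceMeasure Ω) ≤ C * p.toNNReal *
      ((∫⁻ x in Ω, ‖φ x‖ₑ ^ p) + ∫⁻ x in Ω, ‖gradient φ x‖ₑ ^ p) := by
    calc _ = ∫⁻ x, ENNReal.ofReal (|φ x| ^ p) ∂(surfaceMeasure Ω) :=
          lintegral_congr fun x => he _
      _ ≤ C * ∫⁻ x in Ω, ENNReal.ofReal (|φ x| ^ p + ‖gradient (fun y => |φ y| ^ p) x‖) := h1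
      _ ≤ C * ∫⁻ x in Ω, p.toNNReal * (‖φ x‖ₑ ^ p + ‖gradient φ x‖ₑ ^ p) := by
          refine mul_le_mul_right (lintegral_mono fun x => ?_) _
          rw [he, he, ← ENNReal.ofReal_add (by positivity) (by positivity), ← ENNReal.ofReal,
            ← ENNReal.ofReal_mul hp0.le]
          refine ENNReal.ofReal_le_ofReal ?_
          rw [gradient_abs_rpow hp (hφ.differentiable one_ne_zero x), norm_smul, Real.norm_eq_abs,
            abs_rpow_sub_two_mul hp, Real.norm_eq_abs]
          have h3 := mul_rpow_mul_le_rpow_add hp (norm_nonneg (gradient φ x)) (abs_nonneg (φ x))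
          have h4 : 0 ≤ ‖gradient φ x‖ ^ p := by positivity
          nlinarith
      _ = _ := by
          rw [lintegral_const_mul' _ _ ENNReal.coe_ne_top, lintegral_add_left, mul_assoc]
          exact (hφ.continuous.enorm.measurable).pow_const p
  refine (ENNReal.rpow_le_rpow h2 (by positivity)).trans ?_
  rw [ENNReal.mul_rpow_of_nonneg _ _ (by positivity)]
  have h3 : ((C * p.toNNReal : NNReal) : ENNReal) ^ (1 / p) =
      (((C * p.toNNReal) ^ (1 / p) : NNReal) : ENNReal) :=
    (ENNReal.coe_rpow_of_nonneg _ (by positivity)).symm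
  rw [← ENNReal.coe_mul, h3]
  refine mul_le_mul_right ?_ _
  exact ENNReal.rpow_add_le_add_rpow _ _ (by positivity) ((div_le_one hp0).mpr hp.le)

end TraceInequality

/-! ### `L^p` theory of dilated mollification -/

section Density

variable {n : ℕ}

local notation "E" => EuclideanSpace ℝ (Fin n)

/-- Mollification of `F` by `κ`, precomposed with the dilation of ratio `l`. -/
noncomputable def dilatedMollification {n : ℕ} {V : Type} [NormedAddCommGroup V] [NormedSpace ℝ V]
    {c : EuclideanSpace ℝ (Fin n)} (κ : ContDiffBump c) (l : ℝ)
    (F : EuclideanSpace ℝ (Fin n) → V) (x : EuclideanSpace ℝ (Fin n)) : V :=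
  ∫ t, κ.normed volume t • F (l • x - t)

section Lp

variable {V : Type} [NormedAddCommGroup V] [NormedSpace ℝ V] {c : EuclideanSpace ℝ (Fin n)}

/-- The Jacobian of the dilation contributes `l ^ (-n)`, at most `2 ^ n` since `l ≥ 1 / 2`. -/
theorem lintegral_comp_smul_sub {l : ℝ} (hl : 1 / 2 ≤ l) {G : E → ENNReal} (hG : Measurable G)
    (t : E) : ∫⁻ x, G (l • x - t) ≤ 2 ^ n * ∫⁻ x, G x := by
  have hl0 : l ≠ 0 := by linarith
  have hm : Measurable fun x => G (x - t) := hG.comp (measurable_id.sub_const t)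
  have h1 : ∫⁻ x, G (l • x - t) = ∫⁻ y, G (y - t) ∂(Measure.map (l • ·) volume) :=
    (lintegral_map hm (measurable_const_smul l)).symm
  rw [h1, Measure.map_addHaar_smul volume hl0, lintegral_smul_measure, lintegral_sub_right_eq_self]
  refine mul_le_mul_left ?_ _
  rw [finrank_euclideanSpace_fin, ← inv_pow, abs_of_nonneg (by positivity),
    ENNReal.ofReal_pow (by positivity)]
  refine pow_le_pow_left' ?_ n
  rw [← ENNReal.ofReal_ofNat]
  refine ENNReal.ofReal_le_ofReal (inv_le_of_inv_le₀ (by norm_num) (by linarith))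

/-- The kernel is a probability density, so Jensen's inequality bounds the power of the average by
the average of the power; Tonelli then integrates in `x` first. -/
theorem lintegral_rpow_dilatedMollification_le (κ : ContDiffBump c) {l : ℝ} (hl : 1 / 2 ≤ l)
    {F : E → V} (hF : StronglyMeasurable F) {p : ℝ} (hp : 1 ≤ p) :
    ∫⁻ x, ‖dilatedMollification κ l F x‖ₑ ^ p ≤ 2 ^ n * ∫⁻ x, ‖F x‖ₑ ^ p := by
  have hp0 : 0 < p := by linarith
  set w : E → ENNReal := fun t => ENNReal.ofReal (κ.normed volume t) with hw
  have hwm : Measurable w := ENNReal.measurable_ofReal.comp κ.continuous_normed.measurable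
  have hw1 : ∫⁻ t, w t = 1 := by
    rw [hw, ← ofReal_integral_eq_lintegral_ofReal κ.integrable_normed
      (Eventually.of_forall κ.nonneg_normed), κ.integral_normed, ENNReal.ofReal_one]
  set μ : Measure E := volume.withDensity w with hμ
  have : IsProbabilityMeasure μ := ⟨by rw [hμ, withDensity_apply _ MeasurableSet.univ,
    Measure.restrict_univ, hw1]⟩
  have hFm : ∀ x : E, StronglyMeasurable fun t => F (l • x - t) := fun x =>
    hF.comp_measurable (measurable_const.sub measurable_id)
  have hnm : Measurable fun y => ‖F y‖ₑ ^ p := hF.enorm.pow_const p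
  have hpt : ∀ x, ‖dilatedMollification κ l F x‖ₑ ^ p ≤ ∫⁻ t, w t * ‖F (l • x - t)‖ₑ ^ p := by
    intro x
    have h1 : ‖dilatedMollification κ l F x‖ₑ ≤ ∫⁻ t, ‖F (l • x - t)‖ₑ ∂μ := by
      refine (enorm_integral_le_lintegral_enorm _).trans_eq ?_
      rw [hμ, lintegral_withDensity_eq_lintegral_mul _ hwm (hFm x).enorm]
      refine lintegral_congr fun t => ?_
      rw [enorm_smul, Pi.mul_apply, hw, Real.enorm_eq_ofReal (κ.nonneg_normed t)]
    have h2 := eLpNorm'_le_eLpNorm'_of_exponent_le one_pos hp μ (hFm x).aestronglyMeasurable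
    simp only [eLpNorm', ENNReal.rpow_one, div_one] at h2
    calc _ ≤ ((∫⁻ t, ‖F (l • x - t)‖ₑ ^ p ∂μ) ^ (1 / p)) ^ p :=
          ENNReal.rpow_le_rpow (h1.trans h2) hp0.le
      _ = ∫⁻ t, ‖F (l • x - t)‖ₑ ^ p ∂μ := by
          rw [← ENNReal.rpow_mul, one_div_mul_cancel hp0.ne', ENNReal.rpow_one]
      _ = _ := by
          rw [hμ, lintegral_withDensity_eq_lintegral_mul _ hwm ((hFm x).enorm.pow_const p)]
          rfl
  calc _ ≤ ∫⁻ x, ∫⁻ t, w t * ‖F (l • x - t)‖ₑ ^ p := lintegral_mono hpt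
    _ = ∫⁻ t, ∫⁻ x, w t * ‖F (l • x - t)‖ₑ ^ p := by
        refine lintegral_lintegral_swap (Measurable.aemeasurable ?_)
        refine (hwm.comp measurable_snd).mul (hnm.comp ?_)
        exact (measurable_fst.const_smul l).sub measurable_snd
    _ = ∫⁻ t, w t * ∫⁻ x, ‖F (l • x - t)‖ₑ ^ p := by
        refine lintegral_congr fun t => lintegral_const_mul' _ _ ENNReal.ofReal_ne_top
    _ ≤ ∫⁻ t, w t * (2 ^ n * ∫⁻ x, ‖F x‖ₑ ^ p) :=
        lintegral_mono fun t => mul_le_mul_right (lintegral_comp_smul_sub hl hnm t) _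
    _ = _ := by rw [lintegral_mul_const _ hwm, hw1, one_mul]

theorem dilatedMollification_congr (κ : ContDiffBump c) (l : ℝ) {F G : E → V}
    (h : F =ᵐ[volume] G) : dilatedMollification κ l F = dilatedMollification κ l G := by
  funext x
  refine integral_congr_ae ?_
  filter_upwards [(quasiMeasurePreserving_sub_left volume (l • x)).ae_eq h] with t ht
  exact congrArg _ ht

theorem eLpNorm_dilatedMollification_le (κ : ContDiffBump c) {l : ℝ} (hl : 1 / 2 ≤ l)
    {F : E → V} (hF : AEStronglyMeasurable F volume) {p : ℝ} (hp : 1 ≤ p) :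
    eLpNorm (dilatedMollification κ l F) (ENNReal.ofReal p) volume ≤
      (2 ^ n) ^ (1 / p) * eLpNorm F (ENNReal.ofReal p) volume := by
  have hp0 : 0 < p := by linarith
  rw [dilatedMollification_congr κ l hF.ae_eq_mk, eLpNorm_congr_ae hF.ae_eq_mk,
    eLpNorm_eq_lintegral_rpow_enorm_toReal (by simpa using hp0) ENNReal.ofReal_ne_top,
    eLpNorm_eq_lintegral_rpow_enorm_toReal (by simpa using hp0) ENNReal.ofReal_ne_top,
    ENNReal.toReal_ofReal hp0.le, ← ENNReal.mul_rpow_of_nonneg _ _ (by positivity)]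
  exact ENNReal.rpow_le_rpow
    (lintegral_rpow_dilatedMollification_le κ hl hF.stronglyMeasurable_mk hp) (by positivity)

theorem integrable_normed_smul_comp (κ : ContDiffBump c) {F : E → V}
    (hF : LocallyIntegrable F volume) (y : E) :
    Integrable fun t => κ.normed volume t • F (y - t) :=
  (κ.hasCompactSupport_normed.convolutionExists_left (ContinuousLinearMap.lsmul ℝ ℝ)
    κ.continuous_normed hF y).integrable

theorem dilatedMollification_sub (κ : ContDiffBump c) (l : ℝ) {F G : E → V}
    (hF : LocallyIntegrable F volume) (hG : LocallyIntegrable G volume) :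
    dilatedMollification κ l (F - G) = dilatedMollification κ l F - dilatedMollification κ l G := by
  funext x
  simp only [dilatedMollification, Pi.sub_apply, smul_sub]
  exact integral_sub (integrable_normed_smul_comp κ hF _) (integrable_normed_smul_comp κ hG _)

theorem dist_dilatedMollification_le [CompleteSpace V] (κ : ContDiffBump c) {l R δ ε : ℝ}
    (hε : 0 ≤ ε) {g : E → V} (hg : Continuous g)
    (hκ : Function.support (κ.normed volume) ⊆ Metric.ball 0 R)
    (hgδ : ∀ y z, dist y z < δ → dist (g y) (g z) ≤ ε) {x : E} (hx : ‖l • x - x‖ + R ≤ δ) :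
    dist (dilatedMollification κ l g x) (g x) ≤ ε := by
  refine dist_convolution_le (μ := volume) (x₀ := l • x) hε hκ κ.nonneg_normed κ.integral_normed
    hg.aestronglyMeasurable fun y hy => hgδ y x ?_
  rw [Metric.mem_ball] at hy
  calc dist y x ≤ dist y (l • x) + dist (l • x) x := dist_triangle _ _ _
    _ < R + ‖l • x - x‖ := by rw [dist_eq_norm (l • x)]; gcongr
    _ ≤ δ := by linarith

/-- Dilated mollifications with shrinking kernels converge in `L^p` on bounded sets. -/
theorem tendsto_eLpNorm_dilatedMollification_sub [CompleteSpace V] {Ω : Set E}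
    (hΩb : Bornology.IsBounded Ω) (hΩm : MeasurableSet Ω)
    {c : ℕ → E} (κ : ∀ k, ContDiffBump (c k)) {l R : ℕ → ℝ} (hl : ∀ k, 1 / 2 ≤ l k)
    (hl1 : Tendsto l atTop (𝓝 1)) (hR : Tendsto R atTop (𝓝 0))
    (hκ : ∀ k, Function.support ((κ k).normed volume) ⊆ Metric.ball 0 (R k)) {p : ℝ} (hp : 1 ≤ p)
    {F : E → V} (hF : MemLp F (ENNReal.ofReal p) volume) :
    Tendsto (fun k => eLpNorm (fun x => dilatedMollification (κ k) (l k) F x - F x)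
      (ENNReal.ofReal p) (volume.restrict Ω)) atTop (𝓝 0) := by
  have hp0 : 0 < p := by linarith
  have hp1 : 1 ≤ ENNReal.ofReal p := by rwa [ENNReal.one_le_ofReal]
  set A : ENNReal := (2 ^ n) ^ (1 / p) with hA
  have hAt : A ≠ ⊤ := ENNReal.rpow_ne_top_of_nonneg (by positivity) (by simp)
  obtain ⟨M, hM0, hM⟩ : ∃ M > 0, ∀ x ∈ Ω, ‖x‖ ≤ M := hΩb.exists_pos_norm_le
  have hFl : LocallyIntegrable F volume := hF.locallyIntegrable hp1
  rw [ENNReal.tendsto_nhds_zero]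
  intro ε hε
  by_cases hεt : ε = ⊤
  · simp [hεt]
  -- approximation by a continuous function
  set ε₁ := ε / (2 * (A + 1)) with hε₁
  have hε₁0 : ε₁ ≠ 0 :=
    (ENNReal.div_pos hε.ne' (ENNReal.mul_ne_top (by simp) (by simp [hAt]))).ne'
  obtain ⟨g, hgs, hgF, hgc, hgm⟩ :=
    hF.exists_hasCompactSupport_eLpNorm_sub_le ENNReal.ofReal_ne_top hε₁0
  have hgu := hgs.uniformContinuous_of_continuous hgc
  set B : ENNReal := volume Ω ^ (1 / p) with hB
  have hvol : volume Ω ≠ ⊤ := hΩb.measure_lt_top.ne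
  have hBt : B ≠ ⊤ := ENNReal.rpow_ne_top_of_nonneg (by positivity) hvol
  -- `ε₁` and `ε₂` are scaled so that `(A + 1) ε₁` and `(B + 1) ε₂` each equal `ε / 2`, also when
  -- `A` or `B` vanishes.
  set ε₂ : ℝ := (ε / (2 * (B + 1))).toReal with hε₂
  have hε₂t : ε / (2 * (B + 1)) ≠ ⊤ := ENNReal.div_ne_top hεt (by simp)
  have hε₂0 : 0 < ε₂ := ENNReal.toReal_pos
    (ENNReal.div_pos hε.ne' (ENNReal.mul_ne_top (by simp) (by simp [hBt]))).ne' hε₂t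
  obtain ⟨δ, hδ, hδg⟩ := Metric.uniformContinuous_iff.mp hgu ε₂ hε₂0
  have hsmall : ∀ᶠ k in atTop, |l k - 1| * M + R k < δ := by
    have : Tendsto (fun k => |l k - 1| * M + R k) atTop (𝓝 0) := by
      have h1 : Tendsto (fun k => |l k - 1|) atTop (𝓝 0) := by
        simpa using (hl1.sub_const 1).abs
      simpa using (h1.mul_const M).add hR
    exact this.eventually_lt_const hδ
  filter_upwards [hsmall] with k hk
  set T : (E → V) → E → V := dilatedMollification (κ k) (l k) with hT
  -- Three errors: the operator applied to `F - g`, bounded by its norm; the uniform error for the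
  -- continuous `g` on the bounded set; and `g - F` itself.
  have e : (fun x => T F x - F x) = T (F - g) + ((fun x => T g x - g x) + (g - F)) := by
    funext x
    rw [hT, dilatedMollification_sub (κ k) (l k) hFl hgc.locallyIntegrable]
    simp only [Pi.add_apply, Pi.sub_apply]
    abel
  have hTmeas : ∀ {G : E → V}, LocallyIntegrable G volume →
      AEStronglyMeasurable (T G) (volume.restrict Ω) := fun {G} hG => by
    have : Continuous (MeasureTheory.convolution ((κ k).normed volume) G
        (ContinuousLinearMap.lsmul ℝ ℝ) volume) :=
      (κ k).hasCompactSupport_normed.continuous_convolution_left _ (κ k).continuous_normed hG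
    exact (this.comp (continuous_const_smul (l k))).aestronglyMeasurable
  have hFg : MemLp (F - g) (ENNReal.ofReal p) volume := hF.sub hgm
  have b1 : eLpNorm (T (F - g)) (ENNReal.ofReal p) (volume.restrict Ω) ≤ A * ε₁ :=
    (eLpNorm_mono_measure _ Measure.restrict_le_self).trans
      ((eLpNorm_dilatedMollification_le (κ k) (hl k) hFg.1 hp).trans
        (mul_le_mul_right hgF _))
  have b2 : eLpNorm (fun x => T g x - g x) (ENNReal.ofReal p) (volume.restrict Ω) ≤
      B * ENNReal.ofReal ε₂ := by
    have := eLpNorm_le_of_ae_bound (p := ENNReal.ofReal p) (μ := volume.restrict Ω)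
      (f := fun x => T g x - g x) (C := ε₂) ?_
    · rwa [Measure.restrict_apply_univ, ENNReal.toReal_ofReal hp0.le, ← one_div] at this
    · filter_upwards [ae_restrict_mem hΩm] with x hx
      rw [← dist_eq_norm]
      refine dist_dilatedMollification_le (κ k) hε₂0.le hgc (hκ k)
        (fun y z hyz => (hδg hyz).le) ?_
      have h1 : l k • x - x = (l k - 1) • x := by rw [sub_smul, one_smul]
      rw [h1, norm_smul, Real.norm_eq_abs]
      have := mul_le_mul_of_nonneg_left (hM x hx) (abs_nonneg (l k - 1))
      linarith
  have b3 : eLpNorm (g - F) (ENNReal.ofReal p) (volume.restrict Ω) ≤ ε₁ := by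
    refine (eLpNorm_mono_measure _ Measure.restrict_le_self).trans ?_
    rwa [eLpNorm_sub_comm]
  have hgl := hgc.locallyIntegrable (μ := volume)
  rw [e]
  calc _ ≤ eLpNorm (T (F - g)) (ENNReal.ofReal p) (volume.restrict Ω) +
        (eLpNorm (fun x => T g x - g x) (ENNReal.ofReal p) (volume.restrict Ω) +
          eLpNorm (g - F) (ENNReal.ofReal p) (volume.restrict Ω)) := by
        refine (eLpNorm_add_le (hTmeas (hFl.sub hgl))
          (((hTmeas hgl).sub hgc.aestronglyMeasurable).add
            (hgm.sub hF).1.restrict) hp1).trans ?_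
        gcongr
        exact eLpNorm_add_le ((hTmeas hgl).sub hgc.aestronglyMeasurable) (hgm.sub hF).1.restrict hp1
    _ ≤ A * ε₁ + (B * ENNReal.ofReal ε₂ + ε₁) := by gcongr
    _ = (A + 1) * ε₁ + B * ENNReal.ofReal ε₂ := by ring
    _ ≤ (A + 1) * ε₁ + (B + 1) * ENNReal.ofReal ε₂ := by gcongr; exact le_self_add
    _ = ε / 2 + ε / 2 := by
        have key : ∀ D : ENNReal, D ≠ ⊤ → (D + 1) * (ε / (2 * (D + 1))) = ε / 2 := by
          intro D hD
          have h1 : D + 1 ≠ 0 := by simp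
          have h2 : D + 1 ≠ ⊤ := by simp [hD]
          rw [ENNReal.div_eq_inv_mul, ENNReal.mul_inv (by simp) (by simp), ENNReal.div_eq_inv_mul]
          calc _ = ((D + 1) * (D + 1)⁻¹) * (2⁻¹ * ε) := by ring
            _ = _ := by rw [ENNReal.mul_inv_cancel h1 h2, one_mul]
        rw [hε₂, ENNReal.ofReal_toReal hε₂t, hε₁, key A hAt, key B hBt]
    _ = ε := ENNReal.add_halves ε

end Lp

end Density

/-! ### Smooth approximation and existence of the trace -/

section Approximation

variable {n : ℕ} {Ω : Set (EuclideanSpace ℝ (Fin n))}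

local notation "E" => EuclideanSpace ℝ (Fin n)

section Derivative

variable {c : EuclideanSpace ℝ (Fin n)}

theorem dilatedMollification_eq_integral {V : Type} [NormedAddCommGroup V] [NormedSpace ℝ V]
    (κ : ContDiffBump c) (l : ℝ) (F : E → V) (x : E) :
    dilatedMollification κ l F x = ∫ y, κ.normed volume (l • x - y) • F y := by
  rw [← integral_sub_left_eq_self _ _ (l • x)]
  simp [dilatedMollification]

theorem contDiff_dilatedMollification (κ : ContDiffBump c) (l : ℝ) {f : E → ℝ}
    (hf : LocallyIntegrable f) : ContDiff ℝ 1 (dilatedMollification κ l f) := by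
  have h1 := (κ.hasCompactSupport_normed (μ := volume)).contDiff_convolution_left (μ := volume)
    (ContinuousLinearMap.lsmul ℝ ℝ) (κ.contDiff_normed (n := 1)) hf
  exact h1.comp (contDiff_const_smul l)

/-- The derivative falls on the smooth kernel; the factor `l` is the chain rule for the dilation. -/
theorem fderiv_dilatedMollification (κ : ContDiffBump c) (l : ℝ) {f : E → ℝ}
    (hf : LocallyIntegrable f) (x v : E) : fderiv ℝ (dilatedMollification κ l f) x v =
      l * ∫ y, fderiv ℝ (κ.normed volume) (l • x - y) v * f y := by
  have hk : ContDiff ℝ 1 (κ.normed volume) := κ.contDiff_normed (n := 1)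
  have hcs := κ.hasCompactSupport_normed (μ := volume)
  have h1 := hcs.hasFDerivAt_convolution_left (μ := volume) (ContinuousLinearMap.lsmul ℝ ℝ) hk hf
    (l • x)
  have h2 := h1.comp x ((hasFDerivAt_id x).const_smul l)
  have h3 : fderiv ℝ (dilatedMollification κ l f) x = _ := h2.fderiv
  have hint := (hcs.fderiv ℝ).convolutionExists_left (μ := volume)
    (ContinuousLinearMap.precompL E (ContinuousLinearMap.lsmul ℝ ℝ))
    (hk.continuous_fderiv one_ne_zero) hf (l • x)
  rw [h3, ← integral_sub_left_eq_self _ _ (l • x)]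
  simp only [ContinuousLinearMap.coe_comp, Function.comp_apply, sub_sub_cancel,
    _root_.smul_apply, ContinuousLinearMap.id_apply, map_smul, smul_eq_mul]
  congr 1
  rw [convolution_def, ContinuousLinearMap.integral_apply hint.integrable]
  simp [ContinuousLinearMap.precompL_apply]

/-- The support hypothesis makes the reflected kernel `y ↦ κ (l • x - y)` admissible in the
definition of the weak gradient. The sign from reflection cancels the sign from integration by
parts. -/
theorem gradient_dilatedMollification {p : ℝ} (hp : 1 ≤ p) (hΩm : MeasurableSet Ω)
    (hΩb : Bornology.IsBounded Ω) (u : SobolevFunction Ω p) (κ : ContDiffBump c) {l : ℝ} {x : E}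
    (hκ : ∀ y, l • x - y ∈ Metric.closedBall c κ.rOut → y ∈ Ω) :
    gradient (dilatedMollification κ l (Ω.indicator u.toFun)) x =
      l • dilatedMollification κ l (Ω.indicator u.grad) x := by
  have hp' : 1 ≤ ENNReal.ofReal p := by simpa using hp
  have : IsFiniteMeasure (volume.restrict Ω : Measure E) :=
    ⟨by simpa using hΩb.measure_lt_top⟩
  have hfi : IntegrableOn u.toFun Ω := u.memLp.integrable hp'
  have hgi : IntegrableOn u.grad Ω := u.memLp_grad.integrable hp'
  have hf : LocallyIntegrable (Ω.indicator u.toFun) :=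
    (hfi.integrable_indicator hΩm).locallyIntegrable
  have hk : ContDiff ℝ (⊤ : ℕ∞) (κ.normed volume) := κ.contDiff_normed
  refine ext_inner_right ℝ fun v => ?_
  rw [inner_gradient_eq_fderiv, fderiv_dilatedMollification κ l hf, inner_smul_left,
    dilatedMollification_eq_integral]
  simp only [conj_trivial]
  congr 1
  set ψ : E → ℝ := fun y => κ.normed volume (l • x - y) with hψ
  have hts : tsupport ψ ⊆ (fun y => l • x - y) ⁻¹' Metric.closedBall c κ.rOut := by
    refine closure_minimal (fun y hy => ?_)
      (Metric.isClosed_closedBall.preimage (continuous_const.sub continuous_id))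
    rw [← κ.tsupport_normed_eq (μ := volume)]
    exact subset_tsupport _ hy
  have hw := u.weak_grad ψ (hk.comp (contDiff_const.sub contDiff_id)) ?_
    (hts.trans hκ) v
  · have hd : ∀ y, fderiv ℝ ψ y v = - fderiv ℝ (κ.normed volume) (l • x - y) v := by
      intro y
      have h1 := ((hk.differentiable (by simp)) (l • x - y)).hasFDerivAt.comp y
        ((hasFDerivAt_id y).const_sub (l • x))
      have h2 : fderiv ℝ ψ y = _ := h1.fderiv
      rw [h2]
      simp
    have e1 : ∫ y, fderiv ℝ (κ.normed volume) (l • x - y) v * Ω.indicator u.toFun y =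
        - ∫ y in Ω, u.toFun y * fderiv ℝ ψ y v := by
      rw [← integral_neg, ← integral_indicator hΩm]
      refine integral_congr_ae (Eventually.of_forall fun y => ?_)
      by_cases hy : y ∈ Ω
      · simp [hy, hd, mul_comm]
      · simp [hy]
    have e2 : (fun y => κ.normed volume (l • x - y) • Ω.indicator u.grad y) =
        Ω.indicator fun y => ψ y • u.grad y := by
      funext y
      by_cases hy : y ∈ Ω <;> simp [hy, hψ]
    rw [e1, hw, neg_neg, e2, integral_indicator hΩm, real_inner_comm, ← integral_inner]
    · refine integral_congr_ae (Eventually.of_forall fun y => ?_)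
      simp only [inner_smul_right, real_inner_comm v, mul_comm]
    · have hψc : Continuous ψ := κ.continuous_normed.comp (continuous_const.sub continuous_id)
      obtain ⟨C, hC⟩ := hΩb.isCompact_closure.exists_bound_of_continuousOn hψc.continuousOn
      refine hgi.bdd_smul C hψc.aestronglyMeasurable ?_
      filter_upwards [ae_restrict_mem hΩm] with y hy using hC y (subset_closure hy)
  · refine HasCompactSupport.intro (K := closure Ω) hΩb.isCompact_closure fun y hy => ?_
    by_contra h
    exact hy (subset_closure (hκ y (hts (subset_tsupport _ h))))

end Derivative

/-- Smooth approximation in `W^{1,p}` of a bounded convex domain by functions on the whole space. -/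
theorem exists_contDiff_tendsto (hΩo : IsOpen Ω) (hΩc : Convex ℝ Ω) (hΩb : Bornology.IsBounded Ω)
    (hne : Ω.Nonempty) {p : ℝ} (hp : 1 ≤ p) (u : SobolevFunction Ω p) :
    ∃ φ : ℕ → E → ℝ, (∀ k, ContDiff ℝ 1 (φ k)) ∧
      Tendsto (fun k => eLpNorm (fun x => φ k x - u.toFun x) (ENNReal.ofReal p)
        (volume.restrict Ω)) atTop (𝓝 0) ∧
      Tendsto (fun k => eLpNorm (fun x => gradient (φ k) x - u.grad x) (ENNReal.ofReal p)
        (volume.restrict Ω)) atTop (𝓝 0) := by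
  have hp' : 1 ≤ ENNReal.ofReal p := by simpa using hp
  have hΩm := hΩo.measurableSet
  obtain ⟨x0, hx0⟩ := hne
  obtain ⟨r, hr, hball⟩ := Metric.nhds_basis_closedBall.mem_iff.mp (hΩo.mem_nhds hx0)
  have : IsFiniteMeasure (volume.restrict Ω : Measure E) := ⟨by simpa using hΩb.measure_lt_top⟩
  set s : ℕ → ℝ := fun k => 1 / ((k : ℝ) + 2) with hs
  have hs0 : ∀ k, 0 < s k := fun k => by simp only [hs]; positivity
  have hs1 : ∀ k, s k ≤ 1 / 2 := fun k => by
    simp only [hs]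
    refine one_div_le_one_div_of_le two_pos ?_
    have : (0 : ℝ) ≤ k := k.cast_nonneg
    linarith
  have hst : Tendsto s atTop (𝓝 0) := by
    have h : Tendsto (fun k : ℕ => (k : ℝ) + 2) atTop atTop :=
      tendsto_atTop_add_const_right _ _ tendsto_natCast_atTop_atTop
    exact h.inv_tendsto_atTop.congr fun k => (one_div _).symm
  -- The centre `-(s k • x0)` makes the value at `x` an average over points `(1 - s k) • x + s k •
  -- z` with `z` in a ball around `x0` inside `Ω`. By convexity these points stay in `Ω`, so no
  -- extension of `u` is required.
  let κ : ∀ k, ContDiffBump (-(s k • x0)) := fun k =>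
    ⟨s k * r / 2, s k * r, by have := hs0 k; positivity, by
      have := mul_pos (hs0 k) hr; linarith⟩
  set l : ℕ → ℝ := fun k => 1 - s k with hl
  have hl2 : ∀ k, 1 / 2 ≤ l k := fun k => by have := hs1 k; simp only [hl]; linarith
  have hl1 : Tendsto l atTop (𝓝 1) := by simpa [hl] using hst.const_sub 1
  have hR : Tendsto (fun k => s k * (‖x0‖ + r)) atTop (𝓝 0) := by
    simpa using hst.mul_const (‖x0‖ + r)
  have hκ : ∀ k, Function.support ((κ k).normed volume) ⊆ Metric.ball 0 (s k * (‖x0‖ + r)) := by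
    intro k
    rw [(κ k).support_normed_eq]
    refine Metric.ball_subset_ball' ?_
    change s k * r + dist (-(s k • x0)) 0 ≤ _
    rw [dist_zero_right, norm_neg, norm_smul, Real.norm_of_nonneg (hs0 k).le]
    linarith
  have hF : MemLp (Ω.indicator u.toFun) (ENNReal.ofReal p) volume :=
    (memLp_indicator_iff_restrict hΩm).mpr u.memLp
  have hG : MemLp (Ω.indicator u.grad) (ENNReal.ofReal p) volume :=
    (memLp_indicator_iff_restrict hΩm).mpr u.memLp_grad
  have hgrad : ∀ k, ∀ x ∈ Ω, gradient (dilatedMollification (κ k) (l k) (Ω.indicator u.toFun)) x =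
      l k • dilatedMollification (κ k) (l k) (Ω.indicator u.grad) x := by
    intro k x hx
    refine gradient_dilatedMollification hp hΩm hΩb u (κ k) fun y hy => ?_
    have hy' : ‖l k • x - y + s k • x0‖ ≤ s k * r := by
      simpa [dist_eq_norm] using hy
    set z : E := (s k)⁻¹ • (y - l k • x) with hz
    have hyz : y = l k • x + s k • z := by
      rw [hz, smul_inv_smul₀ (hs0 k).ne']; abel
    have hzΩ : z ∈ Ω := by
      refine hball ?_
      rw [mem_closedBall_iff_norm]
      have e : l k • x - y + s k • x0 = (-(s k)) • (z - x0) := by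
        rw [hyz]; module
      rw [e, norm_smul, norm_neg, Real.norm_of_nonneg (hs0 k).le] at hy'
      exact le_of_mul_le_mul_left hy' (hs0 k)
    rw [hyz]
    exact hΩc hx hzΩ (by have := hl2 k; linarith) (hs0 k).le (by simp [hl])
  have hTF := tendsto_eLpNorm_dilatedMollification_sub hΩb hΩm κ hl2 hl1 hR hκ hp hF
  have hTG := tendsto_eLpNorm_dilatedMollification_sub hΩb hΩm κ hl2 hl1 hR hκ hp hG
  refine ⟨fun k => dilatedMollification (κ k) (l k) (Ω.indicator u.toFun), fun k =>
    contDiff_dilatedMollification _ _ (hF.locallyIntegrable hp'), ?_, ?_⟩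
  · refine hTF.congr fun k => eLpNorm_congr_ae ?_
    filter_upwards [ae_restrict_mem hΩm] with x hx
    simp [hx]
  · have hb : ∀ k, eLpNorm (fun x =>
        gradient (dilatedMollification (κ k) (l k) (Ω.indicator u.toFun)) x - u.grad x)
          (ENNReal.ofReal p) (volume.restrict Ω) ≤
        eLpNorm (fun x => dilatedMollification (κ k) (l k) (Ω.indicator u.grad) x -
          Ω.indicator u.grad x) (ENNReal.ofReal p) (volume.restrict Ω) +
        ENNReal.ofReal (s k) * eLpNorm u.grad (ENNReal.ofReal p) (volume.restrict Ω) := by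
      intro k
      have hTm : AEStronglyMeasurable (dilatedMollification (κ k) (l k) (Ω.indicator u.grad))
          (volume.restrict Ω) := by
        have h := ((κ k).hasCompactSupport_normed (μ := volume)).continuous_convolution_left
          (μ := volume)
          (ContinuousLinearMap.lsmul ℝ ℝ) (κ k).continuous_normed (hG.locallyIntegrable hp')
        exact (h.comp (continuous_const_smul (l k))).aestronglyMeasurable
      set A : E → E := fun x => dilatedMollification (κ k) (l k) (Ω.indicator u.grad) x -
        Ω.indicator u.grad x with hA
      have hAm : AEStronglyMeasurable A (volume.restrict Ω) := hTm.sub hG.1.restrict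
      -- Since `l = 1 - s`, the gradient error is `l` times the mollification error of `u.grad`,
      -- minus `s` times `u.grad` itself.
      have e : (fun x => gradient (dilatedMollification (κ k) (l k) (Ω.indicator u.toFun)) x -
          u.grad x) =ᵐ[volume.restrict Ω] l k • A + (-(s k)) • u.grad := by
        filter_upwards [ae_restrict_mem hΩm] with x hx
        rw [hgrad k x hx]
        simp only [hA, hl, Pi.add_apply, Pi.smul_apply, Set.indicator_of_mem hx]
        module
      have hl1' : ‖l k‖ₑ ≤ 1 := by
        rw [Real.enorm_eq_ofReal (by have := hl2 k; linarith)]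
        exact ENNReal.ofReal_le_one.mpr (by have := hs0 k; simp only [hl]; linarith)
      rw [eLpNorm_congr_ae e]
      refine (eLpNorm_add_le (hAm.const_smul _) (u.memLp_grad.1.const_smul _) hp').trans ?_
      rw [eLpNorm_const_smul, eLpNorm_const_smul, enorm_neg, Real.enorm_eq_ofReal (hs0 k).le]
      exact add_le_add_left (mul_le_of_le_one_left' hl1') _
    have hs2 : Tendsto (fun k => ENNReal.ofReal (s k) *
        eLpNorm u.grad (ENNReal.ofReal p) (volume.restrict Ω)) atTop (𝓝 0) := by
      have h := ENNReal.Tendsto.mul_const (ENNReal.tendsto_ofReal hst)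
        (Or.inr u.memLp_grad.2.ne)
      simpa using h
    refine tendsto_of_tendsto_of_tendsto_of_le_of_le tendsto_const_nhds ?_ (fun _ => zero_le) hb
    simpa using hTG.add hs2

theorem Continuous.memLp_of_ae_mem_isCompact {V : Type} [NormedAddCommGroup V]
    [SecondCountableTopology V] {f : E → V} (hf : Continuous f) {μ : Measure E}
    [IsFiniteMeasure μ] {K : Set E} (hK : IsCompact K) (hμ : ∀ᵐ x ∂μ, x ∈ K) (q : ENNReal) :
    MemLp f q μ := by
  obtain ⟨B, hB⟩ := hK.exists_bound_of_continuousOn hf.continuousOn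
  exact MemLp.of_bound hf.aestronglyMeasurable B (hμ.mono hB)

/-- The trace exists. -/
theorem SobolevFunction.isTrace_trace (hΩ : HasC2Boundary Ω) (hΩo : IsOpen Ω) (hΩc : Convex ℝ Ω)
    (hΩb : Bornology.IsBounded Ω) (hne : Ω.Nonempty) {p : ℝ} (hp : 1 < p)
    (u : SobolevFunction Ω p) : u.IsTrace u.trace := by
  have hp' : 1 ≤ ENNReal.ofReal p := by simpa using hp.le
  have : Fact (1 ≤ ENNReal.ofReal p) := ⟨hp'⟩
  -- The trace is a choice, so it has the defining property as soon as some function has it.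
  refine Classical.epsilon_spec (p := u.IsTrace) ?_
  obtain ⟨φ, hφ, h1, h2⟩ := exists_contDiff_tendsto hΩo hΩc hΩb hne hp.le u
  obtain ⟨C, hC⟩ := exists_eLpNorm_trace hΩ hΩo hΩc hΩb hp
  have := isFiniteMeasure_surfaceMeasure hΩ hΩo hΩc hΩb
  have hgc : ∀ k, Continuous (gradient (φ k)) := fun k =>
    (InnerProductSpace.toDual ℝ E).symm.continuous.comp ((hφ k).continuous_fderiv one_ne_zero)
  have hmem : ∀ k, MemLp (φ k) (ENNReal.ofReal p) (surfaceMeasure Ω) := fun k =>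
    (hφ k).continuous.memLp_of_ae_mem_isCompact (isCompact_frontier_of_isBounded hΩb)
      (ae_surfaceMeasure_mem_frontier Ω) _
  set e : ℕ → ENNReal := fun k =>
    eLpNorm (fun x => φ k x - u.toFun x) (ENNReal.ofReal p) (volume.restrict Ω) +
    eLpNorm (fun x => gradient (φ k) x - u.grad x) (ENNReal.ofReal p) (volume.restrict Ω) with he
  have het : Tendsto e atTop (𝓝 0) := by simpa using h1.add h2
  -- The trace inequality for differences makes the boundary values Cauchy in `L^p` of the surface
  -- measure; completeness supplies the limit.
  have hcau : ∀ i j, eLpNorm (φ i - φ j) (ENNReal.ofReal p) (surfaceMeasure Ω) ≤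
      C * (e i + e j) := by
    intro i j
    have hgr : gradient (φ i - φ j) = gradient (φ i) - gradient (φ j) := by
      funext x
      simp only [gradient, Pi.sub_apply, ← map_sub]
      rw [fderiv_sub ((hφ i).differentiable one_ne_zero x) ((hφ j).differentiable one_ne_zero x)]
    refine (hC (φ i - φ j) ((hφ i).sub (hφ j))).trans (mul_le_mul_right ?_ _)
    rw [hgr, he]
    have t1 : eLpNorm (φ i - φ j) (ENNReal.ofReal p) (volume.restrict Ω) ≤
        eLpNorm (fun x => φ i x - u.toFun x) (ENNReal.ofReal p) (volume.restrict Ω) +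
        eLpNorm (fun x => φ j x - u.toFun x) (ENNReal.ofReal p) (volume.restrict Ω) := by
      have : φ i - φ j = (φ i - u.toFun) - (φ j - u.toFun) := by abel
      rw [this]
      exact eLpNorm_sub_le ((hφ i).continuous.aestronglyMeasurable.sub u.memLp.1)
        ((hφ j).continuous.aestronglyMeasurable.sub u.memLp.1) hp'
    have t2 : eLpNorm (gradient (φ i) - gradient (φ j)) (ENNReal.ofReal p) (volume.restrict Ω) ≤
        eLpNorm (fun x => gradient (φ i) x - u.grad x) (ENNReal.ofReal p) (volume.restrict Ω) +
        eLpNorm (fun x => gradient (φ j) x - u.grad x) (ENNReal.ofReal p)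
          (volume.restrict Ω) := by
      have : gradient (φ i) - gradient (φ j) =
        (gradient (φ i) - u.grad) - (gradient (φ j) - u.grad) := by abel
      rw [this]
      exact eLpNorm_sub_le ((hgc i).aestronglyMeasurable.sub u.memLp_grad.1)
        ((hgc j).aestronglyMeasurable.sub u.memLp_grad.1) hp'
    refine (add_le_add t1 t2).trans_eq ?_
    ring
  have hCS : CauchySeq fun k => (hmem k).toLp (φ k) := by
    rw [Lp.cauchySeq_Lp_iff_cauchySeq_eLpNorm]
    have hz : Tendsto (fun k : ℕ × ℕ => (C : ENNReal) * (e k.1 + e k.2)) atTop (𝓝 0) := by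
      rw [← prod_atTop_atTop_eq]
      have := ENNReal.Tendsto.const_mul (a := (C : ENNReal))
        ((het.comp tendsto_fst).add (het.comp (tendsto_snd (f := (atTop : Filter ℕ)))))
        (Or.inr ENNReal.coe_ne_top)
      simpa using this
    refine tendsto_of_tendsto_of_tendsto_of_le_of_le tendsto_const_nhds hz (fun _ => zero_le)
      fun k => le_of_eq_of_le (eLpNorm_congr_ae ?_) (hcau k.1 k.2)
    exact (hmem k.1).coeFn_toLp.sub (hmem k.2).coeFn_toLp
  obtain ⟨g, hg⟩ := cauchySeq_tendsto_of_complete hCS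
  refine ⟨g, Lp.memLp g, φ, hφ, h1, h2, ?_⟩
  rw [← Lp.toLp_coeFn g (Lp.memLp g), Lp.tendsto_Lp_iff_tendsto_eLpNorm''] at hg
  exact hg

/-- The integral is the `p`-th power of the `L^p` norm of `w ^ (1 / p) * N (f x)`, and this function
depends on `f` in a Lipschitz way in `L^p` because `w` is bounded. One statement serves the Hardy,
gradient and boundary terms. -/
theorem tendsto_integral_rpow_mul {V : Type} [NormedAddCommGroup V] {μ : Measure E}
    {p : ℝ} (hp : 1 ≤ p) {f : ℕ → E → V} {g : E → V}
    (hf : ∀ k, MemLp (f k) (ENNReal.ofReal p) μ) (hg : MemLp g (ENNReal.ofReal p) μ)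
    (hfg : Tendsto (fun k => eLpNorm (fun x => f k x - g x) (ENNReal.ofReal p) μ) atTop (𝓝 0))
    {N : V → ℝ} {K : NNReal} (hN : LipschitzWith K N) (hN0 : N 0 = 0) (hNn : ∀ v, 0 ≤ N v)
    {w : E → ℝ} (hw : AEStronglyMeasurable w μ) {B : ℝ} (hwB : ∀ᵐ x ∂μ, 0 ≤ w x ∧ w x ≤ B) :
    Tendsto (fun k => ∫ x, N (f k x) ^ p * w x ∂μ) atTop (𝓝 (∫ x, N (g x) ^ p * w x ∂μ)) := by
  have hp0 : 0 < p := by linarith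
  have : Fact (1 ≤ ENNReal.ofReal p) := ⟨by simpa using hp⟩
  set v : E → ℝ := fun x => w x ^ (1 / p) with hv
  have hvm : AEStronglyMeasurable v μ := (hw.aemeasurable.pow_const _).aestronglyMeasurable
  have hvB : ∀ᵐ x ∂μ, ‖v x‖ ≤ B ^ (1 / p) := by
    filter_upwards [hwB] with x hx
    rw [Real.norm_of_nonneg (Real.rpow_nonneg hx.1 _)]
    exact Real.rpow_le_rpow hx.1 hx.2 (by positivity)
  have hmem : ∀ {h : E → V}, MemLp h (ENNReal.ofReal p) μ →
      MemLp (fun x => v x * N (h x)) (ENNReal.ofReal p) μ := by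
    intro h hh
    exact (hN.comp_memLp hN0 hh).of_le_mul (c := B ^ (1 / p))
      (hvm.mul (hN.continuous.comp_aestronglyMeasurable hh.1)) (by
        filter_upwards [hvB] with x hx
        rw [norm_mul]
        exact mul_le_mul_of_nonneg_right hx (norm_nonneg _))
  have hint : ∀ {h : E → V} (hh : MemLp h (ENNReal.ofReal p) μ),
      ∫ x, N (h x) ^ p * w x ∂μ = ‖(hmem hh).toLp _‖ ^ p := by
    intro h hh
    rw [Lp.norm_toLp, (hmem hh).eLpNorm_eq_integral_rpow_norm (by simpa using hp0)
      ENNReal.ofReal_ne_top, ENNReal.toReal_ofReal hp0.le, ENNReal.toReal_ofReal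
      (Real.rpow_nonneg (integral_nonneg fun x => by positivity) _), Real.rpow_inv_rpow
      (integral_nonneg fun x => by positivity) hp0.ne']
    refine integral_congr_ae ?_
    filter_upwards [hwB] with x hx
    have hvn : 0 ≤ v x := Real.rpow_nonneg hx.1 _
    rw [Real.norm_of_nonneg (mul_nonneg hvn (hNn _)), Real.mul_rpow hvn (hNn _), hv,
      ← Real.rpow_mul hx.1, one_div_mul_cancel hp0.ne', Real.rpow_one, mul_comm]
  simp only [hint hg, hint (hf _)]
  refine Tendsto.rpow_const (Tendsto.norm ?_) (Or.inr hp0.le)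
  rw [Lp.tendsto_Lp_iff_tendsto_eLpNorm'']
  have hb : ∀ k, eLpNorm ((fun x => v x * N (f k x)) - fun x => v x * N (g x))
      (ENNReal.ofReal p) μ ≤ ENNReal.ofReal (B ^ (1 / p) * K) *
        eLpNorm (fun x => f k x - g x) (ENNReal.ofReal p) μ := by
    intro k
    refine eLpNorm_le_mul_eLpNorm_of_ae_le_mul ?_ _
    filter_upwards [hvB] with x hx
    rw [Pi.sub_apply, ← mul_sub, norm_mul, mul_assoc]
    exact mul_le_mul hx (hN.norm_sub_le _ _) (norm_nonneg _) ((norm_nonneg _).trans hx)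
  refine tendsto_of_tendsto_of_tendsto_of_le_of_le tendsto_const_nhds ?_ (fun _ => zero_le) hb
  simpa using ENNReal.Tendsto.const_mul hfg (Or.inr ENNReal.ofReal_ne_top)

end Approximation

/-! ### The inequality in the Sobolev space -/

theorem mainTheorem9 (n : ℕ) (hn : 2 ≤ n) (p : ℝ) (hp : 1 < p)
    (H : EuclideanSpace ℝ (Fin n) → ℝ) (hH : IsAnisotropy H) (hell : IsUniformlyElliptic p H)
    (hcurv : HasPositiveGaussCurvature (polar H))
    (Ω : Set (EuclideanSpace ℝ (Fin n))) (hΩo : IsOpen Ω) (hΩb : Bornology.IsBounded Ω)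
    (hΩc : Convex ℝ Ω) (hΩ2 : HasC2Boundary Ω)
    (α ϑ : ℝ) (hα : 0 < α) (hϑ : 0 < ϑ) (u : SobolevFunction Ω p) :
    (p - 1) * (α * ϑ) ^ (p - 1) * (1 - α * ϑ) *
        ∫ x in Ω, |u.toFun x| ^ p / (anisotropicDist H Ω x + α) ^ p ≤
      (∫ x in Ω, H (u.grad x) ^ p) +
        ϑ ^ (p - 1) * ∫ x, |u.trace x| ^ p * H (outerUnitNormal Ω x) ∂(surfaceMeasure Ω) := by
  rcases Ω.eq_empty_or_nonempty with rfl | hne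
  · simp [surfaceMeasure]
  have hnf := nonempty_frontier_of_isBounded (by omega) hΩb hne
  have hΩm := hΩo.measurableSet
  have hp0 : 0 < p := by linarith
  have : IsFiniteMeasure (volume.restrict Ω) := ⟨by simpa using hΩb.measure_lt_top⟩
  have := isFiniteMeasure_surfaceMeasure hΩ2 hΩo hΩc hΩb
  -- A single sequence converges in the domain, in gradient and on the boundary, so the `C¹`
  -- inequality passes to the limit term by term.
  obtain ⟨htr, φ, hφ, h1, h2, h3⟩ :=
    u.isTrace_trace hΩ2 hΩo hΩc hΩb hne hp
  have hgc : ∀ k, Continuous (gradient (φ k)) := fun k =>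
    (InnerProductSpace.toDual ℝ _).symm.continuous.comp ((hφ k).continuous_fderiv one_ne_zero)
  have hcl : ∀ᵐ x ∂(volume.restrict Ω), x ∈ closure Ω := by
    filter_upwards [ae_restrict_mem hΩm] with x hx using subset_closure hx
  have hm1 : ∀ k, MemLp (φ k) (ENNReal.ofReal p) (volume.restrict Ω) := fun k =>
    (hφ k).continuous.memLp_of_ae_mem_isCompact hΩb.isCompact_closure hcl _
  have hm2 : ∀ k, MemLp (gradient (φ k)) (ENNReal.ofReal p) (volume.restrict Ω) := fun k =>
    (hgc k).memLp_of_ae_mem_isCompact hΩb.isCompact_closure hcl _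
  have hm3 : ∀ k, MemLp (φ k) (ENNReal.ofReal p) (surfaceMeasure Ω) := fun k =>
    (hφ k).continuous.memLp_of_ae_mem_isCompact (isCompact_frontier_of_isBounded hΩb)
      (ae_surfaceMeasure_mem_frontier Ω) _
  have habs : LipschitzWith 1 fun t : ℝ => |t| := lipschitzWith_one_norm
  obtain ⟨K, hK⟩ := hH.exists_lipschitz
  obtain ⟨K', hK'⟩ := exists_lipschitz_supportDist hH hΩ2 hΩb hnf
  obtain ⟨a, b, ha, hab, hHb⟩ := hH.comparable
  have l1 : Tendsto (fun k => ∫ x in Ω, |φ k x| ^ p / (anisotropicDist H Ω x + α) ^ p) atTop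
      (𝓝 (∫ x in Ω, |u.toFun x| ^ p / (anisotropicDist H Ω x + α) ^ p)) := by
    -- With the absolute value the weight is measurable and bounded by `(α ^ p)⁻¹` on the whole
    -- space.
    set w : EuclideanSpace ℝ (Fin n) → ℝ := fun x => ((|supportDist H Ω x| + α) ^ p)⁻¹ with hw
    have hwm : Measurable w :=
      (((hK'.continuous.abs.measurable).add_const α).pow_const p).inv
    have h := tendsto_integral_rpow_mul hp.le hm1 u.memLp h1 habs abs_zero (fun t => abs_nonneg t)
      hwm.aestronglyMeasurable (B := (α ^ p)⁻¹) (Eventually.of_forall fun x =>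
        ⟨by simp only [hw]; positivity, inv_anti₀ (by positivity)
          (Real.rpow_le_rpow hα.le (by linarith [abs_nonneg (supportDist H Ω x)]) hp0.le)⟩)
    have e : ∀ f : EuclideanSpace ℝ (Fin n) → ℝ,
        ∫ x in Ω, |f x| ^ p / (anisotropicDist H Ω x + α) ^ p = ∫ x in Ω, |f x| ^ p * w x := by
      refine fun f => setIntegral_congr_fun hΩm fun x hx => ?_
      simp only [hw, div_eq_mul_inv,
        anisotropicDist_eq_supportDist hH hΩ2 hΩb hΩo hΩc hnf hx,
        abs_of_pos (supportDist_pos hH hΩ2 hΩb hΩo hΩc hnf hx)]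
    simpa only [e] using h
  have l2 : Tendsto (fun k => ∫ x in Ω, H (gradient (φ k) x) ^ p) atTop
      (𝓝 (∫ x in Ω, H (u.grad x) ^ p)) := by
    have h := tendsto_integral_rpow_mul hp.le hm2 u.memLp_grad h2 hK hH.map_zero hH.nonneg
      (w := fun _ => 1) aestronglyMeasurable_const (B := 1)
      (Eventually.of_forall fun x => ⟨zero_le_one, le_rfl⟩)
    simpa only [mul_one] using h
  have l3 : Tendsto (fun k => ∫ x, |φ k x| ^ p * H (outerUnitNormal Ω x) ∂(surfaceMeasure Ω))
      atTop (𝓝 (∫ x, |u.trace x| ^ p * H (outerUnitNormal Ω x) ∂(surfaceMeasure Ω))) := by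
    refine tendsto_integral_rpow_mul hp.le hm3 htr h3 habs abs_zero (fun t => abs_nonneg t)
      (hK.continuous.measurable.comp_aemeasurable
        (aemeasurable_outerUnitNormal hΩ2)).aestronglyMeasurable (B := b) ?_
    filter_upwards [ae_surfaceMeasure_mem_frontier Ω] with x hx
    refine ⟨hH.nonneg _, (hHb _).2.trans_eq ?_⟩
    rw [norm_outerUnitNormal hΩ2 hx, mul_one]
  exact le_of_tendsto_of_tendsto' (l1.const_mul _) (l2.add (l3.const_mul _)) fun k =>
    hardy_of_contDiff hH hp hΩo hΩb hΩc hΩ2 hne hnf hα hϑ (hφ k)
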